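/- All multigraphs are finite; parallel edges and loops are allowed. For a multigraph $G$ and a vertex $v$, let $d(v)$ be the number of edges incident with $v$ (a loop at $v$ counts once). For distinct vertices $u,v$ let $\mu(uv)$ be the number of edges between $u$ and $v$, let $N(u)$ be the set of vertices adjacent to $u$, and let $$t(uv)=\max_{w\in (N(u)\cap N(v))\setminus\{u,v\}}\bigl(\mu(uv)+\mu(uw)+\mu(vw)\bigr),$$ with $t(uv)=0$ if there is no such $w$. Let $$\gamma'_l(G)=\max_{uv\in E(G)}\left\lceil\max\left\{d(u)+\tfrac12\bigl(d(v)-\mu(uv)\bigr),\ d(v)+\tfrac12\bigl(d(u)-\mu(uv)\bigr),\ \tfrac12\bigl(d(u)+d(v)-\mu(uv)+t(uv)\bigr)\right\}\right\rceil ,$$ where a loop at $u$ contributes the value $d(u)$ to the outer maximum, and $\gamma'_l(G)=0$ if $G$ has no edges. A $k$-edge-colouring of $G$ assigns one of $k$ colours to every edge so that any two distinct edges with a common endpoint get different colours, and $\chi'(G)$ is the least $k$ for which $G$ has a $k$-edge-colouring. **Theorem.** For every finite multigraph $G$, $\chi'(G)\le\gamma'_l(G)$. Moreover, there is an algorithm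 which, given the list of the pairs of endpoints of the edges of a multigraph $G$ with $m$ edges, finds a $\gamma'_l(G)$-edge-colouring of $G$ in $O(m^2)$ time. Precisely: there are a single program for the word RAM (unit cost per elementary operation, addition and truncated subtraction as the only arithmetic, memory initialised to $0$) and constants $C,D$ such that for every multigraph $G$ with vertices $0,\dots,n-1$ and edges $0,\dots,m-1$, given by $n$, $m$ and the two endpoints of each edge, the program halts after at most $C(m^2+1)$ steps, produces no number larger than $(n+m+2)^D$ on the way, and outputs a $\gamma'_l(G)$-edge-colouring of $G$. -/

import Mathlib

open scoped Graph

namespace Graph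

universe u v

variable {α : Type u} {β : Type v}

/-- The degree `d(x)`: the number of edges incident with `x` (a loop at `x` is one such edge). -/
noncomputable def degreeOf (G : Graph α β) (x : α) : ℕ := (G.incidenceSet x).ncard

/-- The multiplicity `μ(xy)`: the number of edges between `x` and `y`. -/
noncomputable def mult (G : Graph α β) (x y : α) : ℕ := {e : β | G.IsLink e x y}.ncard

/-- `t(xy)`: the largest number of edges in a triangle on `x`, `y` and a common neighbour `w` other
than `x` and `y`; it is `0` when there is no such `w`. -/
noncomputable def triangleMult (G : Graph α β) (x y : α) : ℕ :=
  sSup {j : ℕ | ∃ w, w ≠ x ∧ w ≠ y ∧ G.Adj x w ∧ G.Adj y w ∧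
    j = G.mult x y + G.mult x w + G.mult y w}

open Classical in
/-- The term of the bound that belongs to an edge with ends `x` and `y`.
A loop at `x` contributes the number of edges incident with `x`. -/
noncomputable def localBound (G : Graph α β) (x y : α) : ℚ :=
  if x = y then (G.degreeOf x : ℚ)
  else
    max ((G.degreeOf x : ℚ) + 1 / 2 * ((G.degreeOf y : ℚ) - (G.mult x y : ℚ)))
      (max ((G.degreeOf y : ℚ) + 1 / 2 * ((G.degreeOf x : ℚ) - (G.mult x y : ℚ)))
        (1 / 2 * ((G.degreeOf x : ℚ) + (G.degreeOf y : ℚ) - (G.mult x y : ℚ)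
          + (G.triangleMult x y : ℚ))))

/-- `γ'_l(G)`: the maximum over all edges of the rounded-up local bound (`0` without edges). -/
noncomputable def gammaLocal (G : Graph α β) : ℕ :=
  sSup {j : ℕ | ∃ e x y, G.IsLink e x y ∧ j = ⌈G.localBound x y⌉₊}

/-- `c` is a `k`-edge-colouring of `G`: the edges receive colours from `{0, …, k - 1}`, and
distinct edges with a common end receive different colours. -/
def IsEdgeColouring (G : Graph α β) (k : ℕ) (c : β → ℕ) : Prop :=
  (∀ e ∈ E(G), c e < k) ∧
    ∀ e f x, e ≠ f → G.Inc e x → G.Inc f x → c e ≠ c f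

/-- The chromatic index `χ'(G)`: the least `k` for which `G` has a `k`-edge-colouring
(`⊤` if there is none). -/
noncomputable def chromaticIndex (G : Graph α β) : ℕ∞ :=
  ⨅ k ∈ {k : ℕ | ∃ c : β → ℕ, G.IsEdgeColouring k c}, (k : ℕ∞)

end Graph

/-! ### A word RAM

Programs are built from assignments, array writes, sequencing, branching and loops. A memory state
consists of registers and arrays, all holding natural numbers; a program mentions finitely many
registers and arrays by name. The only arithmetic is addition and truncated subtraction. Each
elementary operation (constant, register read, array read, addition, subtraction, comparison,
Boolean connective, assignment, array write, branch) costs one time unit. Execution with word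
bound `W` is stuck as soon as a number exceeding `W` is produced. -/

namespace RAM

/-- A memory state: registers and arrays, each indexed by natural numbers. -/
structure State where
  reg : ℕ → ℕ
  arr : ℕ → ℕ → ℕ

/-- Write a register. -/
def State.setReg (s : State) (x v : ℕ) : State :=
  ⟨Function.update s.reg x v, s.arr⟩

/-- Write one cell of an array. -/
def State.setArr (s : State) (a i v : ℕ) : State :=
  ⟨s.reg, Function.update s.arr a (Function.update (s.arr a) i v)⟩

/-- Arithmetic expressions. `read a e` is the cell of array `a` at the index given by `e`. -/
inductive Expr where
  | const (c : ℕ)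
  | reg (x : ℕ)
  | read (a : ℕ) (e : Expr)
  | add (e₁ e₂ : Expr)
  | sub (e₁ e₂ : Expr)

/-- The value of an expression. -/
def Expr.eval (s : State) : Expr → ℕ
  | const c => c
  | reg x => s.reg x
  | read a e => s.arr a (e.eval s)
  | add e₁ e₂ => e₁.eval s + e₂.eval s
  | sub e₁ e₂ => e₁.eval s - e₂.eval s

/-- The number of operations needed to evaluate an expression. -/
def Expr.cost : Expr → ℕ
  | const _ => 1
  | reg _ => 1
  | read _ e => e.cost + 1
  | add e₁ e₂ => e₁.cost + e₂.cost + 1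
  | sub e₁ e₂ => e₁.cost + e₂.cost + 1

/-- Every number produced while evaluating the expression is at most `W`. -/
def Expr.Fits (W : ℕ) (s : State) : Expr → Prop
  | const c => c ≤ W
  | reg x => s.reg x ≤ W
  | read a e => e.Fits W s ∧ s.arr a (e.eval s) ≤ W
  | add e₁ e₂ => e₁.Fits W s ∧ e₂.Fits W s ∧ e₁.eval s + e₂.eval s ≤ W
  | sub e₁ e₂ => e₁.Fits W s ∧ e₂.Fits W s

/-- Tests. -/
inductive Test where
  | lt (e₁ e₂ : Expr)
  | eq (e₁ e₂ : Expr)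
  | not (b : Test)
  | and (b₁ b₂ : Test)

/-- The truth value of a test. -/
def Test.eval (s : State) : Test → Bool
  | lt e₁ e₂ => decide (e₁.eval s < e₂.eval s)
  | eq e₁ e₂ => decide (e₁.eval s = e₂.eval s)
  | not b => !(b.eval s)
  | and b₁ b₂ => b₁.eval s && b₂.eval s

/-- The number of operations needed to evaluate a test. -/
def Test.cost : Test → ℕ
  | lt e₁ e₂ => e₁.cost + e₂.cost + 1
  | eq e₁ e₂ => e₁.cost + e₂.cost + 1
  | not b => b.cost + 1
  | and b₁ b₂ => b₁.cost + b₂.cost + 1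

/-- Every number produced while evaluating the test is at most `W`. -/
def Test.Fits (W : ℕ) (s : State) : Test → Prop
  | lt e₁ e₂ => e₁.Fits W s ∧ e₂.Fits W s
  | eq e₁ e₂ => e₁.Fits W s ∧ e₂.Fits W s
  | not b => b.Fits W s
  | and b₁ b₂ => b₁.Fits W s ∧ b₂.Fits W s

/-- Programs. -/
inductive Prog where
  | skip
  | assign (x : ℕ) (e : Expr)
  | store (a : ℕ) (i e : Expr)
  | seq (p q : Prog)
  | ite (b : Test) (p q : Prog)
  | while (b : Test) (p : Prog)

/-- `Exec W p s t s'`: with word bound `W`, program `p` started in state `s` halts after exactly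
`t` time units in state `s'`. -/
inductive Exec (W : ℕ) : Prog → State → ℕ → State → Prop where
  | skip (s : State) : Exec W .skip s 1 s
  | assign (s : State) (x : ℕ) (e : Expr) (he : e.Fits W s) :
      Exec W (.assign x e) s (e.cost + 1) (s.setReg x (e.eval s))
  | store (s : State) (a : ℕ) (i e : Expr) (hi : i.Fits W s) (he : e.Fits W s) :
      Exec W (.store a i e) s (i.cost + e.cost + 1) (s.setArr a (i.eval s) (e.eval s))
  | seq (p q : Prog) (s s₁ s₂ : State) (t₁ t₂ : ℕ)
      (hp : Exec W p s t₁ s₁) (hq : Exec W q s₁ t₂ s₂) :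
      Exec W (.seq p q) s (t₁ + t₂) s₂
  | ite_true (b : Test) (p q : Prog) (s s₁ : State) (t : ℕ)
      (hb : b.Fits W s) (hv : b.eval s = true) (hp : Exec W p s t s₁) :
      Exec W (.ite b p q) s (b.cost + 1 + t) s₁
  | ite_false (b : Test) (p q : Prog) (s s₁ : State) (t : ℕ)
      (hb : b.Fits W s) (hv : b.eval s = false) (hq : Exec W q s t s₁) :
      Exec W (.ite b p q) s (b.cost + 1 + t) s₁
  | while_false (b : Test) (p : Prog) (s : State)
      (hb : b.Fits W s) (hv : b.eval s = false) :
      Exec W (.while b p) s (b.cost + 1) s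
  | while_true (b : Test) (p : Prog) (s s₁ s₂ : State) (t₁ t₂ : ℕ)
      (hb : b.Fits W s) (hv : b.eval s = true)
      (hp : Exec W p s t₁ s₁) (hw : Exec W (.while b p) s₁ t₂ s₂) :
      Exec W (.while b p) s (b.cost + 1 + t₁ + t₂) s₂

/-- The initial state for a multigraph with vertices `0, …, n - 1` and edges `0, …, m - 1` given by
an edge list: register `0` holds `m`, register `1` holds `n`, the first `m` cells of arrays `0`
and `1` hold the two ends of each edge, and everything else is `0`. -/
def edgeListInput (n m : ℕ) (a b : ℕ → ℕ) : State where
  reg x := if x = 0 then m else if x = 1 then n else 0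
  arr j i := if i < m then (if j = 0 then a i else if j = 1 then b i else 0) else 0

end RAM

/-! The edges are coloured one at a time, starting with no colours. A colour is added only when the
current number `k` violates `Bounds`, the local inequalities with denominators cleared. These are
monotone in the number of colours, so the final number is at most every `K` with `Bounds K`, and
`γ'_l(G)` is such a `K` (`bounds_gammaLocal`). It remains to show that for an uncoloured edge `e =
uv` of a proper partial colouring either `Bounds k` fails or `e` can be coloured after some
recolouring (`colourEdge_spec`).

Fans with two leaves suffice. Let `g = vw` and `g' = vw'` have colours missing at `u`, where `w` and
`w'` are distinct and differ from `u`. If two of `u, v, w, w'` miss a common colour, then `e` can be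
coloured: at once, or by passing the colour of a leaf to `e`, if one of the two is `v`, and
otherwise after a Kempe exchange on the path from `v` (`star_spec`). If no two do, the four disjoint
sets of missing colours contradict the pair inequalities (`Bounds.exists_common_of_star`).

Suppose there is only the leaf `g = vw`, even after its colour has been moved to `e` and `g` has
become the uncoloured edge. Then at `v` the colours missing at `u` occur only on edges to `w`, and
those missing at `w` only on edges to `u` (`hub_spec`). The same argument with centre `u` yields a
leaf `h = ux`. If `w = x`, the triangle inequality fails (`Bounds.false_of_triangle`). If `w ≠ x`,
all colours missing at `w` or `x` occur on edges between `u` and `v`, which are too few for these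
two sets to be disjoint (`Bounds.exists_common_of_path`). A common missing colour permits a direct
recolouring of the path `x u v w` (`Proper.recolour_path`). Loops are coloured last, where the
degree bound alone leaves a free colour.

Each edge costs boundedly many linear scans. A Kempe exchange is linear as well, because an
alternating walk never repeats a pair (vertex, colour) and only `2m` pairs are available. The
algorithm is written in a restricted language `Cmd` whose loops all run `m` times, so that its time
is read off from the nesting depth, which is 2, and its numbers stay bounded because the only
additions are increments of values below `m`. The bound on `χ'` comes from running the same
algorithm on an encoding of the graph. -/

namespace RAM

/-! ### Tests, and expressions that cannot overflow -/

/-- Disjunction of tests. -/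
def Test.or (b₁ b₂ : Test) : Test := .not (.and (.not b₁) (.not b₂))

theorem Test.eval_lt (s : State) (e f : Expr) :
    (Test.lt e f).eval s = true ↔ e.eval s < f.eval s := decide_eq_true_iff

theorem Test.eval_eq (s : State) (e f : Expr) :
    (Test.eq e f).eval s = true ↔ e.eval s = f.eval s := decide_eq_true_iff

theorem Test.eval_not (s : State) (b : Test) :
    (Test.not b).eval s = true ↔ ¬b.eval s = true := by
  simp [Test.eval]

theorem Test.eval_and (s : State) (b₁ b₂ : Test) :
    (Test.and b₁ b₂).eval s = true ↔ b₁.eval s = true ∧ b₂.eval s = true := by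
  simp [Test.eval]

theorem Test.eval_or (s : State) (b₁ b₂ : Test) :
    (Test.or b₁ b₂).eval s = true ↔ b₁.eval s = true ∨ b₂.eval s = true := by
  simp [Test.or, Test.eval]

/-- Expressions without additions whose constants are at most `1`. -/
def Expr.noAdd : Expr → Bool
  | const c => decide (c ≤ 1)
  | reg _ => true
  | read _ e => e.noAdd
  | add _ _ => false
  | sub e₁ e₂ => e₁.noAdd && e₂.noAdd

/-- Tests all of whose expressions are free of additions. -/
def Test.noAdd : Test → Bool
  | lt e₁ e₂ => e₁.noAdd && e₂.noAdd
  | eq e₁ e₂ => e₁.noAdd && e₂.noAdd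
  | not b => b.noAdd
  | and b₁ b₂ => b₁.noAdd && b₂.noAdd

/-- All numbers stored in the state are at most `W`. -/
def State.Bounded (W : ℕ) (s : State) : Prop :=
  (∀ x, s.reg x ≤ W) ∧ ∀ j i, s.arr j i ≤ W

/-- Without additions a value is a constant at most 1, a stored number, or something smaller, so a
bound on the memory bounds every intermediate result. -/
theorem Expr.fits_of_noAdd {W : ℕ} {s : State} (hW : 1 ≤ W) (hs : s.Bounded W) (e : Expr)
    (he : e.noAdd = true) : e.Fits W s ∧ e.eval s ≤ W := by
  induction e with
  | const c => simp [noAdd] at he; exact ⟨by simp [Fits]; omega, by simp [eval]; omega⟩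
  | reg x => exact ⟨hs.1 x, hs.1 x⟩
  | read j e ih => exact ⟨⟨(ih he).1, hs.2 _ _⟩, hs.2 _ _⟩
  | add e f => simp [noAdd] at he
  | sub e f ihe ihf =>
    simp only [noAdd, Bool.and_eq_true] at he
    exact ⟨⟨(ihe he.1).1, (ihf he.2).1⟩, (Nat.sub_le _ _).trans (ihe he.1).2⟩

theorem Test.fits_of_noAdd {W : ℕ} {s : State} (hW : 1 ≤ W) (hs : s.Bounded W) (b : Test)
    (hb : b.noAdd = true) : b.Fits W s := by
  induction b with
  | lt e f =>
    simp only [noAdd, Bool.and_eq_true] at hb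
    exact ⟨(e.fits_of_noAdd hW hs hb.1).1, (f.fits_of_noAdd hW hs hb.2).1⟩
  | eq e f =>
    simp only [noAdd, Bool.and_eq_true] at hb
    exact ⟨(e.fits_of_noAdd hW hs hb.1).1, (f.fits_of_noAdd hW hs hb.2).1⟩
  | not b ih => exact ih hb
  | and b c ihb ihc =>
    simp only [noAdd, Bool.and_eq_true] at hb
    exact ⟨ihb hb.1, ihc hb.2⟩

/-! ### A structured language with built-in time and word bounds -/

/-- Structured commands: the only loop runs a counter from `0` to the value of register `0`, and
the only addition is an increment of a register smaller than register `0`. -/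
inductive Cmd where
  | skip
  | assign (x : ℕ) (e : Expr)
  | store (j : ℕ) (i e : Expr)
  | incr (x : ℕ)
  | seq (p q : Cmd)
  | ite (b : Test) (p q : Cmd)
  | loop (r : ℕ) (p : Cmd)

namespace Cmd

/-- The program that implements a command. -/
def compile : Cmd → Prog
  | skip => .skip
  | assign x e => .assign x e
  | store j i e => .store j i e
  | incr x => .ite (.lt (.reg x) (.reg 0)) (.assign x (.add (.reg x) (.const 1))) .skip
  | seq p q => .seq p.compile q.compile
  | ite b p q => .ite b p.compile q.compile
  | loop r p => .seq (.assign r (.const 0))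
      (.while (.lt (.reg r) (.reg 0)) (.seq p.compile (.assign r (.add (.reg r) (.const 1)))))

/-- The effect of a command on the memory. -/
def run : Cmd → State → State
  | skip, s => s
  | assign x e, s => s.setReg x (e.eval s)
  | store j i e, s => s.setArr j (i.eval s) (e.eval s)
  | incr x, s => if s.reg x < s.reg 0 then s.setReg x (s.reg x + 1) else s
  | seq p q, s => q.run (p.run s)
  | ite b p q, s => if b.eval s then p.run s else q.run s
  | loop r p, s =>
      (fun s => (p.run s).setReg r ((p.run s).reg r + 1))^[s.reg 0] (s.setReg r 0)

/-- Whether a command may write register `x`. -/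
def writes : Cmd → ℕ → Bool
  | skip, _ => false
  | assign y _, x => x == y
  | store _ _ _, _ => false
  | incr y, x => x == y
  | seq p q, x => p.writes x || q.writes x
  | ite _ p q, x => p.writes x || q.writes x
  | loop r p, x => x == r || p.writes x

/-- Whether a command may write array `j`. -/
def writesArr : Cmd → ℕ → Bool
  | skip, _ => false
  | assign _ _, _ => false
  | store i _ _, j => j == i
  | incr _, _ => false
  | seq p q, j => p.writesArr j || q.writesArr j
  | ite _ p q, j => p.writesArr j || q.writesArr j
  | loop _ p, j => p.writesArr j

/-- Commands that leave register `0` and the counters of running loops alone and add only in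
increments. -/
def ok : Cmd → Bool
  | skip => true
  | assign x e => x != 0 && e.noAdd
  | store _ i e => i.noAdd && e.noAdd
  | incr x => x != 0
  | seq p q => p.ok && q.ok
  | ite b p q => b.noAdd && p.ok && q.ok
  | loop r p => r != 0 && !p.writes r && p.ok

/-- An upper bound for the running time when register `0` holds `m`. -/
def cost (m : ℕ) : Cmd → ℕ
  | skip => 1
  | assign _ e => e.cost + 1
  | store _ i e => i.cost + e.cost + 1
  | incr _ => 8
  | seq p q => p.cost m + q.cost m
  | ite b p q => b.cost + 1 + (p.cost m + q.cost m)
  | loop _ p => 2 + (m * (p.cost m + 8) + 4)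

/-- The nesting depth of loops. -/
def depth : Cmd → ℕ
  | skip => 0
  | assign _ _ => 0
  | store _ _ _ => 0
  | incr _ => 0
  | seq p q => max p.depth q.depth
  | ite _ p q => max p.depth q.depth
  | loop _ p => p.depth + 1

theorem reg_run {x : ℕ} (p : Cmd) (s : State) (h : p.writes x = false) :
    (p.run s).reg x = s.reg x := by
  induction p generalizing s with
  | skip => rfl
  | assign y e => simp [writes] at h; simp [run, State.setReg, h]
  | store j i e => rfl
  | incr y =>
    simp [writes] at h
    simp only [run]; split_ifs <;> simp [State.setReg, h]
  | seq p q ihp ihq => simp [writes] at h; simp [run, ihp _ h.1, ihq _ h.2]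
  | ite b p q ihp ihq =>
    simp [writes] at h; simp only [run]; split_ifs
    · exact ihp _ h.1
    · exact ihq _ h.2
  | loop r p ih =>
    simp [writes] at h
    simp only [run]
    have : ∀ n s, ((fun s => (p.run s).setReg r ((p.run s).reg r + 1))^[n] s).reg x = s.reg x := by
      intro n
      induction n with
      | zero => intro s; rfl
      | succ n ihn =>
        intro s
        rw [Function.iterate_succ_apply, ihn]
        simp [State.setReg, h.1, ih _ h.2]
    rw [this]; simp [State.setReg, h.1]

theorem arr_run {j : ℕ} (p : Cmd) (s : State) (h : p.writesArr j = false) :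
    (p.run s).arr j = s.arr j := by
  induction p generalizing s with
  | skip => rfl
  | assign y e => rfl
  | store i _ e => simp [writesArr] at h; simp [run, State.setArr, h]
  | incr y => simp only [run]; split_ifs <;> rfl
  | seq p q ihp ihq => simp [writesArr] at h; simp [run, ihp _ h.1, ihq _ h.2]
  | ite b p q ihp ihq =>
    simp [writesArr] at h; simp only [run]; split_ifs
    · exact ihp _ h.1
    · exact ihq _ h.2
  | loop r p ih =>
    simp [writesArr] at h
    simp only [run]
    have : ∀ n s, ((fun s => (p.run s).setReg r ((p.run s).reg r + 1))^[n] s).arr j = s.arr j := by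
      intro n
      induction n with
      | zero => intro s; rfl
      | succ n ihn =>
        intro s
        rw [Function.iterate_succ_apply, ihn]
        exact ih _ h
    rw [this]; rfl

theorem writes_zero (p : Cmd) (h : p.ok = true) : p.writes 0 = false := by
  induction p with
  | skip => rfl
  | assign y e => simp [ok] at h; simp [writes]; omega
  | store j i e => rfl
  | incr y => simp [ok] at h; simp [writes]; omega
  | seq p q ihp ihq => simp [ok] at h; simp [writes, ihp h.1, ihq h.2]
  | ite b p q ihp ihq => simp [ok] at h; simp [writes, ihp h.1.2, ihq h.2]
  | loop r p ih => simp [ok] at h; simp [writes, ih h.2]; omega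

theorem bounded_setReg {W x v : ℕ} {s : State} (hs : s.Bounded W) (hv : v ≤ W) :
    (s.setReg x v).Bounded W := by
  refine ⟨fun y => ?_, hs.2⟩
  simp only [State.setReg, Function.update_apply]
  split_ifs
  · exact hv
  · exact hs.1 y

theorem bounded_setArr {W j i v : ℕ} {s : State} (hs : s.Bounded W) (hv : v ≤ W) :
    (s.setArr j i v).Bounded W := by
  refine ⟨hs.1, fun j' i' => ?_⟩
  simp only [State.setArr, Function.update_apply]
  split_ifs
  · simp only [Function.update_apply]
    split_ifs
    · exact hv
    · exact hs.2 _ _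
  · exact hs.2 _ _

/-- A command runs within the word bound and within the time given by `cost`. -/
theorem exec {W : ℕ} (hW : 1 ≤ W) (p : Cmd) (hp : p.ok = true) (s : State) (hs : s.Bounded W) :
    ∃ t, Exec W p.compile s t (p.run s) ∧ t ≤ p.cost (s.reg 0) ∧ (p.run s).Bounded W := by
  induction p generalizing s with
  | skip => exact ⟨_, .skip s, le_rfl, hs⟩
  | assign x e =>
    simp [ok] at hp
    have h := e.fits_of_noAdd hW hs hp.2
    exact ⟨_, .assign s x e h.1, le_rfl, bounded_setReg hs h.2⟩
  | store j i e =>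
    simp [ok] at hp
    have h := e.fits_of_noAdd hW hs hp.2
    exact ⟨_, .store s j i e (i.fits_of_noAdd hW hs hp.1).1 h.1, le_rfl, bounded_setArr hs h.2⟩
  | incr x =>
    have hb : (Test.lt (.reg x) (.reg 0)).Fits W s := ⟨hs.1 _, hs.1 _⟩
    by_cases h : s.reg x < s.reg 0
    · have hv : s.reg x + 1 ≤ W := le_trans h (hs.1 0)
      have he := Exec.assign (W := W) s x (.add (.reg x) (.const 1)) ⟨hs.1 _, hW, hv⟩
      have hrun : (incr x).run s = s.setReg x (s.reg x + 1) := by simp [run, h]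
      rw [hrun]
      exact ⟨_, .ite_true _ _ _ _ _ _ hb ((Test.eval_lt _ _ _).2 h) he,
        by simp [Test.cost, Expr.cost, cost], bounded_setReg hs hv⟩
    · have hrun : (incr x).run s = s := by simp [run, h]
      rw [hrun]
      exact ⟨_, .ite_false _ _ _ _ _ _ hb (decide_eq_false h) (.skip s),
        by simp [Test.cost, Expr.cost, cost], hs⟩
  | seq p q ihp ihq =>
    simp [ok] at hp
    obtain ⟨t₁, h₁, c₁, b₁⟩ := ihp hp.1 s hs
    obtain ⟨t₂, h₂, c₂, b₂⟩ := ihq hp.2 _ b₁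
    rw [reg_run p s (writes_zero p hp.1)] at c₂
    exact ⟨_, .seq _ _ _ _ _ _ _ h₁ h₂, add_le_add c₁ c₂, b₂⟩
  | ite b p q ihp ihq =>
    simp [ok] at hp
    have hb := b.fits_of_noAdd hW hs hp.1.1
    by_cases h : b.eval s = true
    · obtain ⟨t₁, h₁, c₁, b₁⟩ := ihp hp.1.2 s hs
      have hrun : (ite b p q).run s = p.run s := by simp [run, h]
      rw [hrun]
      exact ⟨_, .ite_true _ _ _ _ _ _ hb h h₁, by simp only [cost]; omega, b₁⟩
    · obtain ⟨t₁, h₁, c₁, b₁⟩ := ihq hp.2 s hs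
      have hrun : (ite b p q).run s = q.run s := by simp [run, h]
      rw [hrun]
      exact ⟨_, .ite_false _ _ _ _ _ _ hb (by simpa using h) h₁, by simp only [cost]; omega, b₁⟩
  | loop r p ih =>
    simp [ok] at hp
    obtain ⟨⟨hr, hw⟩, hp⟩ := hp
    have hw0 := writes_zero p hp
    set f : State → State := fun s => (p.run s).setReg r ((p.run s).reg r + 1) with hf
    -- Induction on the number `n` of remaining iterations. Since counter plus `n` equals register
    -- `0`, the incremented counter stays within the word bound.
    have key : ∀ n s, s.Bounded W → s.reg r + n = s.reg 0 →
        ∃ t, Exec W (.while (.lt (.reg r) (.reg 0))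
          (.seq p.compile (.assign r (.add (.reg r) (.const 1))))) s t (f^[n] s) ∧
          t ≤ n * (p.cost (s.reg 0) + 8) + 4 ∧ (f^[n] s).Bounded W := by
      intro n
      induction n with
      | zero =>
        intro s hs h
        refine ⟨_, .while_false _ _ _ ⟨hs.1 _, hs.1 _⟩ ?_, ?_, hs⟩
        · exact decide_eq_false (by simp only [Expr.eval]; omega)
        · simp [Test.cost, Expr.cost]
      | succ n ihn =>
        intro s hs h
        obtain ⟨t₁, h₁, c₁, b₁⟩ := ih hp s hs
        have e0 := reg_run p s hw0
        have er := reg_run p s hw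
        have hv : (p.run s).reg r + 1 ≤ W := by
          have := hs.1 0
          omega
        have h₂ := Exec.assign (W := W) (p.run s) r (.add (.reg r) (.const 1))
          ⟨b₁.1 _, hW, hv⟩
        have hfs0 : (f s).reg 0 = s.reg 0 := by
          simp [hf, State.setReg, e0, Ne.symm hr]
        have hfsr : (f s).reg r = s.reg r + 1 := by
          simp [hf, State.setReg, er]
        obtain ⟨t₃, h₃, c₃, b₃⟩ := ihn (f s) (bounded_setReg b₁ hv) (by omega)
        refine ⟨_, .while_true _ _ _ _ _ _ _ ⟨hs.1 _, hs.1 _⟩ ?_ (.seq _ _ _ _ _ _ _ h₁ h₂) h₃,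
          ?_, b₃⟩
        · exact (Test.eval_lt _ _ _).2 (by simp only [Expr.eval]; omega)
        · rw [hfs0] at c₃
          simp only [Test.cost, Expr.cost]
          rw [Nat.succ_mul]
          omega
    have h0 := bounded_setReg (x := r) hs (Nat.zero_le W)
    have e0 : (s.setReg r 0).reg 0 = s.reg 0 := by simp [State.setReg, Ne.symm hr]
    obtain ⟨t, h, c, b⟩ := key (s.reg 0) (s.setReg r 0) h0 (by rw [e0]; simp [State.setReg])
    rw [e0] at c
    exact ⟨_, .seq _ _ _ _ _ _ _ (.assign s r (.const 0) (Nat.zero_le W)) h,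
      by simp only [Expr.cost, cost]; omega, b⟩

/-- Only a loop multiplies the cost by `m`, while sequencing and branching add, so the exponent is
the nesting depth. -/
theorem cost_le (p : Cmd) : ∃ C, ∀ m, p.cost m ≤ C * (m + 1) ^ p.depth := by
  have base : ∀ c : ℕ, ∃ C, ∀ m : ℕ, c ≤ C * (m + 1) ^ 0 := fun c => ⟨c, by simp⟩
  have mono : ∀ {C m d d' : ℕ}, d ≤ d' → C * (m + 1) ^ d ≤ C * (m + 1) ^ d' := fun h =>
    Nat.mul_le_mul_left _ (Nat.pow_le_pow_right (by omega) h)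
  induction p with
  | skip => exact base _
  | assign y e => exact base _
  | store j i e => exact base _
  | incr y => exact base _
  | seq p q ihp ihq =>
    obtain ⟨C₁, h₁⟩ := ihp
    obtain ⟨C₂, h₂⟩ := ihq
    refine ⟨C₁ + C₂, fun m => ?_⟩
    rw [add_mul]
    exact add_le_add ((h₁ m).trans (mono (le_max_left _ _))) ((h₂ m).trans (mono (le_max_right _ _)))
  | ite b p q ihp ihq =>
    obtain ⟨C₁, h₁⟩ := ihp
    obtain ⟨C₂, h₂⟩ := ihq
    refine ⟨b.cost + 1 + (C₁ + C₂), fun m => ?_⟩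
    rw [add_mul, add_mul C₁]
    exact add_le_add (Nat.le_mul_of_pos_right _ (by positivity))
      (add_le_add ((h₁ m).trans (mono (le_max_left _ _))) ((h₂ m).trans (mono (le_max_right _ _))))
  | loop r p ih =>
    obtain ⟨C, h⟩ := ih
    -- The overhead of a loop is 8 per iteration and 6 once.
    refine ⟨C + 14, fun m => ?_⟩
    have h1 : 1 ≤ (m + 1) ^ p.depth := Nat.one_le_pow _ _ (by omega)
    simp only [cost, depth, pow_succ]
    have := Nat.mul_le_mul_left m (h m)
    nlinarith [h m, Nat.mul_le_mul_left m h1]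

/-- Induction over the iterations of a loop, with the frame of the loop provided. -/
theorem loop_induct {r : ℕ} {p : Cmd} (hok : (loop r p).ok = true) (s : State)
    (I : ℕ → State → Prop) (h0 : I 0 (s.setReg r 0))
    (hstep : ∀ i s', i < s.reg 0 → s'.reg r = i →
      (∀ x, (loop r p).writes x = false → s'.reg x = s.reg x) →
      (∀ j, p.writesArr j = false → s'.arr j = s.arr j) →
      I i s' → I (i + 1) ((p.run s').setReg r (i + 1))) :
    I (s.reg 0) ((loop r p).run s) := by
  simp [ok] at hok
  obtain ⟨⟨hr, hw⟩, hp⟩ := hok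
  set f : State → State := fun s => (p.run s).setReg r ((p.run s).reg r + 1) with hf
  have key : ∀ i ≤ s.reg 0, I i (f^[i] (s.setReg r 0)) ∧ (f^[i] (s.setReg r 0)).reg r = i ∧
      (∀ x, (loop r p).writes x = false → (f^[i] (s.setReg r 0)).reg x = s.reg x) ∧
      (∀ j, p.writesArr j = false → (f^[i] (s.setReg r 0)).arr j = s.arr j) := by
    intro i
    induction i with
    | zero =>
      refine fun _ => ⟨h0, by simp [State.setReg], fun x hx => ?_, fun _ _ => rfl⟩
      simp [writes] at hx
      simp [State.setReg, hx.1]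
    | succ i ih =>
      intro hi
      obtain ⟨h1, h2, h3, h4⟩ := ih (by omega)
      have := hstep i _ (by omega) h2 h3 h4 h1
      rw [Function.iterate_succ_apply']
      set t := f^[i] (s.setReg r 0)
      have e : f t = (p.run t).setReg r (i + 1) := by
        simp [hf, reg_run p t hw, h2]
      refine ⟨e ▸ this, by simp [e, State.setReg], fun x hx => ?_, fun j hj => ?_⟩
      · rw [← h3 x hx, e]
        simp [writes] at hx
        simp [State.setReg, hx.1, reg_run p t hx.2]
      · rw [← h4 j hj, e]
        exact arr_run p t hj
  exact (key _ le_rfl).1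

end Cmd

end RAM

/-! ### Edge lists and the counting arguments -/

/-- A multigraph given by the two ends of each of its edges `0, …, m - 1`. -/
structure EdgeList (α : Type*) where
  m : ℕ
  a : ℕ → α
  b : ℕ → α

namespace EdgeList

variable {α : Type*} (L : EdgeList α)

/-- The edge `e` is incident with `x`. -/
def Inc (e : ℕ) (x : α) : Prop := e < L.m ∧ (L.a e = x ∨ L.b e = x)

/-- The number of edges incident with `x`. -/
noncomputable def deg (x : α) : ℕ := {e | L.Inc e x}.ncard

/-- The number of edges incident with both `x` and `y`. -/
noncomputable def mult (x y : α) : ℕ := {e | L.Inc e x ∧ L.Inc e y}.ncard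

/-- The local lower bounds on a number of colours, with denominators cleared. -/
structure Bounds (K : ℕ) : Prop where
  deg_le : ∀ e x, L.Inc e x → L.deg x ≤ K
  pair : ∀ e x y, x ≠ y → L.Inc e x → L.Inc e y → 2 * L.deg x + L.deg y ≤ 2 * K + L.mult x y
  triangle : ∀ e f g x y w, x ≠ y → x ≠ w → y ≠ w → L.Inc e x → L.Inc e y → L.Inc f x → L.Inc f w →
    L.Inc g y → L.Inc g w → L.deg x + L.deg y + L.mult x w + L.mult y w ≤ 2 * K

/-- A partial edge-colouring with colours `0, …, k - 1`; the colour `m` marks uncoloured edges. -/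
structure Proper (k : ℕ) (c : ℕ → ℕ) : Prop where
  le : k ≤ L.m
  range : ∀ e < L.m, c e ≠ L.m → c e < k
  ne : ∀ e f x, L.Inc e x → L.Inc f x → e ≠ f → c e ≠ L.m → c e ≠ c f

/-- Only edges with two distinct ends are coloured. -/
def LoopFree (c : ℕ → ℕ) : Prop := ∀ e < L.m, c e ≠ L.m → L.a e ≠ L.b e

/-- The colour `j` is not used at `x`. -/
def Missing (k : ℕ) (c : ℕ → ℕ) (x : α) (j : ℕ) : Prop := j < k ∧ ∀ e, L.Inc e x → c e ≠ j

/-- The colouring `c'` with `k'` colours colours exactly `e` in addition to the edges coloured by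
`c`, and a colour has been added only if `k` violates the local bounds. -/
structure Done (k : ℕ) (c : ℕ → ℕ) (e k' : ℕ) (c' : ℕ → ℕ) : Prop where
  proper : L.Proper k' c'
  dom : ∀ f < L.m, c' f = L.m ↔ c f = L.m ∧ f ≠ e
  bound : k' = k ∨ k' = k + 1 ∧ ¬L.Bounds k

variable {L} {k K : ℕ} {c : ℕ → ℕ} {e f g h j : ℕ} {u v w x y z : α}

/-- This is what makes adding colours safe: if the bounds fail for `k`, every `K` that satisfies
them exceeds `k`. -/
theorem Bounds.mono (hK : L.Bounds K) (h : K ≤ k) : L.Bounds k :=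
  ⟨fun e x he => (hK.deg_le e x he).trans h,
    fun e x y hxy hx hy => (hK.pair e x y hxy hx hy).trans (by omega),
    fun e f g x y w h1 h2 h3 h4 h5 h6 h7 h8 h9 =>
      (hK.triangle e f g x y w h1 h2 h3 h4 h5 h6 h7 h8 h9).trans (by omega)⟩

theorem Inc.eq_or_eq (hx : L.Inc e x) (hy : L.Inc e y) (hxy : x ≠ y) (hz : L.Inc e z) :
    z = x ∨ z = y := by
  rcases hx with ⟨-, h1 | h1⟩ <;> rcases hy with ⟨-, h2 | h2⟩ <;> rcases hz with ⟨-, h3 | h3⟩ <;>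
    simp_all

theorem mult_comm (x y : α) : L.mult x y = L.mult y x := by
  simp only [mult, and_comm]

theorem finite_of_lt {S : Set ℕ} {m : ℕ} (h : ∀ e ∈ S, e < m) : S.Finite :=
  (Set.finite_Iio m).subset h

theorem finite_inc (x : α) : {e | L.Inc e x}.Finite := finite_of_lt fun _ he => he.1

theorem finite_inc₂ (x y : α) : {e | L.Inc e x ∧ L.Inc e y}.Finite :=
  finite_of_lt fun _ he => he.1.1

theorem finite_missing (x : α) : {j | L.Missing k c x j}.Finite := finite_of_lt fun _ hj => hj.1

theorem ncard_Iio (k : ℕ) : (Set.Iio k).ncard = k := by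
  rw [← Finset.coe_Iio, Set.ncard_coe_finset, Nat.card_Iio]

/-- Each of the `k` colours is missing at `x` or is the colour of one of the edges at `x`. -/
theorem le_ncard_missing (k : ℕ) (c : ℕ → ℕ) (x : α) :
    k ≤ {j | L.Missing k c x j}.ncard + L.deg x := by
  have h : Set.Iio k ⊆ {j | L.Missing k c x j} ∪ c '' {e | L.Inc e x} := by
    intro j hj
    by_cases hm : L.Missing k c x j
    · exact .inl hm
    · right
      simp only [Missing, not_and, not_forall] at hm
      obtain ⟨e, he, h⟩ := hm hj
      exact ⟨e, he, not_not.1 h⟩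
  have h1 := Set.ncard_le_ncard h ((finite_missing x).union ((finite_inc x).image c))
  have h2 := Set.ncard_union_le {j | L.Missing k c x j} (c '' {e | L.Inc e x})
  have h3 := Set.ncard_image_le (f := c) (finite_inc (L := L) x)
  rw [ncard_Iio] at h1
  unfold deg
  omega

/-- The uncoloured edge `e` uses up none of the `k` colours at `x`, as `k ≤ m` keeps the marker `m`
apart from them. This gains one over `le_ncard_missing`. -/
theorem lt_ncard_missing (hk : k ≤ L.m) (he : L.Inc e x) (hc : c e = L.m) :
    k < {j | L.Missing k c x j}.ncard + L.deg x := by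
  have h : Set.Iio k ⊆ {j | L.Missing k c x j} ∪ c '' ({e | L.Inc e x} \ {e}) := by
    intro j hj
    by_cases hm : L.Missing k c x j
    · exact .inl hm
    · right
      simp only [Missing, not_and, not_forall] at hm
      obtain ⟨f, hf, h⟩ := hm hj
      refine ⟨f, ⟨hf, ?_⟩, not_not.1 h⟩
      rintro rfl
      rw [Set.mem_Iio] at hj
      omega
  have hfin : ({e | L.Inc e x} \ {e}).Finite := (finite_inc x).subset Set.sdiff_subset
  have h1 := Set.ncard_le_ncard h ((finite_missing x).union (hfin.image c))
  have h2 := Set.ncard_union_le {j | L.Missing k c x j} (c '' ({e | L.Inc e x} \ {e}))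
  have h3 := Set.ncard_image_le (f := c) hfin
  have h4 := Set.ncard_sdiff_singleton_add_one (show e ∈ {e | L.Inc e x} from he) (finite_inc x)
  rw [ncard_Iio] at h1
  unfold deg
  omega

/-- An edge has at most two ends, so the edges from `v` to distinct other vertices form disjoint
sets. -/
theorem mult_add_mult_le (huv : u ≠ v) (hwv : w ≠ v) (huw : u ≠ w) :
    L.mult u v + L.mult w v ≤ L.deg v := by
  unfold mult deg
  rw [← Set.ncard_union_eq _ (finite_inc₂ u v) (finite_inc₂ w v)]
  · refine Set.ncard_le_ncard ?_ (finite_inc v)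
    rintro e (he | he) <;> exact he.2
  · rw [Set.disjoint_left]
    rintro e ⟨h1, h2⟩ ⟨h3, -⟩
    rcases h1.eq_or_eq h2 huv h3 with h | h
    · exact huw h.symm
    · exact hwv h

theorem mult_add_mult_add_mult_le (huv : u ≠ v) (hwv : w ≠ v) (hzv : z ≠ v) (huw : u ≠ w)
    (huz : u ≠ z) (hwz : w ≠ z) : L.mult u v + L.mult w v + L.mult z v ≤ L.deg v := by
  have hd : ∀ {x y}, x ≠ v → y ≠ v → x ≠ y →
      Disjoint {e | L.Inc e x ∧ L.Inc e v} {e | L.Inc e y ∧ L.Inc e v} := by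
    intro x y hx hy hxy
    rw [Set.disjoint_left]
    rintro e ⟨h1, h2⟩ ⟨h3, -⟩
    rcases h1.eq_or_eq h2 hx h3 with h | h
    · exact hxy h.symm
    · exact hy h
  unfold mult deg
  rw [← Set.ncard_union_eq (hd huv hwv huw) (finite_inc₂ u v) (finite_inc₂ w v),
    ← Set.ncard_union_eq (Set.disjoint_union_left.2 ⟨hd huv hzv huz, hd hwv hzv hwz⟩)
      ((finite_inc₂ u v).union (finite_inc₂ w v)) (finite_inc₂ z v)]
  refine Set.ncard_le_ncard ?_ (finite_inc v)
  rintro e ((he | he) | he) <;> exact he.2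

theorem Bounds.exists_missing (hB : L.Bounds k) (hk : k ≤ L.m) (he : L.Inc e x)
    (hc : c e = L.m) : ∃ j, L.Missing k c x j := by
  have h1 := lt_ncard_missing hk he hc
  have h2 := hB.deg_le e x he
  have : {j | L.Missing k c x j}.Nonempty := by
    rw [Set.nonempty_iff_ne_empty]
    intro h
    rw [h, Set.ncard_empty] at h1
    omega
  exact this

/-- Among a vertex and three of its neighbours, two have a common missing colour. -/
theorem Bounds.exists_common_of_star (hB : L.Bounds k) (hk : k ≤ L.m) {w₁ w₂ : α} {g₁ g₂ : ℕ}
    (huv : u ≠ v) (h1v : w₁ ≠ v) (h2v : w₂ ≠ v) (hu1 : u ≠ w₁) (hu2 : u ≠ w₂) (h12 : w₁ ≠ w₂)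
    (heu : L.Inc e u) (hev : L.Inc e v) (hc : c e = L.m)
    (h1 : L.Inc g₁ v) (h1' : L.Inc g₁ w₁) (h2 : L.Inc g₂ v) (h2' : L.Inc g₂ w₂)
    (duv : ∀ j, L.Missing k c u j → ¬L.Missing k c v j)
    (d1v : ∀ j, L.Missing k c w₁ j → ¬L.Missing k c v j)
    (d2v : ∀ j, L.Missing k c w₂ j → ¬L.Missing k c v j)
    (du1 : ∀ j, L.Missing k c u j → ¬L.Missing k c w₁ j)
    (du2 : ∀ j, L.Missing k c u j → ¬L.Missing k c w₂ j)
    (d12 : ∀ j, L.Missing k c w₁ j → ¬L.Missing k c w₂ j) : False := by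
  have hfin := fun x => finite_missing (L := L) (k := k) (c := c) x
  have hd : ∀ {x y}, (∀ j, L.Missing k c x j → ¬L.Missing k c y j) →
      Disjoint {j | L.Missing k c x j} {j | L.Missing k c y j} := fun h =>
    Set.disjoint_left.2 h
  have htot : (({j | L.Missing k c u j} ∪ {j | L.Missing k c w₁ j}) ∪
      ({j | L.Missing k c w₂ j} ∪ {j | L.Missing k c v j})).ncard ≤ k := by
    refine (Set.ncard_le_ncard (t := Set.Iio k) ?_ (Set.finite_Iio k)).trans (ncard_Iio k).le
    rintro j ((hj | hj) | (hj | hj)) <;> exact hj.1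
  rw [Set.ncard_union_eq _ ((hfin _).union (hfin _)) ((hfin _).union (hfin _)),
    Set.ncard_union_eq (hd du1) (hfin _) (hfin _),
    Set.ncard_union_eq (hd d2v) (hfin _) (hfin _)] at htot
  -- The pair inequalities sum to `2(d(u) + d(w₁) + d(w₂)) + 3d(v) ≤ 6k + d(v)`, the multiplicities
  -- at `v` adding up to at most `d(v)`. So the four degrees sum to at most `3k`, and the four
  -- disjoint sets have at least `k + 2` elements; the 2 comes from `e`.
  · have m1 := lt_ncard_missing hk heu hc
    have m2 := lt_ncard_missing hk hev hc
    have m3 := le_ncard_missing (L := L) k c w₁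
    have m4 := le_ncard_missing (L := L) k c w₂
    have p1 := hB.pair e u v huv heu hev
    have p2 := hB.pair g₁ w₁ v h1v h1' h1
    have p3 := hB.pair g₂ w₂ v h2v h2' h2
    have := mult_add_mult_add_mult_le (L := L) huv h1v h2v hu1 hu2 h12
    omega
  · exact Set.disjoint_union_left.2
      ⟨Set.disjoint_union_right.2 ⟨hd du2, hd duv⟩, Set.disjoint_union_right.2 ⟨hd d12, hd d1v⟩⟩

/-- If every colour missing at one end of an uncoloured edge appears at the other end only on edges
to a common neighbour, the local bounds fail. -/
theorem Bounds.false_of_triangle (hB : L.Bounds k) (hk : k ≤ L.m)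
    (huv : u ≠ v) (huw : u ≠ w) (hvw : v ≠ w)
    (heu : L.Inc e u) (hev : L.Inc e v) (hc : c e = L.m)
    (hgv : L.Inc g v) (hgw : L.Inc g w) (hhu : L.Inc h u) (hhw : L.Inc h w)
    (duv : ∀ j, L.Missing k c u j → ¬L.Missing k c v j)
    (cv : ∀ f, L.Inc f v → L.Missing k c u (c f) → L.Inc f w)
    (cu : ∀ f, L.Inc f u → L.Missing k c v (c f) → L.Inc f w) : False := by
  have key : ∀ {x y : α}, (∀ j, L.Missing k c x j → ¬L.Missing k c y j) →
      (∀ f, L.Inc f y → L.Missing k c x (c f) → L.Inc f w) →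
      {j | L.Missing k c x j}.ncard ≤ L.mult y w := by
    intro x y hd hcl
    have : {j | L.Missing k c x j} ⊆ c '' {f | L.Inc f y ∧ L.Inc f w} := by
      intro j hj
      have := hd j hj
      simp only [Missing, not_and, not_forall] at this
      obtain ⟨f, hf, h⟩ := this hj.1
      have h := not_not.1 h
      exact ⟨f, ⟨hf, hcl f hf (h ▸ hj)⟩, h⟩
    exact (Set.ncard_le_ncard this ((finite_inc₂ y w).image c)).trans
      (Set.ncard_image_le (finite_inc₂ y w))
  -- Now `k + 1 - d(u) ≤ μ(vw)` and `k + 1 - d(v) ≤ μ(uw)`, whose sum exceeds the triangle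
  -- inequality by 2.
  have h1 := key duv cv
  have h2 := key (fun j hv hu => duv j hu hv) cu
  have m1 := lt_ncard_missing hk heu hc
  have m2 := lt_ncard_missing hk hev hc
  have := hB.triangle e h g u v w huv huw hvw heu hev hhu hhw hgv hgw
  omega

/-- All colours missing at `w` or `x` sit on edges between `u` and `v` other than `e`. If the two
sets were disjoint, their sizes would sum to at most `μ(uv) - 1`. But the pair inequalities for `wv`
and `xu` give twice that sum at least `(d(v) - μ(wv)) + (d(u) - μ(xu)) ≥ 2μ(uv)`. -/
theorem Bounds.exists_common_of_path (hB : L.Bounds k) (hk : k ≤ L.m)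
    (huv : u ≠ v) (hwv : w ≠ v) (hxu : x ≠ u) (huw : u ≠ w) (hxv : x ≠ v)
    (heu : L.Inc e u) (hev : L.Inc e v) (hc : c e = L.m)
    (hgv : L.Inc g v) (hgw : L.Inc g w) (hhu : L.Inc h u) (hhx : L.Inc h x)
    (dwv : ∀ j, L.Missing k c w j → ¬L.Missing k c v j)
    (dxu : ∀ j, L.Missing k c x j → ¬L.Missing k c u j)
    (cv : ∀ f, L.Inc f v → L.Missing k c w (c f) → L.Inc f u)
    (cu : ∀ f, L.Inc f u → L.Missing k c x (c f) → L.Inc f v) :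
    ∃ j, L.Missing k c w j ∧ L.Missing k c x j := by
  by_contra! hno
  have hsub : {j | L.Missing k c w j} ∪ {j | L.Missing k c x j} ⊆
      c '' ({f | L.Inc f u ∧ L.Inc f v} \ {e}) := by
    have hne : ∀ {j f}, j < k → c f = j → f ≠ e := by
      rintro j f hj h rfl
      omega
    rintro j (hj | hj)
    · have := dwv j hj
      simp only [Missing, not_and, not_forall] at this
      obtain ⟨f, hf, h⟩ := this hj.1
      have h := not_not.1 h
      exact ⟨f, ⟨⟨cv f hf (h ▸ hj), hf⟩, hne hj.1 h⟩, h⟩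
    · have := dxu j hj
      simp only [Missing, not_and, not_forall] at this
      obtain ⟨f, hf, h⟩ := this hj.1
      have h := not_not.1 h
      exact ⟨f, ⟨⟨hf, cu f hf (h ▸ hj)⟩, hne hj.1 h⟩, h⟩
  have hfin : ({f | L.Inc f u ∧ L.Inc f v} \ {e}).Finite :=
    (finite_inc₂ u v).subset Set.sdiff_subset
  have h1 := (Set.ncard_le_ncard hsub (hfin.image c)).trans (Set.ncard_image_le hfin)
  have hd : Disjoint {j | L.Missing k c w j} {j | L.Missing k c x j} := Set.disjoint_left.2 hno
  rw [Set.ncard_union_eq hd (finite_missing w) (finite_missing x)] at h1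
  have h2 := Set.ncard_sdiff_singleton_add_one
    (show e ∈ {f | L.Inc f u ∧ L.Inc f v} from ⟨heu, hev⟩) (finite_inc₂ u v)
  have m1 := le_ncard_missing (L := L) k c w
  have m2 := le_ncard_missing (L := L) k c x
  have p1 := hB.pair g w v hwv hgw hgv
  have p2 := hB.pair h x u hxu hhx hhu
  have d1 := mult_add_mult_le (L := L) huv hwv huw
  have d2 := mult_add_mult_le (L := L) huv.symm hxu hxv.symm
  rw [mult_comm v u] at d2
  unfold mult at *
  omega

/-! ### Recolouring -/

theorem Proper.extend (hp : L.Proper k c) (hc : c e = L.m) (hj : ∀ x, L.Inc e x → L.Missing k c x j) :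
    L.Done k c e k (Function.update c e j) := by
  by_cases hem : e < L.m
  swap
  -- If `e` is not an edge, the update is invisible to all edges.
  · refine ⟨⟨hp.le, fun f hf => ?_, fun f g x hf hg hfg => ?_⟩, fun f hf => ?_, .inl rfl⟩
    · rw [Function.update_of_ne (by omega)]; exact hp.range f hf
    · rw [Function.update_of_ne (by have := hf.1; omega), Function.update_of_ne (by have := hg.1; omega)]
      exact hp.ne f g x hf hg hfg
    · rw [Function.update_of_ne (by omega)]
      constructor
      · intro h; exact ⟨h, by omega⟩
      · exact And.left
  have hjk : j < k := (hj _ ⟨hem, .inl rfl⟩).1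
  have hle := hp.le
  refine ⟨⟨hle, fun f hf => ?_, fun f g x hf hg hfg => ?_⟩, fun f hf => ?_, .inl rfl⟩
  · rcases eq_or_ne f e with rfl | hfe
    · simp [hjk]
    · rw [Function.update_of_ne hfe]; exact hp.range f hf
  · rcases eq_or_ne f e with rfl | hfe
    · rw [Function.update_self, Function.update_of_ne hfg.symm]
      exact fun _ h => (hj x hf).2 g hg h.symm
    · rw [Function.update_of_ne hfe]
      rcases eq_or_ne g e with rfl | hge
      · rw [Function.update_self]
        exact fun _ => (hj x hg).2 f hf
      · rw [Function.update_of_ne hge]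
        exact hp.ne f g x hf hg hfg
  · rcases eq_or_ne f e with rfl | hfe
    · simp; omega
    · simp [hfe]

theorem Proper.uncolour (hp : L.Proper k c) (e : ℕ) : L.Proper k (Function.update c e L.m) := by
  refine ⟨hp.le, fun f hf => ?_, fun f g x hf hg hfg hfm => ?_⟩
  · rcases eq_or_ne f e with rfl | hfe
    · simp
    · rw [Function.update_of_ne hfe]; exact hp.range f hf
  · rcases eq_or_ne f e with rfl | hfe
    · simp at hfm
    · rw [Function.update_of_ne hfe] at hfm ⊢
      rcases eq_or_ne g e with rfl | hge
      · rwa [Function.update_self]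
      · rw [Function.update_of_ne hge]
        exact hp.ne f g x hf hg hfg hfm

/-- Colour `k` is unused so far, hence missing everywhere once admitted. The condition `k < m` keeps
it apart from the marker `m`. -/
theorem Proper.addColour (hp : L.Proper k c) (hk : k < L.m) (hc : c e = L.m) (hB : ¬L.Bounds k) :
    L.Done k c e (k + 1) (Function.update c e k) := by
  have h' : L.Proper (k + 1) c :=
    ⟨hk, fun f hf hm => (hp.range f hf hm).trans (Nat.lt_succ_self k), hp.ne⟩
  have := h'.extend hc (j := k) fun x _ => ⟨Nat.lt_succ_self k, fun f hf h =>
    absurd (hp.range f hf.1 (by omega)) (by omega)⟩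
  exact ⟨this.proper, this.dom, .inr ⟨rfl, hB⟩⟩

theorem Proper.ne_m_of_missing (hp : L.Proper k c) (h : L.Missing k c x j) : j ≠ L.m := by
  have := h.1
  have := hp.le
  omega

/-- Passing the colour of `g` to `e` keeps the partial colouring proper. -/
theorem Proper.shift (hp : L.Proper k c) (huv : u ≠ v) (heu : L.Inc e u) (hev : L.Inc e v)
    (hgv : L.Inc g v) (hg : L.Missing k c u (c g)) :
    L.Proper k (Function.update (Function.update c e (c g)) g L.m) := by
  have h1 := hp.uncolour g
  have hgm := hp.ne_m_of_missing hg
  have hge : g ≠ e := fun h => hg.2 e heu (by rw [h])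
  -- In the other order: once `g` is uncoloured, its colour is free at `u` by assumption and at `v`
  -- because `g` was the only edge there with it.
  rw [Function.update_comm hge.symm]
  have h2 := h1.uncolour e
  have h3 := h2.extend (e := e) (j := c g) (by simp) (fun x hx => ⟨hg.1, fun f hf => ?_⟩)
  · simpa using h3.proper
  · rcases eq_or_ne f e with rfl | hfe
    · simpa using hgm.symm
    · rw [Function.update_of_ne hfe]
      rcases eq_or_ne f g with rfl | hfg
      · simpa using hgm.symm
      · rw [Function.update_of_ne hfg]
        rcases heu.eq_or_eq hev huv hx with rfl | rfl
        · exact hg.2 f hf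
        · exact (hp.ne g f x hgv hf hfg.symm hgm).symm

/-- At a common end of `e` and `g` the colour merely moves from one edge to the other. -/
theorem missing_shift_iff (hge : g ≠ e) (hxe : L.Inc e x) (hxg : L.Inc g x) (hj : j ≠ L.m)
    (hc : c e = L.m) :
    L.Missing k (Function.update (Function.update c e (c g)) g L.m) x j ↔ L.Missing k c x j := by
  refine and_congr_right fun _ => ⟨fun h f hf hfj => ?_, fun h f hf => ?_⟩
  · rcases eq_or_ne f g with rfl | hfg
    · have := h e hxe
      rw [Function.update_of_ne hge.symm, Function.update_self] at this
      exact this hfj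
    · rcases eq_or_ne f e with rfl | hfe
      · exact hj (by rw [← hfj, hc])
      · have := h f hf
        rw [Function.update_of_ne hfg, Function.update_of_ne hfe] at this
        exact this hfj
  · rcases eq_or_ne f g with rfl | hfg
    · rw [Function.update_self]; exact hj.symm
    · rw [Function.update_of_ne hfg]
      rcases eq_or_ne f e with rfl | hfe
      · rw [Function.update_self]; exact h g hxg
      · rw [Function.update_of_ne hfe]; exact h f hf

/-- At a vertex off `e` the shift can only remove a colour. -/
theorem missing_shift (hj : j ≠ L.m) (hxe : ¬L.Inc e x) (h : L.Missing k c x j) :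
    L.Missing k (Function.update (Function.update c e (c g)) g L.m) x j := by
  refine ⟨h.1, fun f hf => ?_⟩
  rcases eq_or_ne f g with rfl | hfg
  · rw [Function.update_self]; exact hj.symm
  · rw [Function.update_of_ne hfg, Function.update_of_ne (by rintro rfl; exact hxe hf)]
    exact h.2 f hf

theorem Proper.missing_shift_self (hp : L.Proper k c) (hgm : c g ≠ L.m) (hxe : ¬L.Inc e x)
    (hxg : L.Inc g x) :
    L.Missing k (Function.update (Function.update c e (c g)) g L.m) x (c g) := by
  refine ⟨hp.range g hxg.1 hgm, fun f hf => ?_⟩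
  rcases eq_or_ne f g with rfl | hfg
  · rw [Function.update_self]; exact hgm.symm
  · rw [Function.update_of_ne hfg, Function.update_of_ne (by rintro rfl; exact hxe hf)]
    exact (hp.ne g f x hxg hf hfg.symm hgm).symm

/-- The shift moves the uncoloured place from `e` to `g`, so filling `g` afterwards amounts to
colouring `e` in addition. -/
theorem Done.of_shift {k' : ℕ} {c' : ℕ → ℕ} (hc : c e = L.m) (hgm : c g ≠ L.m)
    (h : L.Done k (Function.update (Function.update c e (c g)) g L.m) g k' c') :
    L.Done k c e k' c' := by
  refine ⟨h.proper, fun f hf => (h.dom f hf).trans ?_, h.bound⟩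
  have hge : g ≠ e := fun h => hgm (h ▸ hc)
  rcases eq_or_ne f g with rfl | hfg
  · simp [hgm]
  · rcases eq_or_ne f e with rfl | hfe
    · simp [hfg, hgm]
    · simp [hfg, hfe]

/-- Colouring `e` with the colour of `g` and `g` with a colour missing at both of its ends. -/
theorem Proper.extend_shift (hp : L.Proper k c) (huv : u ≠ v) (huw : u ≠ w) (hwv : w ≠ v)
    (heu : L.Inc e u) (hev : L.Inc e v) (hc : c e = L.m) (hgv : L.Inc g v) (hgw : L.Inc g w)
    (hg : L.Missing k c u (c g)) (hjv : L.Missing k c v j) (hjw : L.Missing k c w j) :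
    L.Done k c e k (Function.update (Function.update c e (c g)) g j) := by
  have hgm := hp.ne_m_of_missing hg
  have hjm := hp.ne_m_of_missing hjv
  have hge : g ≠ e := fun h => hg.2 e heu (by rw [h])
  have hwe : ¬L.Inc e w := fun h => by
    rcases heu.eq_or_eq hev huv h with h | h
    · exact huw h.symm
    · exact hwv h
  have h1 := hp.shift huv heu hev hgv hg
  have h2 := h1.extend (e := g) (j := j) (by simp) (fun x hx => by
    rcases hgw.eq_or_eq hgv hwv hx with rfl | rfl
    · exact missing_shift hjm hwe hjw
    · exact (missing_shift_iff hge hev hgv hjm hc).2 hjv)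
  simpa using Done.of_shift hc hgm h2

/-- The recolouring of a path `x u v w` in which the uncoloured edge is parallel to `f`. -/
theorem Proper.recolour_path {γ : ℕ} (hp : L.Proper k c) (huv : u ≠ v) (hwv : w ≠ v) (hxu : x ≠ u)
    (huw : u ≠ w) (hxv : x ≠ v) (hxw : x ≠ w) (heu : L.Inc e u) (hev : L.Inc e v) (hc : c e = L.m)
    (hgv : L.Inc g v) (hgw : L.Inc g w) (hhu : L.Inc h u) (hhx : L.Inc h x)
    (hfu : L.Inc f u) (hfv : L.Inc f v) (hg : L.Missing k c u (c g)) (hh : L.Missing k c v (c h))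
    (hγ : c f = γ) (hγw : L.Missing k c w γ) (hγx : L.Missing k c x γ) :
    L.Done k c e k (Function.update (Function.update (Function.update (Function.update c
      f (c g)) g γ) e (c h)) h γ) := by
  have hgm := hp.ne_m_of_missing hg
  have hhm := hp.ne_m_of_missing hh
  have hγm := hp.ne_m_of_missing hγw
  have iu : ∀ {x f}, L.Inc f u → L.Inc f v → L.Inc f x → x = u ∨ x = v := fun h1 h2 h3 =>
    h1.eq_or_eq h2 huv h3
  have hfe : f ≠ e := by rintro rfl; omega
  have hge : g ≠ e := by rintro rfl; omega
  have hhe : h ≠ e := by rintro rfl; omega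
  have hfg : f ≠ g := by rintro rfl; exact hg.2 f hfu rfl
  have hfh : f ≠ h := by rintro rfl; exact hh.2 f hfv rfl
  have hgh : g ≠ h := by rintro rfl; exact hg.2 g hhu rfl
  have ig : ∀ {y}, L.Inc g y → y = w ∨ y = v := fun h3 => hgw.eq_or_eq hgv hwv h3
  have ih : ∀ {y}, L.Inc h y → y = x ∨ y = u := fun h3 => hhx.eq_or_eq hhu hxu h3
  have hkm := hp.le
  set c' := Function.update (Function.update (Function.update (Function.update c
      f (c g)) g γ) e (c h)) h γ with hc'
  have vh : c' h = γ := by simp [hc']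
  have ve : c' e = c h := by simp [hc', hhe.symm]
  have vg : c' g = γ := by simp [hc', hge, hgh]
  have vf : c' f = c g := by simp [hc', hfe, hfh, hfg]
  have vo : ∀ d, d ≠ e → d ≠ f → d ≠ g → d ≠ h → c' d = c d := by
    intro d h1 h2 h3 h4
    simp [hc', h1, h2, h3, h4]
  have jg : c g < k := hg.1
  have jh : c h < k := hh.1
  have jγ : γ < k := hγw.1
  have gh' : c g ≠ c h := (hg.2 h hhu).symm
  have gγ : c g ≠ γ := hγw.2 g hgw
  have hhγ : c h ≠ γ := hγx.2 h hhx
  -- At `v`, `f` takes over the colour of `g`, `g` takes over `γ` from `f`, and `e` gets a missing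
  -- colour. At `u`, `e` takes over the colour of `h`, `h` takes over `γ`, and `f` gets a missing
  -- colour. At `w` and `x` the new colour `γ` was missing; `w ≠ x` keeps the two new `γ`-edges
  -- apart.
  have key : ∀ d d' y, L.Inc d y → L.Inc d' y → d ≠ d' → c' d ≠ L.m → c' d ≠ c' d' := by
    intro d d' y hd hd' hdd
    have hu : ∀ d, L.Inc d u → c d ≠ c g := hg.2
    have hv : ∀ d, L.Inc d v → c d ≠ c h := hh.2
    have hw : ∀ d, L.Inc d w → c d ≠ γ := hγw.2
    have hx : ∀ d, L.Inc d x → c d ≠ γ := hγx.2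
    have ie : ∀ {y}, L.Inc e y → y = u ∨ y = v := iu heu hev
    have jf : ∀ {y}, L.Inc f y → y = u ∨ y = v := iu hfu hfv
    have nf : ∀ d y, L.Inc f y → L.Inc d y → d ≠ f → c d ≠ γ := fun d y h1 h2 h3 h4 =>
      hp.ne f d y h1 h2 h3.symm (by omega) (by omega)
    have ng : ∀ d y, L.Inc g y → L.Inc d y → d ≠ g → c d ≠ c g := fun d y h1 h2 h3 h4 =>
      hp.ne g d y h1 h2 h3.symm (by omega) (by omega)
    have nh : ∀ d y, L.Inc h y → L.Inc d y → d ≠ h → c d ≠ c h := fun d y h1 h2 h3 h4 =>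
      hp.ne h d y h1 h2 h3.symm (by omega) (by omega)
    have ho := hp.ne d d' y hd hd' hdd
    clear_value c'
    clear hp hg hh hγw hγx
    grind
  refine ⟨⟨hkm, fun d hd hdm => ?_, key⟩, fun d hd => ?_, .inl rfl⟩
  · have := hp.range d hd
    clear_value c'
    grind
  · clear_value c'
    grind

end EdgeList

/-! ### Alternating walks and Kempe exchanges -/

namespace EdgeList

variable {α : Type*} {L : EdgeList α} {k : ℕ} {c : ℕ → ℕ} {e f : ℕ} {v y y' : α} {γ β p q : ℕ}

/-- A walk from `v` along edges coloured alternately `γ`, `β`, …. The walk has left from the pairs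
(vertex, colour) in `D`, has used the edges in `Q`, is now at `y`, and continues with colour `p`,
the other colour being `q`. -/
inductive Walk (L : EdgeList α) (c : ℕ → ℕ) (γ β : ℕ) (v : α) :
    Set (α × ℕ) → Set ℕ → α → ℕ → ℕ → Prop
  | nil : Walk L c γ β v ∅ ∅ v γ β
  | cons {D Q y p q e y'} (h : Walk L c γ β v D Q y p q) (hy : L.Inc e y) (hy' : L.Inc e y')
      (hne : y ≠ y') (hc : c e = p) : Walk L c γ β v (insert (y, p) D) (insert e Q) y' q p

variable {D : Set (α × ℕ)} {Q : Set ℕ}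

theorem Walk.colours (h : Walk L c γ β v D Q y p q) : (p = γ ∧ q = β) ∨ (p = β ∧ q = γ) := by
  induction h with
  | nil => exact .inl ⟨rfl, rfl⟩
  | cons => tauto

theorem Walk.edges (h : Walk L c γ β v D Q y p q) (he : e ∈ Q) :
    e < L.m ∧ (c e = γ ∨ c e = β) := by
  induction h with
  | nil => exact he.elim
  | cons h hy hy' hne hc ih =>
    rcases he with rfl | he
    · exact ⟨hy.1, by rcases h.colours with h | h <;> omega⟩
    · exact ih he

/-- The vertices visited by a walk: at every one of them, all edges with the two colours are used,
except possibly the next edge of the walk. -/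
theorem Walk.closed (hp : L.Proper k c) (hγ : γ ≠ L.m) (hβ : β ≠ L.m) (hv : L.Missing k c v β)
    (h : Walk L c γ β v D Q y p q) {x : α} (hx : x = v ∨ ∃ e ∈ Q, L.Inc e x) (hf : L.Inc f x)
    (hc : c f = γ ∨ c f = β) : f ∈ Q ∨ (x = y ∧ c f = p) := by
  induction h generalizing x f with
  | nil =>
    rcases hx with rfl | ⟨e, he, -⟩
    · exact .inr ⟨rfl, hc.resolve_right (hv.2 f hf)⟩
    · exact he.elim
  | @cons D Q y p q e y' h hy hy' hne hce ih =>
    have hp' := h.colours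
    -- At a vertex visited earlier the only unused edge was the next one of the walk, and by
    -- properness that is `e`.
    have old : (x = v ∨ ∃ e ∈ Q, L.Inc e x) → f ∈ insert e Q ∨ (x = y' ∧ c f = q) := by
      intro hx
      rcases ih hx hf hc with hQ | ⟨rfl, hfp⟩
      · exact .inl (.inr hQ)
      · by_cases hfe : f = e
        · exact .inl (.inl hfe)
        · exact absurd (by rw [hce, hfp]) (hp.ne e f _ hy hf (Ne.symm hfe) (by omega))
    rcases hx with hx | ⟨e', rfl | he', hx⟩
    · exact old (.inl hx)
    · rcases hy.eq_or_eq hy' hne hx with rfl | rfl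
      · by_cases hfe : f = e'
        · exact .inl (.inl hfe)
        · refine old ?_
          cases h with
          | nil => exact .inl rfl
          | cons h1 h2 h3 h4 h5 => exact .inr ⟨_, .inl rfl, h3⟩
      · by_cases hfe : f = e'
        · exact .inl (.inl hfe)
        · refine .inr ⟨rfl, ?_⟩
          have := hp.ne e' f _ hy' hf (Ne.symm hfe) (by omega)
          omega
    · exact old (.inr ⟨e', he', hx⟩)

/-- At inner vertices of a walk, both colours are present. -/
theorem Walk.inner (h : Walk L c γ β v D Q y p q) {x : α} (hx : ∃ e ∈ Q, L.Inc e x) (hxv : x ≠ v) :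
    (∃ f, L.Inc f x ∧ c f = q) ∧ (x ≠ y → ∃ f, L.Inc f x ∧ c f = p) := by
  induction h generalizing x with
  | nil => obtain ⟨e, he, -⟩ := hx; exact he.elim
  | @cons D Q y p q e y' h hy hy' hne hce ih =>
    obtain ⟨e', rfl | he', hx⟩ := hx
    · rcases hy.eq_or_eq hy' hne hx with rfl | rfl
      · refine ⟨⟨e', hy, hce⟩, fun _ => ?_⟩
        cases h with
        | nil => exact absurd rfl hxv
        | cons h1 h2 h3 h4 h5 => exact ⟨_, h3, h5⟩
      · exact ⟨⟨e', hy', hce⟩, fun h => absurd rfl h⟩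
    · obtain ⟨h1, h2⟩ := ih ⟨e', he', hx⟩ hxv
      by_cases hxy : x = y
      · subst hxy
        exact ⟨⟨e, hy, hce⟩, fun _ => h1⟩
      · exact ⟨h2 hxy, fun _ => h1⟩

/-- Every pair other than the initial one was reached by an edge of the other colour from a pair in
`D`. Tracing a repetition back along this edge gives an earlier one. -/
theorem Walk.pred (h : Walk L c γ β v D Q y p q) {s : α × ℕ} (hs : s ∈ insert (y, p) D) :
    s = (v, γ) ∨ ∃ x e r, (x, r) ∈ D ∧ L.Inc e x ∧ L.Inc e s.1 ∧ x ≠ s.1 ∧ c e = r ∧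
      (s.2 = γ ∧ r = β ∨ s.2 = β ∧ r = γ) := by
  induction h with
  | nil => rcases hs with rfl | hs; exacts [.inl rfl, hs.elim]
  | @cons D Q y p q e y' h hy hy' hne hce ih =>
    rcases hs with rfl | hs
    · exact .inr ⟨y, e, p, .inl rfl, hy, hy', hne, hce, by have := h.colours; tauto⟩
    · rcases ih hs with h | ⟨x, e', r, h1, h2⟩
      · exact .inl h
      · exact .inr ⟨x, e', r, .inr h1, h2⟩

/-- A walk never returns to a pair (vertex, colour). -/
theorem Walk.not_mem (hp : L.Proper k c) (hγ : γ ≠ L.m) (hβ : β ≠ L.m) (hγβ : γ ≠ β)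
    (hv : L.Missing k c v β) (h : Walk L c γ β v D Q y p q) : (y, p) ∉ D := by
  induction h with
  | nil => simp
  | @cons D Q y p q e y' h hy hy' hne hce ih =>
    rintro (hs | hs)
    · exact hne (Prod.ext_iff.1 hs).1.symm
    · have hp' := h.colours
      -- A return to the initial pair would enter `v` by an edge of the missing colour `β`. Any
      -- other return enters `y'` by an edge with the colour of `e`, hence by `e` itself, so the
      -- pair before was repeated already.
      rcases h.pred (.inr hs) with hs' | ⟨x, e', r, h1, h2, h3, h4, h5, h6⟩
      · obtain ⟨h1, h2⟩ := Prod.ext_iff.1 hs'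
        simp only at h1 h2
        subst h1
        exact hv.2 e hy' (by omega)
      · simp only at h3 h4 h6
        have hr : r = p := by omega
        subst hr
        have : e' = e := by
          by_contra hne
          exact hp.ne e' e y' h3 hy' hne (by omega) (by omega)
        subst this
        rcases h2.eq_or_eq h3 h4 hy with rfl | rfl
        · exact ih h1
        · exact hne rfl

/-- Each pair in `D` consists of an end of an edge and the colour of that edge, and an edge accounts
for at most two such pairs. -/
theorem Walk.ncard_le (h : Walk L c γ β v D Q y p q) : D.Finite ∧ D.ncard ≤ 2 * L.m := by
  have hsub : D ⊆ (fun e => (L.a e, c e)) '' Set.Iio L.m ∪ (fun e => (L.b e, c e)) '' Set.Iio L.m := by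
    induction h with
    | nil => exact Set.empty_subset _
    | @cons D Q y p q e y' h hy hy' hne hce ih =>
      refine Set.insert_subset ?_ ih
      rcases hy with ⟨hm, rfl | rfl⟩
      · exact .inl ⟨e, hm, by simp [hce]⟩
      · exact .inr ⟨e, hm, by simp [hce]⟩
  have hfin := Set.finite_Iio L.m
  refine ⟨((hfin.image _).union (hfin.image _)).subset hsub, ?_⟩
  have h1 := Set.ncard_le_ncard hsub ((hfin.image _).union (hfin.image _))
  have h2 := Set.ncard_union_le ((fun e => (L.a e, c e)) '' Set.Iio L.m)
    ((fun e => (L.b e, c e)) '' Set.Iio L.m)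
  have h3 := Set.ncard_image_le (f := fun e => (L.a e, c e)) hfin
  have h4 := Set.ncard_image_le (f := fun e => (L.b e, c e)) hfin
  rw [ncard_Iio] at h3 h4
  omega

/-- Exchange the colours `γ` and `β` on the edges of `Q`. -/
noncomputable def exchange (c : ℕ → ℕ) (γ β : ℕ) (Q : Set ℕ) (e : ℕ) : ℕ :=
  open Classical in if e ∈ Q then (if c e = γ then β else γ) else c e

/-- The properties of a colouring `c'` obtained from `c` by exchanging `γ` and `β` on the alternating
path that starts at `v`. -/
structure Exchanged (L : EdgeList α) (k : ℕ) (c : ℕ → ℕ) (γ β : ℕ) (v : α) (c' : ℕ → ℕ) : Prop where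
  proper : L.Proper k c'
  missing : L.Missing k c' v γ
  missing_or : ∀ x y, x ≠ y → x ≠ v → y ≠ v → L.Missing k c x γ → L.Missing k c y γ →
    L.Missing k c' x γ ∨ L.Missing k c' y γ
  eq : ∀ e < L.m, c e ≠ γ → c e ≠ β → c' e = c e
  dom : ∀ e < L.m, c' e = L.m ↔ c e = L.m
  missing_iff : ∀ x j, j ≠ γ → j ≠ β → (L.Missing k c' x j ↔ L.Missing k c x j)

/-- Exchanging along a walk that cannot be continued. -/
theorem Walk.exchanged (hp : L.Proper k c) (hγ : γ < k) (hγβ : γ ≠ β) (hv : L.Missing k c v β)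
    (h : Walk L c γ β v D Q y p q) (hlast : ∀ f, L.Inc f y → c f ≠ p) {c' : ℕ → ℕ}
    (hc' : ∀ e < L.m, c' e = exchange c γ β Q e) : L.Exchanged k c γ β v c' := by
  have hle := hp.le
  have hβ := hv.1
  -- As the walk is stuck, the exception in `Walk.closed` disappears: `Q` contains all `γ`- and
  -- `β`-edges at its vertices.
  have hcl : ∀ {x f}, (x = v ∨ ∃ e ∈ Q, L.Inc e x) → L.Inc f x → (c f = γ ∨ c f = β) → f ∈ Q := by
    intro x f hx hf hc
    rcases h.closed hp (by omega) (by omega) hv hx hf hc with hQ | ⟨rfl, hfp⟩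
    · exact hQ
    · exact absurd hfp (hlast f hf)
  have hin : ∀ e < L.m, e ∈ Q → (c e = γ ∧ c' e = β) ∨ (c e = β ∧ c' e = γ) := by
    intro e he heQ
    rw [hc' e he, exchange, if_pos heQ]
    rcases (h.edges heQ).2 with h | h
    · simp [h]
    · simp [h, hγβ.symm]
  have hout : ∀ e < L.m, e ∉ Q → c' e = c e := fun e he heQ => by
    rw [hc' e he, exchange, if_neg heQ]
  have hmiss : ∀ x, (¬∃ e ∈ Q, L.Inc e x) → L.Missing k c x γ → L.Missing k c' x γ :=
    fun x hx hm => ⟨hγ, fun f hf => by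
      rw [hout f hf.1 (fun hQ => hx ⟨f, hQ, hf⟩)]; exact hm.2 f hf⟩
  refine ⟨⟨hle, fun e he hm => ?_, fun e f x he hf hef hm => ?_⟩, ⟨hγ, fun f hf hfγ => ?_⟩,
    fun x z hxz hxv hzv hx hz => ?_, fun e he h1 h2 => ?_, fun e he => ?_, fun x j h1 h2 => ?_⟩
  · by_cases heQ : e ∈ Q
    · have := hin e he heQ; omega
    · rw [hout e he heQ] at hm ⊢; exact hp.range e he hm
  -- The swap preserves distinctness inside `Q`. An edge outside `Q` that meets one of `Q` has
  -- neither of the two colours.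
  · have hx : ∀ {e}, L.Inc e x → e ∈ Q → x = v ∨ ∃ e ∈ Q, L.Inc e x := fun h1 h2 =>
      .inr ⟨_, h2, h1⟩
    by_cases heQ : e ∈ Q <;> by_cases hfQ : f ∈ Q
    · have := hin e he.1 heQ
      have := hin f hf.1 hfQ
      have := hp.ne e f x he hf hef (by omega)
      omega
    · have := hin e he.1 heQ
      have hf' := hout f hf.1 hfQ
      have := mt (hcl (hx he heQ) hf) hfQ
      omega
    · have := hin f hf.1 hfQ
      have he' := hout e he.1 heQ
      have := mt (hcl (hx hf hfQ) he) heQ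
      omega
    · rw [hout e he.1 heQ] at hm ⊢
      rw [hout f hf.1 hfQ]
      exact hp.ne e f x he hf hef hm
  · by_cases hfQ : f ∈ Q
    · have := hin f hf.1 hfQ
      have := hv.2 f hf
      omega
    · rw [hout f hf.1 hfQ] at hfγ
      exact hfQ (hcl (.inl rfl) hf (.inl hfγ))
  · by_contra! hno
    have hx' : ∃ e ∈ Q, L.Inc e x := by
      by_contra h; exact hno.1 (hmiss x h hx)
    have hz' : ∃ e ∈ Q, L.Inc e z := by
      by_contra h; exact hno.2 (hmiss z h hz)
    -- A vertex of the path other than `v` and the last vertex sees both colours, so only the last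
    -- one can have missed `γ`. Hence of two vertices at most one is affected.
    have hend : ∀ x, L.Missing k c x γ → x ≠ v → (∃ e ∈ Q, L.Inc e x) → x = y := by
      intro x hx hxv hx'
      obtain ⟨⟨f, hf, hfq⟩, h2⟩ := h.inner hx' hxv
      by_contra hxy
      obtain ⟨g, hg, hgp⟩ := h2 hxy
      have h1 := hx.2 f hf
      have h2 := hx.2 g hg
      have := h.colours
      omega
    exact hxz ((hend x hx hxv hx').trans (hend z hz hzv hz').symm)
  · refine hout e he fun heQ => ?_
    have := hin e he heQ
    omega
  · by_cases heQ : e ∈ Q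
    · have := hin e he heQ
      omega
    · rw [hout e he heQ]
  · refine and_congr_right fun _ => forall_congr' fun f => forall_congr' fun hf => ?_
    by_cases hfQ : f ∈ Q
    · have := hin f hf.1 hfQ
      omega
    · rw [hout f hf.1 hfQ]

end EdgeList

/-! ### Linear scans: marking colours and searching for edges -/

namespace RAM

namespace Cmd

open EdgeList

/-- The test whether the edge in register `e` is incident with the vertex in register `x`. -/
def incTest (e x : ℕ) : Test :=
  .or (.eq (.read 0 (.reg e)) (.reg x)) (.eq (.read 1 (.reg e)) (.reg x))

/-- Mark in array `3` the colours that occur at one of the vertices in registers `10` and `11`. -/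
def markUsed : Cmd :=
  .seq (.loop 20 (.store 3 (.reg 20) (.const 0)))
    (.loop 20 (.ite (.or (incTest 20 10) (incTest 20 11))
      (.store 3 (.read 2 (.reg 20)) (.const 1)) .skip))

/-- Put into register `13` a colour missing at the vertices in registers `10` and `11`. -/
def common : Cmd :=
  .seq markUsed (.seq (.assign 13 (.reg 0))
    (.loop 20 (.ite (.and (.lt (.reg 20) (.reg 2)) (.eq (.read 3 (.reg 20)) (.const 0)))
      (.assign 13 (.reg 20)) .skip)))

/-- Put into register `13` a colour missing at the vertices in registers `x` and `y`. -/
def commonOf (x y : ℕ) : Cmd := .seq (.assign 10 (.reg x)) (.seq (.assign 11 (.reg y)) common)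

/-- Put into register `13` an edge at the vertex in register `v` with the colour in register `10`. -/
def findEdge (v : ℕ) : Cmd :=
  .seq (.assign 13 (.reg 0))
    (.loop 20 (.ite (.and (incTest 20 v) (.eq (.read 2 (.reg 20)) (.reg 10)))
      (.assign 13 (.reg 20)) .skip))

/-- Put into register `13` a coloured edge at the vertex in register `v` that is not incident with
the vertices in registers `u` and `w` and whose colour is missing at the vertex in register `p`. -/
def thirdOf (p v u w : ℕ) : Cmd :=
  .seq (.assign 10 (.reg p)) (.seq (.assign 11 (.reg p)) (.seq markUsed (.seq (.assign 13 (.reg 0))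
    (.loop 20 (.ite (.and (incTest 20 v) (.and (.not (incTest 20 u)) (.and (.not (incTest 20 w))
        (.and (.lt (.read 2 (.reg 20)) (.reg 2))
          (.eq (.read 3 (.read 2 (.reg 20))) (.const 0))))))
      (.assign 13 (.reg 20)) .skip)))))

/-- Put into register `w` the end of the edge in register `e` other than the one in register `v`. -/
def otherEnd (e v w : ℕ) : Cmd :=
  .ite (.eq (.read 0 (.reg e)) (.reg v)) (.assign w (.read 1 (.reg e)))
    (.assign w (.read 0 (.reg e)))

/-- Record in array `j` for each vertex the edge at it with the colour in register `x`. -/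
def table (j x : ℕ) : Cmd :=
  .loop 20 (.ite (.eq (.read 2 (.reg 20)) (.reg x))
    (.seq (.store j (.read 0 (.reg 20)) (.reg 20)) (.store j (.read 1 (.reg 20)) (.reg 20))) .skip)

/-- One step along an alternating path: registers `16`, `17`, `18` hold the current vertex, the next
colour and the other colour. The edge used is marked in array `7`. -/
def walkStep : Cmd :=
  .seq (.ite (.eq (.reg 17) (.reg 10)) (.assign 19 (.read 5 (.reg 16)))
      (.assign 19 (.read 6 (.reg 16))))
    (.ite (.and (.lt (.reg 19) (.reg 0)) (.and (.eq (.read 2 (.reg 19)) (.reg 17)) (incTest 19 16)))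
      (.seq (.store 7 (.reg 19) (.const 1)) (.seq (otherEnd 19 16 16)
        (.seq (.assign 23 (.reg 17)) (.seq (.assign 17 (.reg 18)) (.assign 18 (.reg 23))))))
      .skip)

/-- Exchange the colours in registers `10` and `11` on the edges marked in array `7`. -/
def flip : Cmd :=
  .loop 20 (.ite (.eq (.read 7 (.reg 20)) (.const 1))
    (.ite (.eq (.read 2 (.reg 20)) (.reg 10)) (.store 2 (.reg 20) (.reg 11))
      (.store 2 (.reg 20) (.reg 10))) .skip)

/-- Exchange the colours in registers `10` and `11` on the alternating path that starts at the vertex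
in register `12`. -/
def kempe : Cmd :=
  .seq (.loop 20 (.store 7 (.reg 20) (.const 0)))
    (.seq (table 5 10) (.seq (table 6 11)
      (.seq (.assign 16 (.reg 12)) (.seq (.assign 17 (.reg 10)) (.seq (.assign 18 (.reg 11))
        (.seq (.loop 21 (.seq walkStep (.seq walkStep walkStep))) flip))))))

end Cmd

/-- The state stores the edge list `L`. -/
structure Holds (L : EdgeList ℕ) (s : State) : Prop where
  m : s.reg 0 = L.m
  a : s.arr 0 = L.a
  b : s.arr 1 = L.b

namespace Cmd

open EdgeList

variable {L : EdgeList ℕ} {s : State} {k : ℕ} {c : ℕ → ℕ}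

theorem _root_.RAM.Holds.run {p : Cmd} (h : Holds L s) (h0 : p.writes 0 = false)
    (ha : p.writesArr 0 = false) (hb : p.writesArr 1 = false) : Holds L (p.run s) :=
  ⟨(reg_run p s h0).trans h.m, (arr_run p s ha).trans h.a, (arr_run p s hb).trans h.b⟩

theorem run_seq (p q : Cmd) (s : State) : (seq p q).run s = q.run (p.run s) := rfl

theorem eval_incTest (h : Holds L s) {e x : ℕ} (he : s.reg e < L.m) :
    (incTest e x).eval s = true ↔ L.Inc (s.reg e) (s.reg x) := by
  simp only [incTest, Test.eval_or, Test.eval_eq, Expr.eval, h.a, h.b, Inc, he, true_and]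

/-- Only cells below `m` are cleared and read. Uncoloured edges mark cell `m`, which is harmless. -/
theorem markUsed_spec (h : Holds L s) {j : ℕ} (hj : j < L.m) :
    (markUsed.run s).arr 3 j = 0 ↔
      ∀ e, L.Inc e (s.reg 10) ∨ L.Inc e (s.reg 11) → s.arr 2 e ≠ j := by
  set p₁ : Cmd := .loop 20 (.store 3 (.reg 20) (.const 0)) with hp₁
  have h1 : ∀ j < L.m, (p₁.run s).arr 3 j = 0 := by
    rw [← h.m]
    refine loop_induct rfl s (fun i s' => ∀ j < i, s'.arr 3 j = 0) (by simp) ?_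
    intro i s' hi hr _ _ hI j hj
    simp only [run, State.setReg, State.setArr, Expr.eval, Function.update_self, hr,
      Function.update_apply]
    split_ifs with hji
    · rfl
    · exact hI j (by omega)
  set t := p₁.run s with ht
  have hh : Holds L t := h.run rfl rfl rfl
  have e10 : t.reg 10 = s.reg 10 := reg_run _ _ rfl
  have e11 : t.reg 11 = s.reg 11 := reg_run _ _ rfl
  have e2 : t.arr 2 = s.arr 2 := arr_run _ _ rfl
  have key := loop_induct (r := 20) (p := .ite (.or (incTest 20 10) (incTest 20 11))
      (.store 3 (.read 2 (.reg 20)) (.const 1)) .skip) rfl t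
    (fun i s' => ∀ j < L.m, s'.arr 3 j = 0 ↔
      ∀ e < i, L.Inc e (s.reg 10) ∨ L.Inc e (s.reg 11) → s.arr 2 e ≠ j)
    (fun j hj => ⟨fun _ e he => absurd he (Nat.not_lt_zero e), fun _ => h1 j hj⟩) ?_
  · refine (key j hj).trans ⟨fun H e he => H e ?_ he, fun H e _ he => H e he⟩
    rw [hh.m]
    exact he.elim And.left And.left
  · intro i s' hi hr hx hj hI j hjm
    have hh' : Holds L s' := ⟨(hx 0 rfl).trans hh.m, (hj 0 rfl).trans hh.a, (hj 1 rfl).trans hh.b⟩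
    have him : s'.reg 20 < L.m := by rw [hr, ← hh.m]; exact hi
    have f10 : s'.reg 10 = s.reg 10 := (hx 10 rfl).trans e10
    have f11 : s'.reg 11 = s.reg 11 := (hx 11 rfl).trans e11
    have f2 : s'.arr 2 = s.arr 2 := (hj 2 rfl).trans e2
    have hsplit : (∀ e < i + 1, L.Inc e (s.reg 10) ∨ L.Inc e (s.reg 11) → s.arr 2 e ≠ j) ↔
        (∀ e < i, L.Inc e (s.reg 10) ∨ L.Inc e (s.reg 11) → s.arr 2 e ≠ j) ∧
        (L.Inc i (s.reg 10) ∨ L.Inc i (s.reg 11) → s.arr 2 i ≠ j) :=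
      Nat.forall_lt_succ_right
    rw [hsplit, ← hI j hjm]
    simp only [run]
    split_ifs with hb <;>
      simp only [Test.eval_or, eval_incTest hh' him, hr, f10, f11] at hb
    · simp only [State.setReg, State.setArr, Expr.eval, Function.update_self, hr, f2,
        Function.update_apply]
      split_ifs with hji
      · simp [hji, hb]
      · simp [Ne.symm hji]
    · simp [State.setReg, hb]

theorem missing_iff_mark (h : Holds L s) (hk : s.reg 2 ≤ L.m) {j : ℕ} :
    (j < s.reg 2 ∧ (markUsed.run s).arr 3 j = 0) ↔
      L.Missing (s.reg 2) (s.arr 2) (s.reg 10) j ∧ L.Missing (s.reg 2) (s.arr 2) (s.reg 11) j := by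
  constructor
  · rintro ⟨h1, h2⟩
    rw [markUsed_spec h (by omega)] at h2
    exact ⟨⟨h1, fun e he => h2 e (.inl he)⟩, ⟨h1, fun e he => h2 e (.inr he)⟩⟩
  · rintro ⟨h1, h2⟩
    refine ⟨h1.1, (markUsed_spec h (by have := h1.1; omega)).2 ?_⟩
    rintro e (he | he)
    exacts [h1.2 e he, h2.2 e he]

/-- The value `m` in register `13` means that nothing was found; it cannot be a colour, since `k ≤
m`. -/
theorem common_spec (h : Holds L s) (hk : s.reg 2 ≤ L.m) :
    (L.Missing (s.reg 2) (s.arr 2) (s.reg 10) ((common.run s).reg 13) ∧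
      L.Missing (s.reg 2) (s.arr 2) (s.reg 11) ((common.run s).reg 13)) ∨
    ((common.run s).reg 13 = L.m ∧ ∀ j, L.Missing (s.reg 2) (s.arr 2) (s.reg 10) j →
      ¬L.Missing (s.reg 2) (s.arr 2) (s.reg 11) j) := by
  set t := (Cmd.assign 13 (.reg 0)).run (markUsed.run s) with ht
  have hm0 : (markUsed.run s).reg 0 = L.m := (reg_run _ _ rfl).trans h.m
  have t0 : t.reg 0 = L.m := by rw [ht, ← hm0]; rfl
  have t13 : t.reg 13 = L.m := by rw [ht, ← hm0]; rfl
  have t2 : t.reg 2 = s.reg 2 := reg_run markUsed s rfl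
  have t3 : t.arr 3 = (markUsed.run s).arr 3 := rfl
  have key := loop_induct (r := 20)
    (p := .ite (.and (.lt (.reg 20) (.reg 2)) (.eq (.read 3 (.reg 20)) (.const 0)))
      (.assign 13 (.reg 20)) .skip) rfl t
    (fun i s' => (s'.reg 13 < s.reg 2 ∧ (markUsed.run s).arr 3 (s'.reg 13) = 0) ∨
      (s'.reg 13 = L.m ∧ ∀ j < i, ¬(j < s.reg 2 ∧ (markUsed.run s).arr 3 j = 0)))
    (.inr ⟨t13, by simp⟩) ?_
  · rw [t0] at key
    rcases key with H | ⟨H, H'⟩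
    · exact .inl ((missing_iff_mark h hk).1 H)
    · refine .inr ⟨H, fun j h1 h2 => ?_⟩
      exact H' j (h1.1.trans_le hk) ((missing_iff_mark h hk).2 ⟨h1, h2⟩)
  · intro i s' hi hr hx hj hI
    have f2 : s'.reg 2 = s.reg 2 := (hx 2 rfl).trans t2
    have f3 : s'.arr 3 = (markUsed.run s).arr 3 := hj 3 rfl
    simp only [run]
    split_ifs with hb <;>
      simp only [Test.eval_and, Test.eval_lt, Test.eval_eq, Expr.eval, hr, f2, f3] at hb
    · left
      simpa [State.setReg, Function.update_apply, Expr.eval, hr] using hb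
    · rcases hI with hI | ⟨hI, hI'⟩
      · left; simpa [State.setReg, Function.update_apply] using hI
      · right
        refine ⟨by simpa [State.setReg, Function.update_apply] using hI, fun j hj => ?_⟩
        rcases Nat.lt_succ_iff_lt_or_eq.1 hj with hj | rfl
        · exact hI' j hj
        · exact hb

/-- Register `10` is overwritten before register `y` is read, whence `y ≠ 10`. -/
theorem commonOf_spec (h : Holds L s) (hk : s.reg 2 ≤ L.m) {x y : ℕ} (hy : y ≠ 10) :
    (L.Missing (s.reg 2) (s.arr 2) (s.reg x) (((commonOf x y).run s).reg 13) ∧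
      L.Missing (s.reg 2) (s.arr 2) (s.reg y) (((commonOf x y).run s).reg 13)) ∨
    (((commonOf x y).run s).reg 13 = L.m ∧ ∀ j, L.Missing (s.reg 2) (s.arr 2) (s.reg x) j →
      ¬L.Missing (s.reg 2) (s.arr 2) (s.reg y) j) := by
  have := common_spec (L := L)
    (s := (Cmd.assign 11 (.reg y)).run ((Cmd.assign 10 (.reg x)).run s)) ⟨h.m, h.a, h.b⟩ hk
  simpa [commonOf, run, State.setReg, Function.update_apply, Expr.eval, hy] using this

/-- Nothing is recorded about register `13` in the second alternative, which is refuted wherever the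
search is used. -/
theorem findEdge_spec (h : Holds L s) {v : ℕ} (h13 : v ≠ 13) (h20 : v ≠ 20) :
    (L.Inc (((findEdge v).run s).reg 13) (s.reg v) ∧
      s.arr 2 (((findEdge v).run s).reg 13) = s.reg 10) ∨
    ∀ e, L.Inc e (s.reg v) → s.arr 2 e ≠ s.reg 10 := by
  set t := (Cmd.assign 13 (.reg 0)).run s with ht
  have tv : t.reg v = s.reg v := by simp [ht, run, State.setReg, h13]
  have key := loop_induct (r := 20)
    (p := .ite (.and (incTest 20 v) (.eq (.read 2 (.reg 20)) (.reg 10)))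
      (.assign 13 (.reg 20)) .skip) rfl t
    (fun i s' => (L.Inc (s'.reg 13) (s.reg v) ∧ s.arr 2 (s'.reg 13) = s.reg 10) ∨
      (∀ e < i, L.Inc e (s.reg v) → s.arr 2 e ≠ s.reg 10))
    (.inr (by simp)) ?_
  · refine key.imp_right fun H e he => H e ?_ he
    have : t.reg 0 = L.m := h.m
    rw [this]
    exact he.1
  · intro i s' hi hr hx hj hI
    have hh' : Holds L s' := ⟨(hx 0 rfl).trans h.m, (hj 0 rfl).trans h.a, (hj 1 rfl).trans h.b⟩
    have him : s'.reg 20 < L.m := by rw [hr, ← h.m]; exact hi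
    have fv : s'.reg v = s.reg v := (hx v (by simp [writes, h13, h20])).trans tv
    have f10 : s'.reg 10 = s.reg 10 := hx 10 rfl
    have f2 : s'.arr 2 = s.arr 2 := hj 2 rfl
    simp only [run]
    split_ifs with hb <;>
      simp only [Test.eval_and, eval_incTest hh' him, Test.eval_eq, Expr.eval, hr, f2, fv, f10] at hb
    · left
      simpa [State.setReg, Function.update_apply, Expr.eval, hr] using hb
    · rcases hI with hI | hI
      · left; simpa [State.setReg, Function.update_apply] using hI
      · right
        intro e he
        rcases Nat.lt_succ_iff_lt_or_eq.1 he with he | rfl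
        · exact hI e he
        · exact fun h1 h2 => hb ⟨h1, h2⟩

/-- The conditions on the register numbers keep the inputs away from the scratch registers. The
comparison with register `2` discards uncoloured edges. -/
theorem thirdOf_spec (h : Holds L s) (hk : s.reg 2 ≤ L.m) {p v u w : ℕ} (hp : p ≠ 10)
    (hv : 20 < v) (hu : 20 < u) (hw : 20 < w) :
    (L.Inc (((thirdOf p v u w).run s).reg 13) (s.reg v) ∧
      ¬L.Inc (((thirdOf p v u w).run s).reg 13) (s.reg u) ∧
      ¬L.Inc (((thirdOf p v u w).run s).reg 13) (s.reg w) ∧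
      L.Missing (s.reg 2) (s.arr 2) (s.reg p) (s.arr 2 (((thirdOf p v u w).run s).reg 13))) ∨
    (((thirdOf p v u w).run s).reg 13 = L.m ∧ ∀ e, L.Inc e (s.reg v) →
      L.Missing (s.reg 2) (s.arr 2) (s.reg p) (s.arr 2 e) →
      L.Inc e (s.reg u) ∨ L.Inc e (s.reg w)) := by
  set s₁ := (Cmd.assign 11 (.reg p)).run ((Cmd.assign 10 (.reg p)).run s) with hs₁
  have h₁ : Holds L s₁ := ⟨h.m, h.a, h.b⟩
  have e10 : s₁.reg 10 = s.reg p := by simp [hs₁, run, State.setReg, Expr.eval]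
  have e11 : s₁.reg 11 = s.reg p := by simp [hs₁, run, State.setReg, Expr.eval, hp]
  have hmark : ∀ j, (j < s.reg 2 ∧ (markUsed.run s₁).arr 3 j = 0) ↔
      L.Missing (s.reg 2) (s.arr 2) (s.reg p) j := by
    intro j
    refine (missing_iff_mark h₁ hk).trans ?_
    rw [e10, e11, and_self]
    rfl
  set t := (Cmd.assign 13 (.reg 0)).run (markUsed.run s₁) with ht
  have hm0 : (markUsed.run s₁).reg 0 = L.m := (reg_run _ _ rfl).trans h.m
  have t0 : t.reg 0 = L.m := by rw [ht, ← hm0]; rfl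
  have t13 : t.reg 13 = L.m := by rw [ht, ← hm0]; rfl
  have hht : Holds L t := ⟨t0, (arr_run markUsed s₁ rfl).trans h₁.a,
    (arr_run markUsed s₁ rfl).trans h₁.b⟩
  have tx : ∀ x, 20 < x → t.reg x = s.reg x := by
    intro x hx
    have h13 : x ≠ 13 := by omega
    have h10 : x ≠ 10 := by omega
    have h11 : x ≠ 11 := by omega
    have h20 : x ≠ 20 := by omega
    have : (markUsed.run s₁).reg x = s₁.reg x := reg_run _ _ (by simp [markUsed, writes, h20])
    have h1 : s₁.reg x = s.reg x := by simp [hs₁, run, State.setReg, h10, h11]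
    rw [← h1, ← this]
    exact Function.update_of_ne h13 _ _
  have t2 : t.reg 2 = s.reg 2 := reg_run markUsed s₁ rfl
  have t2' : t.arr 2 = s.arr 2 := arr_run markUsed s₁ rfl
  have t3 : t.arr 3 = (markUsed.run s₁).arr 3 := rfl
  have key := loop_induct (r := 20)
    (p := .ite (.and (incTest 20 v) (.and (.not (incTest 20 u)) (.and (.not (incTest 20 w))
        (.and (.lt (.read 2 (.reg 20)) (.reg 2))
          (.eq (.read 3 (.read 2 (.reg 20))) (.const 0))))))
      (.assign 13 (.reg 20)) .skip) rfl t
    (fun i s' => (L.Inc (s'.reg 13) (s.reg v) ∧ ¬L.Inc (s'.reg 13) (s.reg u) ∧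
      ¬L.Inc (s'.reg 13) (s.reg w) ∧
      L.Missing (s.reg 2) (s.arr 2) (s.reg p) (s.arr 2 (s'.reg 13))) ∨
      (s'.reg 13 = L.m ∧ ∀ e < i, ¬(L.Inc e (s.reg v) ∧ ¬L.Inc e (s.reg u) ∧
        ¬L.Inc e (s.reg w) ∧ L.Missing (s.reg 2) (s.arr 2) (s.reg p) (s.arr 2 e))))
    (.inr ⟨t13, by simp⟩) ?_
  · rw [t0] at key
    refine key.imp_right fun ⟨H, H'⟩ => ⟨H, fun e he hm => ?_⟩
    have := H' e he.1
    tauto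
  · intro i s' hi hr hx hj hI
    have hh' : Holds L s' := ⟨(hx 0 rfl).trans t0, (hj 0 rfl).trans hht.a, (hj 1 rfl).trans hht.b⟩
    have him : s'.reg 20 < L.m := by rw [hr, ← t0]; exact hi
    have fx : ∀ x, 20 < x → s'.reg x = s.reg x := fun x h =>
      (hx x (by simp [writes]; omega)).trans (tx x h)
    have f2 : s'.reg 2 = s.reg 2 := (hx 2 rfl).trans t2
    have f2' : s'.arr 2 = s.arr 2 := (hj 2 rfl).trans t2'
    have f3 : s'.arr 3 = (markUsed.run s₁).arr 3 := hj 3 rfl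
    simp only [run]
    split_ifs with hb <;>
      simp only [Test.eval_and, Test.eval_not, eval_incTest hh' him, Test.eval_lt, Test.eval_eq,
        Expr.eval, hr, f2, f2', f3, fx v hv, fx u hu, fx w hw, hmark] at hb
    · left
      simpa [State.setReg, Function.update_apply, Expr.eval, hr] using hb
    · rcases hI with hI | ⟨hI, hI'⟩
      · left; simpa [State.setReg, Function.update_apply] using hI
      · right
        refine ⟨by simpa [State.setReg, Function.update_apply] using hI, fun e he => ?_⟩
        rcases Nat.lt_succ_iff_lt_or_eq.1 he with he | rfl
        · exact hI' e he
        · exact hb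

theorem otherEnd_spec (h : Holds L s) {e v w : ℕ} (hv : L.Inc (s.reg e) (s.reg v))
    (hl : L.a (s.reg e) ≠ L.b (s.reg e)) :
    L.Inc (s.reg e) (((otherEnd e v w).run s).reg w) ∧
      ((otherEnd e v w).run s).reg w ≠ s.reg v := by
  simp only [otherEnd, run]
  split_ifs with hb <;> simp only [Test.eval_eq, Expr.eval, h.a] at hb
  · simp only [State.setReg, Expr.eval, Function.update_self, h.b, ← hb]
    exact ⟨⟨hv.1, .inr rfl⟩, hl.symm⟩
  · simp only [State.setReg, Expr.eval, Function.update_self, h.a]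
    exact ⟨⟨hv.1, .inl rfl⟩, hb⟩

end Cmd

end RAM

/-! ### The Kempe exchange in linear time -/

namespace RAM

namespace Cmd

open EdgeList

variable {L : EdgeList ℕ} {s : State} {k : ℕ} {c : ℕ → ℕ}

/-- Properness allows only one edge of the given colour at `y`, so its entry is never overwritten.
Entries of other vertices may be stale, which is why `walkStep` checks the edge it reads. -/
theorem table_spec (h : Holds L s) (hp : L.Proper k (s.arr 2)) {j x : ℕ} (hx : s.reg x ≠ L.m)
    (hx20 : x ≠ 20) (h0 : j ≠ 0) (h1 : j ≠ 1) (h2 : j ≠ 2) {e y : ℕ} (he : L.Inc e y)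
    (hc : s.arr 2 e = s.reg x) : ((table j x).run s).arr j y = e := by
  have key := loop_induct (r := 20) (p := .ite (.eq (.read 2 (.reg 20)) (.reg x))
    (.seq (.store j (.read 0 (.reg 20)) (.reg 20)) (.store j (.read 1 (.reg 20)) (.reg 20))) .skip)
    rfl s (fun i s' => ∀ e < i, ∀ y, L.Inc e y → s.arr 2 e = s.reg x → s'.arr j y = e) (by simp) ?_
  · exact key e (by rw [h.m]; exact he.1) y he hc
  · intro i s' hi hr hx' hj hI e he y hey hec
    have f0 : s'.arr 0 = L.a := (hj 0 (by simp [writesArr, h0.symm])).trans h.a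
    have f1 : s'.arr 1 = L.b := (hj 1 (by simp [writesArr, h1.symm])).trans h.b
    have f2 : s'.arr 2 = s.arr 2 := hj 2 (by simp [writesArr, h2.symm])
    have fx : s'.reg x = s.reg x := hx' x (by simp [writes, hx20])
    simp only [run]
    split_ifs with hb <;> simp only [Test.eval_eq, Expr.eval, hr, f2, fx] at hb
    · simp only [State.setReg, State.setArr, Expr.eval, Function.update_self, hr,
        Function.update_apply, f0, f1, Ne.symm h1, if_false]
      by_cases hie : e = i
      · subst hie
        rcases hey.2 with h | h <;> simp [h]
      · have hlt : e < i := by omega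
        have hn : ¬L.Inc i y := fun hi' =>
          hp.ne e i y hey hi' hie (by rw [hec]; exact hx) (by rw [hec, hb])
        have := hI e hlt y hey hec
        have him : i < L.m := by rw [← h.m]; exact hi
        simp only [Inc, him, true_and, not_or] at hn
        simp [Ne.symm hn.1, Ne.symm hn.2, this]
    · rcases Nat.lt_succ_iff_lt_or_eq.1 he with he | rfl
      · exact hI e he y hey hec
      · exact absurd hec hb

/-- The data of a run along the alternating path from `v`. -/
structure Walking (L : EdgeList ℕ) (k : ℕ) (c : ℕ → ℕ) (γ β v : ℕ) (D : Set (ℕ × ℕ)) (s : State) :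
    Prop where
  holds : Holds L s
  col : s.arr 2 = c
  r10 : s.reg 10 = γ
  r11 : s.reg 11 = β
  t5 : ∀ e y, L.Inc e y → c e = γ → s.arr 5 y = e
  t6 : ∀ e y, L.Inc e y → c e = β → s.arr 6 y = e
  walk : L.Walk c γ β v D {e | e < L.m ∧ s.arr 7 e = 1} (s.reg 16) (s.reg 17) (s.reg 18)

/-- The walk cannot be continued. -/
def Stuck (L : EdgeList ℕ) (c : ℕ → ℕ) (s : State) : Prop :=
  ∀ f, L.Inc f (s.reg 16) → c f ≠ s.reg 17

variable {γ β v : ℕ} {D : Set (ℕ × ℕ)}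

theorem Walking.setReg (hw : Walking L k c γ β v D s) (n : ℕ) :
    Walking L k c γ β v D (s.setReg 21 n) := by
  have hx : ∀ x, x ≠ 21 → (s.setReg 21 n).reg x = s.reg x := fun x hx => by
    simp [State.setReg, hx]
  refine ⟨⟨(hx 0 (by omega)).trans hw.holds.m, hw.holds.a, hw.holds.b⟩, hw.col,
    (hx 10 (by omega)).trans hw.r10, (hx 11 (by omega)).trans hw.r11, hw.t5, hw.t6, ?_⟩
  rw [hx 16 (by omega), hx 17 (by omega), hx 18 (by omega)]
  exact hw.walk

theorem Stuck.setReg (h : Stuck L c s) (n : ℕ) : Stuck L c (s.setReg 21 n) := by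
  intro f hf
  have hx : ∀ x, x ≠ 21 → (s.setReg 21 n).reg x = s.reg x := fun x hx => by
    simp [State.setReg, hx]
  rw [hx 16 (by omega)] at hf
  rw [hx 17 (by omega)]
  exact h f hf

/-- Until the walk is stuck, every step adds a new pair to `D` by `Walk.not_mem`; afterwards a step
is idle. So the size of `D` counts the effective steps. -/
theorem walkStep_spec (hp : L.Proper k c) (hl : L.LoopFree c) (hγ : γ < k) (hγβ : γ ≠ β)
    (hv : L.Missing k c v β) (hw : Walking L k c γ β v D s) {n : ℕ}
    (hn : Stuck L c s ∨ n ≤ D.ncard) :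
    ∃ D', Walking L k c γ β v D' (walkStep.run s) ∧
      (Stuck L c (walkStep.run s) ∨ n + 1 ≤ D'.ncard) := by
  have hle := hp.le
  have hβ := hv.1
  set e := if s.reg 17 = γ then s.arr 5 (s.reg 16) else s.arr 6 (s.reg 16) with he
  set p₁ : Cmd := .ite (.eq (.reg 17) (.reg 10)) (.assign 19 (.read 5 (.reg 16)))
      (.assign 19 (.read 6 (.reg 16))) with hp₁
  have h₁ : p₁.run s = s.setReg 19 e := by
    simp only [hp₁, run]
    split_ifs with hb <;> simp only [Test.eval_eq, Expr.eval, hw.r10] at hb <;>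
      simp [he, hb, Expr.eval]
  have hcol := hw.walk.colours
  have hedge : ∀ f, L.Inc f (s.reg 16) → c f = s.reg 17 → f = e := by
    intro f hf hc
    rw [he]
    split_ifs with hb
    · exact (hw.t5 f _ hf (by omega)).symm
    · exact (hw.t6 f _ hf (by omega)).symm
  set s₁ := s.setReg 19 e with hs₁
  have e19 : s₁.reg 19 = e := by simp [hs₁, State.setReg]
  have ex : ∀ x, x ≠ 19 → s₁.reg x = s.reg x := fun x hx => by simp [hs₁, State.setReg, hx]
  have hh : Holds L s₁ := ⟨(ex 0 (by omega)).trans hw.holds.m, hw.holds.a, hw.holds.b⟩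
  have hrun : walkStep.run s = (Cmd.ite
      (.and (.lt (.reg 19) (.reg 0)) (.and (.eq (.read 2 (.reg 19)) (.reg 17)) (incTest 19 16)))
      (.seq (.store 7 (.reg 19) (.const 1)) (.seq (otherEnd 19 16 16)
        (.seq (.assign 23 (.reg 17)) (.seq (.assign 17 (.reg 18)) (.assign 18 (.reg 23))))))
      .skip).run s₁ := by
    rw [← h₁]; rfl
  have htest : (Test.and (.lt (.reg 19) (.reg 0))
      (.and (.eq (.read 2 (.reg 19)) (.reg 17)) (incTest 19 16))).eval s₁ = true ↔
      L.Inc e (s.reg 16) ∧ c e = s.reg 17 := by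
    simp only [Test.eval_and, Test.eval_lt, Test.eval_eq, Expr.eval, e19, hh.m, ex 17 (by omega)]
    have : s₁.arr 2 = c := hw.col
    rw [this]
    constructor
    · rintro ⟨h1, h2, h3⟩
      rw [eval_incTest hh (by rw [e19]; exact h1), e19, ex 16 (by omega)] at h3
      exact ⟨h3, h2⟩
    · rintro ⟨h1, h2⟩
      refine ⟨h1.1, h2, ?_⟩
      rw [eval_incTest hh (by rw [e19]; exact h1.1), e19, ex 16 (by omega)]
      exact h1
  by_cases hb : L.Inc e (s.reg 16) ∧ c e = s.reg 17
  · have hb' := htest.2 hb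
    have hns : ¬Stuck L c s := fun h => h e hb.1 hb.2
    have hn := hn.resolve_left hns
    set s₂ := s₁.setArr 7 e 1 with hs₂
    have hh₂ : Holds L s₂ := ⟨hh.m, hh.a, hh.b⟩
    have i₂ : L.Inc (s₂.reg 19) (s₂.reg 16) := by
      have : s₂.reg 19 = e := e19
      rw [this]
      have : s₂.reg 16 = s.reg 16 := ex 16 (by omega)
      rw [this]
      exact hb.1
    have ho := otherEnd_spec (w := 16) hh₂ i₂ (by
      have : s₂.reg 19 = e := e19
      rw [this]
      exact hl e hb.1.1 (by omega))
    have g19 : s₂.reg 19 = e := e19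
    have g16 : s₂.reg 16 = s.reg 16 := ex 16 (by omega)
    rw [g19, g16] at ho
    set s₃ := (otherEnd 19 16 16).run s₂ with hs₃
    have gx : ∀ x, x ≠ 16 → x ≠ 19 → s₃.reg x = s.reg x := fun x h h' =>
      (reg_run _ _ (by simp [otherEnd, writes, h])).trans (ex x h')
    have gj : s₃.arr = s₂.arr := by
      simp only [hs₃, otherEnd, run]
      split_ifs <;> rfl
    have hfin : walkStep.run s =
        (((s₃.setReg 23 (s.reg 17)).setReg 17 (s.reg 18)).setReg 18 (s.reg 17)) := by
      rw [hrun]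
      simp only [run, hb', if_true, Expr.eval, e19]
      rw [← hs₂, ← hs₃, gx 17 (by omega) (by omega)]
      simp [State.setReg, gx 18 (by omega) (by omega)]
    rw [hfin]
    have w16 : (((s₃.setReg 23 (s.reg 17)).setReg 17 (s.reg 18)).setReg 18 (s.reg 17)).reg 16 =
      s₃.reg 16 := by simp [State.setReg]
    have w17 : (((s₃.setReg 23 (s.reg 17)).setReg 17 (s.reg 18)).setReg 18 (s.reg 17)).reg 17 =
      s.reg 18 := by simp [State.setReg]
    have w18 : (((s₃.setReg 23 (s.reg 17)).setReg 17 (s.reg 18)).setReg 18 (s.reg 17)).reg 18 =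
      s.reg 17 := by simp [State.setReg]
    have wx : ∀ x < 16, (((s₃.setReg 23 (s.reg 17)).setReg 17 (s.reg 18)).setReg 18
      (s.reg 17)).reg x = s.reg x := fun x hx => by
        have : x ≠ 23 := by omega
        have h1 : x ≠ 17 := by omega
        have h2 : x ≠ 18 := by omega
        simp [State.setReg, this, h1, h2, gx x (by omega) (by omega)]
    have wa : ∀ j, j ≠ 7 → (((s₃.setReg 23 (s.reg 17)).setReg 17 (s.reg 18)).setReg 18
      (s.reg 17)).arr j = s.arr j := fun j hj => by
        simp [State.setReg, gj, hs₂, State.setArr, hj, hs₁]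
    have w7 : (((s₃.setReg 23 (s.reg 17)).setReg 17 (s.reg 18)).setReg 18 (s.reg 17)).arr 7 =
      Function.update (s.arr 7) e 1 := by
        simp [State.setReg, gj, hs₂, State.setArr, hs₁]
    set s₄ := (((s₃.setReg 23 (s.reg 17)).setReg 17 (s.reg 18)).setReg 18 (s.reg 17)) with hs₄
    refine ⟨insert (s.reg 16, s.reg 17) D, ⟨⟨(wx 0 (by omega)).trans hw.holds.m,
      (wa 0 (by omega)).trans hw.holds.a, (wa 1 (by omega)).trans hw.holds.b⟩,
      (wa 2 (by omega)).trans hw.col, (wx 10 (by omega)).trans hw.r10,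
      (wx 11 (by omega)).trans hw.r11, ?_, ?_, ?_⟩, .inr ?_⟩
    · rw [wa 5 (by omega)]; exact hw.t5
    · rw [wa 6 (by omega)]; exact hw.t6
    · have hcons := hw.walk.cons hb.1 ho.1 ho.2.symm hb.2
      rw [w16, w17, w18, w7]
      convert hcons using 1
      ext f
      simp only [Set.mem_ofPred_eq, Set.mem_insert_iff, Function.update_apply]
      split_ifs with hfe
      · simp [hfe, hb.1.1]
      · simp [hfe]
    · rw [Set.ncard_insert_of_notMem (hw.walk.not_mem hp (by omega) (by omega) hγβ hv)
        hw.walk.ncard_le.1]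
      omega
  · have hb' : ¬_ := mt htest.1 hb
    have hfin : walkStep.run s = s₁ := by
      rw [hrun]
      simp only [run]
      rw [if_neg hb']
    -- The table entry `e` is the only possible continuation, and it failed the check.
    have hstuck : Stuck L c s := fun f hf hc => hb (hedge f hf hc ▸ ⟨hf, hc⟩)
    rw [hfin]
    exact ⟨D, ⟨hh, hw.col, hw.r10, hw.r11, hw.t5, hw.t6, hw.walk⟩, .inl hstuck⟩

theorem flip_spec (h : Holds L s) : ∀ e < L.m, (flip.run s).arr 2 e =
    exchange (s.arr 2) (s.reg 10) (s.reg 11) {e | e < L.m ∧ s.arr 7 e = 1} e := by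
  have key := loop_induct (r := 20) (p := .ite (.eq (.read 7 (.reg 20)) (.const 1))
    (.ite (.eq (.read 2 (.reg 20)) (.reg 10)) (.store 2 (.reg 20) (.reg 11))
      (.store 2 (.reg 20) (.reg 10))) .skip) rfl s (fun i s' => ∀ e < L.m, s'.arr 2 e =
        if e < i then exchange (s.arr 2) (s.reg 10) (s.reg 11) {e | e < L.m ∧ s.arr 7 e = 1} e
        else s.arr 2 e) (by simp [State.setReg]) ?_
  · intro e he
    rw [h.m] at key
    exact (key e he).trans (if_pos he)
  · intro i s' hi hr hx hj hI e he
    have f10 : s'.reg 10 = s.reg 10 := hx 10 rfl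
    have f11 : s'.reg 11 = s.reg 11 := hx 11 rfl
    have f7 : s'.arr 7 = s.arr 7 := hj 7 rfl
    have him : i < L.m := by rw [← h.m]; exact hi
    have hi2 := hI i him
    rw [if_neg (lt_irrefl i)] at hi2
    have hne : ∀ (x : ℕ), e ≠ i → (if e < i + 1 then x else s.arr 2 e) = if e < i then x else s.arr 2 e := by
      intro x hei
      have : e < i + 1 ↔ e < i := by omega
      simp only [this]
    by_cases hei : e = i
    · subst hei
      rw [if_pos (Nat.lt_succ_self _)]
      simp only [exchange, Set.mem_ofPred_eq, him, true_and]
      simp only [run, apply_ite (fun s : State => (s.setReg 20 (e + 1)).arr 2 e), Test.eval_eq,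
        Expr.eval, hr, f10, f11, f7, hi2]
      simp [State.setArr, State.setReg, hi2]
    · rw [hne _ hei, ← hI e he]
      simp only [run]
      split_ifs <;> simp [State.setArr, State.setReg, hr, Expr.eval, hei]

/-- The loop makes `3m` steps and `D` has at most `2m` elements, so the walk is stuck at the end and
the marked edges form the whole alternating path. -/
theorem kempe_spec (h : Holds L s) (hp : L.Proper k (s.arr 2)) (hl : L.LoopFree (s.arr 2))
    (hγ : s.reg 10 < k) (hγβ : s.reg 10 ≠ s.reg 11)
    (hv : L.Missing k (s.arr 2) (s.reg 12) (s.reg 11)) :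
    L.Exchanged k (s.arr 2) (s.reg 10) (s.reg 11) (s.reg 12) ((kempe.run s).arr 2) := by
  have hle := hp.le
  have hβ := hv.1
  set p₁ : Cmd := .loop 20 (.store 7 (.reg 20) (.const 0)) with hp₁
  set s₁ := p₁.run s with hs₁
  have h1 : ∀ j < L.m, s₁.arr 7 j = 0 := by
    rw [← h.m]
    refine loop_induct rfl s (fun i s' => ∀ j < i, s'.arr 7 j = 0) (by simp) ?_
    intro i s' hi hr _ _ hI j hj
    simp only [run, State.setReg, State.setArr, Expr.eval, Function.update_self, hr,
      Function.update_apply]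
    split_ifs with hji
    · rfl
    · exact hI j (by omega)
  set s₂ := (table 5 10).run s₁ with hs₂
  set s₃ := (table 6 11).run s₂ with hs₃
  set s₄ := (Cmd.assign 18 (.reg 11)).run ((Cmd.assign 17 (.reg 10)).run
    ((Cmd.assign 16 (.reg 12)).run s₃)) with hs₄
  have r1 : ∀ x, x ≠ 20 → s₁.reg x = s.reg x := fun x hx => reg_run _ _ (by simp [hp₁, writes, hx])
  have r2 : ∀ x, x ≠ 20 → s₂.reg x = s.reg x := fun x hx =>
    (reg_run _ _ (by simp [table, writes, hx])).trans (r1 x hx)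
  have r3 : ∀ x, x ≠ 20 → s₃.reg x = s.reg x := fun x hx =>
    (reg_run _ _ (by simp [table, writes, hx])).trans (r2 x hx)
  have c1 : s₁.arr 2 = s.arr 2 := arr_run _ _ rfl
  have c2 : s₂.arr 2 = s.arr 2 := (arr_run _ _ rfl).trans c1
  have c3 : s₃.arr 2 = s.arr 2 := (arr_run _ _ rfl).trans c2
  have hh1 : Holds L s₁ := h.run rfl rfl rfl
  have hh2 : Holds L s₂ := hh1.run rfl rfl rfl
  have hh3 : Holds L s₃ := hh2.run rfl rfl rfl
  have e16 : s₄.reg 16 = s.reg 12 := by simp [hs₄, run, State.setReg, Expr.eval, r3]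
  have e17 : s₄.reg 17 = s.reg 10 := by simp [hs₄, run, State.setReg, Expr.eval, r3]
  have e18 : s₄.reg 18 = s.reg 11 := by simp [hs₄, run, State.setReg, Expr.eval, r3]
  have e10 : s₄.reg 10 = s.reg 10 := by simp [hs₄, run, State.setReg, r3]
  have e11 : s₄.reg 11 = s.reg 11 := by simp [hs₄, run, State.setReg, r3]
  have e7 : s₄.arr 7 = s₁.arr 7 := (arr_run (table 6 11) s₂ rfl).trans (arr_run (table 5 10) s₁ rfl)
  have e6 : s₄.arr 6 = s₃.arr 6 := rfl
  have e5 : s₄.arr 5 = s₂.arr 5 := arr_run (table 6 11) s₂ rfl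
  have hw : Walking L k (s.arr 2) (s.reg 10) (s.reg 11) (s.reg 12) ∅ s₄ := by
    refine ⟨⟨hh3.m, hh3.a, hh3.b⟩, c3, e10, e11, fun e y he hc => ?_, fun e y he hc => ?_, ?_⟩
    · rw [e5]
      have r := r1 10 (by omega)
      exact table_spec hh1 (c1.symm ▸ hp) (by omega) (by omega) (by omega) (by omega) (by omega) he
        (by rw [c1, r, hc])
    · rw [e6]
      have r := r2 11 (by omega)
      exact table_spec hh2 (c2.symm ▸ hp) (by omega) (by omega) (by omega) (by omega) (by omega) he
        (by rw [c2, r, hc])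
    · rw [e16, e17, e18, e7]
      have : {e | e < L.m ∧ s₁.arr 7 e = 1} = ∅ := by
        ext e
        simp only [Set.mem_ofPred_eq, Set.mem_empty_iff_false, iff_false]
        rintro ⟨h2, h3⟩
        have := h1 e h2
        omega
      rw [this]
      exact .nil
  have hnil : ∃ D, Walking L k (s.arr 2) (s.reg 10) (s.reg 11) (s.reg 12) D (s₄.setReg 21 0) ∧
      (Stuck L (s.arr 2) (s₄.setReg 21 0) ∨ 3 * 0 ≤ D.ncard) :=
    ⟨∅, hw.setReg 0, .inr (Nat.zero_le _)⟩
  have hstep : ∀ i s', (∃ D, Walking L k (s.arr 2) (s.reg 10) (s.reg 11) (s.reg 12) D s' ∧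
      (Stuck L (s.arr 2) s' ∨ 3 * i ≤ D.ncard)) →
      ∃ D, Walking L k (s.arr 2) (s.reg 10) (s.reg 11) (s.reg 12) D
        (((Cmd.seq walkStep (.seq walkStep walkStep)).run s').setReg 21 (i + 1)) ∧
      (Stuck L (s.arr 2) (((Cmd.seq walkStep (.seq walkStep walkStep)).run s').setReg 21 (i + 1)) ∨
        3 * (i + 1) ≤ D.ncard) := by
    rintro i s' ⟨D, hD, hst⟩
    obtain ⟨D₁, hD₁, hst₁⟩ := walkStep_spec hp hl hγ hγβ hv hD hst
    obtain ⟨D₂, hD₂, hst₂⟩ := walkStep_spec hp hl hγ hγβ hv hD₁ hst₁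
    obtain ⟨D₃, hD₃, hst₃⟩ := walkStep_spec hp hl hγ hγβ hv hD₂ hst₂
    rw [run_seq, run_seq]
    exact ⟨D₃, hD₃.setReg _, hst₃.imp_left fun h => h.setReg _⟩
  have key := loop_induct (r := 21) (p := .seq walkStep (.seq walkStep walkStep)) rfl s₄
    (fun i s' => ∃ D, Walking L k (s.arr 2) (s.reg 10) (s.reg 11) (s.reg 12) D s' ∧
      (Stuck L (s.arr 2) s' ∨ 3 * i ≤ D.ncard)) hnil fun i s' _ _ _ _ => hstep i s'
  have e0 : s₄.reg 0 = L.m := by simp [hs₄, run, State.setReg, hh3.m]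
  rw [e0] at key
  set s₅ := (Cmd.loop 21 (.seq walkStep (.seq walkStep walkStep))).run s₄ with hs₅
  have hrun : kempe.run s = flip.run s₅ := by
    rw [kempe, run_seq, run_seq, run_seq, run_seq, run_seq, run_seq, run_seq]
  rw [hrun]
  obtain ⟨D, hD, hst⟩ := key
  have hstuck : Stuck L (s.arr 2) s₅ := by
    -- The strict inequality `2m < 3m` needs `m > 0`, which follows from `γ < k ≤ m`.
    refine hst.resolve_right fun h => ?_
    have := hD.walk.ncard_le.2
    omega
  refine hD.walk.exchanged hp hγ hγβ hv hstuck fun e he => ?_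
  have := flip_spec hD.holds e he
  rwa [hD.col, hD.r10, hD.r11] at this

end Cmd

end RAM

/-! ### Fans with two leaves -/

namespace EdgeList

variable {α : Type*}

/-- An uncoloured edge `e` with distinct ends `u` and `v` in a proper partial colouring. -/
structure Uncoloured (L : EdgeList α) (k : ℕ) (c : ℕ → ℕ) (e : ℕ) (u v : α) : Prop where
  proper : L.Proper k c
  loopFree : L.LoopFree c
  lt : k < L.m
  col : c e = L.m
  ne : u ≠ v
  left : L.Inc e u
  right : L.Inc e v

/-- An edge `g` from `v` to a vertex `w` other than `u` whose colour is missing at `u`. -/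
structure Leaf (L : EdgeList α) (k : ℕ) (c : ℕ → ℕ) (u v : α) (g : ℕ) (w : α) : Prop where
  left_ne : u ≠ w
  ne_right : w ≠ v
  right : L.Inc g v
  inc : L.Inc g w
  missing : L.Missing k c u (c g)

/-- No colour is missing at both `x` and `y`. -/
def NoCommon (L : EdgeList α) (k : ℕ) (c : ℕ → ℕ) (x y : α) : Prop :=
  ∀ j, L.Missing k c x j → ¬L.Missing k c y j

variable {L : EdgeList α} {k : ℕ} {c c' : ℕ → ℕ} {e g γ β : ℕ} {u v w x y : α}

theorem NoCommon.symm (h : L.NoCommon k c x y) : L.NoCommon k c y x := fun j h1 h2 => h j h2 h1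

theorem Uncoloured.symm (h : L.Uncoloured k c e u v) : L.Uncoloured k c e v u :=
  ⟨h.proper, h.loopFree, h.lt, h.col, h.ne.symm, h.right, h.left⟩

theorem Uncoloured.exchanged (h : L.Uncoloured k c e u v) (hx : L.Exchanged k c γ β x c') :
    L.Uncoloured k c' e u v :=
  ⟨hx.proper, fun f hf hm => h.loopFree f hf (mt (hx.dom f hf).2 hm), h.lt,
    (hx.dom e h.left.1).2 h.col, h.ne, h.left, h.right⟩

/-- The colour of `g` is neither `γ` nor `β`, the latter being missing at `v`, so the exchange
affects neither this colour nor where it is missing. -/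
theorem Leaf.exchanged (h : L.Leaf k c u v g w) (hx : L.Exchanged k c γ β v c') (hγ : c g ≠ γ)
    (hβ : L.Missing k c v β) : L.Leaf k c' u v g w := by
  have hgβ := hβ.2 g h.right
  refine ⟨h.left_ne, h.ne_right, h.right, h.inc, ?_⟩
  rw [hx.eq g h.right.1 hγ hgβ]
  exact (hx.missing_iff u (c g) hγ hgβ).2 h.missing

theorem Done.of_exchanged {k' : ℕ} {c'' : ℕ → ℕ} (hx : L.Exchanged k c γ β x c')
    (h : L.Done k c' e k' c'') : L.Done k c e k' c'' :=
  ⟨h.proper, fun f hf => by rw [h.dom f hf, hx.dom f hf], h.bound⟩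

end EdgeList

namespace RAM

namespace Cmd

open EdgeList

/-- Run a command only if the edge in register `r` is uncoloured. -/
def guarded (r : ℕ) (p : Cmd) : Cmd := .ite (.eq (.read 2 (.reg r)) (.reg 0)) p .skip

/-- Give a new colour to the edge in register `r`. -/
def newColour (r : ℕ) : Cmd := .seq (.store 2 (.reg r) (.reg 2)) (.incr 2)

/-- Colour the edge in register `40` with a colour missing at both ends. -/
def tryEnds : Cmd :=
  .seq (commonOf 41 42) (.ite (.lt (.reg 13) (.reg 0)) (.store 2 (.reg 40) (.reg 13)) .skip)

/-- Pass the colour of the edge in register `43` to the one in register `40` and recolour it. -/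
def tryLeaf : Cmd :=
  .seq (commonOf 44 42) (.ite (.lt (.reg 13) (.reg 0))
    (.seq (.store 2 (.reg 40) (.read 2 (.reg 43))) (.store 2 (.reg 43) (.reg 13))) .skip)

/-- Exchange the contents of two registers. -/
def swapRegs (x y : ℕ) : Cmd :=
  .seq (.assign 24 (.reg x)) (.seq (.assign x (.reg y)) (.assign y (.reg 24)))

/-- Exchange the two leaves. -/
def swapLeaves : Cmd := .seq (swapRegs 43 45) (swapRegs 44 46)

/-- Exchange the colour in register `13` and a colour missing at the vertex in register `42` on the
alternating path starting there. -/
def kempeAt : Cmd :=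
  .seq (.assign 47 (.reg 13)) (.seq (commonOf 42 42) (.ite (.lt (.reg 13) (.reg 0))
    (.seq (.assign 11 (.reg 13)) (.seq (.assign 10 (.reg 47)) (.seq (.assign 12 (.reg 42)) kempe)))
    (newColour 40)))

/-- Use a colour missing at the vertices in registers `41` and `44`. -/
def pairEnd : Cmd :=
  .seq (commonOf 41 44) (.ite (.lt (.reg 13) (.reg 0))
    (.seq kempeAt (.seq (guarded 40 tryEnds) (guarded 40 tryLeaf))) .skip)

/-- Use a colour missing at the vertices in registers `44` and `46`. -/
def pairLeaves : Cmd :=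
  .seq (commonOf 44 46) (.ite (.lt (.reg 13) (.reg 0))
    (.seq kempeAt (.seq (guarded 40 tryLeaf) (guarded 40 (.seq swapLeaves tryLeaf)))) .skip)

/-- Colour the edge in register `40` using two leaves. -/
def star : Cmd :=
  .seq tryEnds (.seq (guarded 40 tryLeaf) (.seq (guarded 40 (.seq swapLeaves tryLeaf))
    (.seq (guarded 40 pairEnd) (.seq (guarded 40 (.seq swapLeaves pairEnd))
      (.seq (guarded 40 pairLeaves) (guarded 40 (newColour 40)))))))

/-- The command leaves alone the graph, the colouring and the registers `40`, …, `46`. -/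
def keeps (p : Cmd) : Bool :=
  [0, 2, 40, 41, 42, 43, 44, 45, 46].all (fun x => !p.writes x) &&
    [0, 1, 2].all (fun j => !p.writesArr j)

end Cmd

open EdgeList

/-- The registers hold the uncoloured edge, its ends, and two leaves. -/
structure At (L : EdgeList ℕ) (k : ℕ) (c : ℕ → ℕ) (e u v g w g' w' : ℕ) (s : State) : Prop where
  holds : Holds L s
  colours : s.reg 2 = k
  col : s.arr 2 = c
  r40 : s.reg 40 = e
  r41 : s.reg 41 = u
  r42 : s.reg 42 = v
  r43 : s.reg 43 = g
  r44 : s.reg 44 = w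
  r45 : s.reg 45 = g'
  r46 : s.reg 46 = w'

/-- The edge `e`, stored in register `r`, has been coloured. -/
structure Finished (L : EdgeList ℕ) (k : ℕ) (c : ℕ → ℕ) (e r : ℕ) (s : State) : Prop where
  holds : Holds L s
  reg : s.reg r = e
  done : L.Done k c e (s.reg 2) (s.arr 2)

namespace Cmd

variable {L : EdgeList ℕ} {s : State} {k : ℕ} {c : ℕ → ℕ} {e u v g w g' w' r : ℕ} {p : Cmd}

theorem _root_.RAM.At.run (h : At L k c e u v g w g' w' s) (hp : p.keeps = true) :
    At L k c e u v g w g' w' (p.run s) := by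
  simp only [keeps, List.all_cons, List.all_nil, Bool.and_true, Bool.and_eq_true,
    Bool.not_eq_true'] at hp
  obtain ⟨⟨h0, h2, h40, h41, h42, h43, h44, h45, h46⟩, a0, a1, a2⟩ := hp
  exact ⟨h.holds.run h0 a0 a1, (reg_run p s h2).trans h.colours, (arr_run p s a2).trans h.col,
    (reg_run p s h40).trans h.r40, (reg_run p s h41).trans h.r41, (reg_run p s h42).trans h.r42,
    (reg_run p s h43).trans h.r43, (reg_run p s h44).trans h.r44, (reg_run p s h45).trans h.r45,
    (reg_run p s h46).trans h.r46⟩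

theorem run_guarded (h : s.arr 2 (s.reg r) = s.reg 0) : (guarded r p).run s = p.run s := by
  simp only [guarded, run]
  exact if_pos ((Test.eval_eq s (.read 2 (.reg r)) (.reg 0)).2 h)

theorem run_guarded_of_ne (h : s.arr 2 (s.reg r) ≠ s.reg 0) : (guarded r p).run s = s := by
  simp only [guarded, run]
  exact if_neg (mt (Test.eval_eq s (.read 2 (.reg r)) (.reg 0)).1 h)

theorem _root_.RAM.Finished.guarded (h : Finished L k c e r s) (he : e < L.m) :
    (guarded r p).run s = s := by
  refine run_guarded_of_ne fun hm => ?_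
  rw [h.reg, h.holds.m] at hm
  exact ((h.done.dom e he).1 hm).2 rfl

/-- Chains attempts: `P` collects what is known while the edge is still uncoloured, and a success
makes the later attempts idle. -/
theorem guarded_spec {P : Prop} {Q : State → Prop} (he : e < L.m) (h : Finished L k c e r s ∨ P)
    (hP : P → s.arr 2 (s.reg r) = s.reg 0)
    (hQ : P → Finished L k c e r (p.run s) ∨ Q (p.run s)) :
    Finished L k c e r ((guarded r p).run s) ∨ Q ((guarded r p).run s) := by
  rcases h with h | h
  · left
    rwa [h.guarded he]
  · rw [run_guarded (hP h)]
    exact hQ h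

theorem _root_.RAM.At.uncoloured (h : At L k c e u v g w g' w' s) (hc : c e = L.m) :
    s.arr 2 (s.reg 40) = s.reg 0 := by
  rw [h.r40, h.col, hc, h.holds.m]

theorem newColour_spec (h : Holds L s) (hk : s.reg 2 = k) (hc : s.arr 2 = c) (hr : s.reg r = e)
    (hr2 : r ≠ 2) (hp : L.Proper k c) (hlt : k < L.m) (hce : c e = L.m) (hB : ¬L.Bounds k) :
    Finished L k c e r ((newColour r).run s) := by
  have hrun : (newColour r).run s = (s.setArr 2 e k).setReg 2 (k + 1) := by
    have h1 : (s.setArr 2 e k).reg = s.reg := rfl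
    simp only [newColour, run, Expr.eval, hr, hk, h1, h.m, if_pos hlt]
  rw [hrun]
  refine ⟨⟨?_, h.a, h.b⟩, ?_, ?_⟩
  · simpa [State.setReg, State.setArr] using h.m
  · simpa [State.setReg, State.setArr, hr2] using hr
  · have := hp.addColour hlt hce hB
    simpa [State.setReg, State.setArr, hc] using this

/-- The outcome of the search for a common missing colour. -/
theorem common_cases (h : At L k c e u v g w g' w' s) (hk : k < L.m) {x y : ℕ} (hy : y ≠ 10)
    (hkeep : (commonOf x y).keeps = true) (p q : Cmd) :
    (∃ t, At L k c e u v g w g' w' t ∧ L.Missing k c (s.reg x) (t.reg 13) ∧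
      L.Missing k c (s.reg y) (t.reg 13) ∧ t = (commonOf x y).run s ∧
      (Cmd.seq (commonOf x y) (.ite (.lt (.reg 13) (.reg 0)) p q)).run s = p.run t) ∨
    (∃ t, At L k c e u v g w g' w' t ∧ L.NoCommon k c (s.reg x) (s.reg y) ∧
      t = (commonOf x y).run s ∧
      (Cmd.seq (commonOf x y) (.ite (.lt (.reg 13) (.reg 0)) p q)).run s = q.run t) := by
  have hs := commonOf_spec (x := x) h.holds (by rw [h.colours]; exact hk.le) hy
  rw [h.colours, h.col] at hs
  have ht := h.run hkeep
  rcases hs with ⟨h1, h2⟩ | ⟨h1, h2⟩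
  · refine .inl ⟨_, ht, h1, h2, rfl, ?_⟩
    rw [run_seq]
    simp only [run]
    refine if_pos ((Test.eval_lt _ _ _).2 ?_)
    simp only [Expr.eval, ht.holds.m]
    exact h1.1.trans hk
  · refine .inr ⟨_, ht, h2, rfl, ?_⟩
    rw [run_seq]
    simp only [run]
    refine if_neg (mt (Test.eval_lt _ _ _).1 ?_)
    simp only [Expr.eval, ht.holds.m, h1, lt_irrefl, not_false_eq_true]

/-- The ends `u` and `v` may coincide, so that the same command serves for loops. -/
theorem tryEnds_spec (h : At L k c e u v g w g' w' s) (hp : L.Proper k c) (hlt : k < L.m)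
    (hc : c e = L.m) (hends : ∀ x, L.Inc e x → x = u ∨ x = v) :
    Finished L k c e 40 (tryEnds.run s) ∨
      (At L k c e u v g w g' w' (tryEnds.run s) ∧ L.NoCommon k c u v) := by
  rw [tryEnds]
  rcases common_cases (x := 41) (y := 42) h hlt (by omega) rfl (.store 2 (.reg 40) (.reg 13)) .skip
    with ⟨t, ht, h1, h2, -, h3⟩ | ⟨t, ht, h1, -, h3⟩
  · rw [h.r41] at h1
    rw [h.r42] at h2
    have := hp.extend (j := t.reg 13) hc fun x hx => by
      rcases hends x hx with rfl | rfl <;> assumption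
    left
    rw [h3]
    refine ⟨⟨ht.holds.m, ht.holds.a, ht.holds.b⟩, ht.r40, ?_⟩
    simp only [run, Expr.eval, State.setArr, Function.update_self, ht.r40, ht.colours, ht.col]
    exact this
  · rw [h3, ← h.r41, ← h.r42]
    exact .inr ⟨by rw [h.r41, h.r42]; exact ht, h1⟩

theorem _root_.EdgeList.Uncoloured.ends (h : L.Uncoloured k c e u v) (x : ℕ) (hx : L.Inc e x) :
    x = u ∨ x = v := h.left.eq_or_eq h.right h.ne hx

theorem tryLeaf_spec (h : At L k c e u v g w g' w' s) (hu : L.Uncoloured k c e u v)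
    (hg : L.Leaf k c u v g w) :
    Finished L k c e 40 (tryLeaf.run s) ∨
      (At L k c e u v g w g' w' (tryLeaf.run s) ∧ L.NoCommon k c w v) := by
  rw [tryLeaf]
  rcases common_cases (x := 44) (y := 42) h hu.lt (by omega) rfl
    (.seq (.store 2 (.reg 40) (.read 2 (.reg 43))) (.store 2 (.reg 43) (.reg 13))) .skip
    with ⟨t, ht, h1, h2, -, h3⟩ | ⟨t, ht, h1, -, h3⟩
  · rw [h.r44] at h1
    rw [h.r42] at h2
    have := hu.proper.extend_shift hu.ne hg.left_ne hg.ne_right hu.left hu.right hu.col hg.right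
      hg.inc hg.missing h2 h1
    left
    rw [h3]
    refine ⟨⟨ht.holds.m, ht.holds.a, ht.holds.b⟩, ht.r40, ?_⟩
    simp only [run, Expr.eval, State.setArr, Function.update_self, ht.r40, ht.r43, ht.colours,
      ht.col]
    exact this
  · rw [h3, ← h.r44, ← h.r42]
    exact .inr ⟨by rw [h.r44, h.r42]; exact ht, h1⟩

theorem swapLeaves_spec (h : At L k c e u v g w g' w' s) :
    At L k c e u v g' w' g w (swapLeaves.run s) := by
  constructor
  case holds => exact h.holds.run rfl rfl rfl
  all_goals
    simp only [swapLeaves, swapRegs, run, State.setReg, Expr.eval]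
    simp [h.colours, h.col, h.r40, h.r41, h.r42, h.r43, h.r44, h.r45, h.r46]

/-- The second colour `β` is any colour missing at `v`; it differs from the first because that one
occurs at `v`. If no `β` exists, the degree bound fails and a new colour is justified. -/
theorem kempeAt_spec (h : At L k c e u v g w g' w' s) (hu : L.Uncoloured k c e u v)
    (hγ : s.reg 13 < k) (hv : ¬L.Missing k c v (s.reg 13)) :
    Finished L k c e 40 (kempeAt.run s) ∨ ∃ β c', L.Missing k c v β ∧
      L.Exchanged k c (s.reg 13) β v c' ∧ At L k c' e u v g w g' w' (kempeAt.run s) := by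
  set s₁ := (Cmd.assign 47 (.reg 13)).run s with hs₁
  have h₁ : At L k c e u v g w g' w' s₁ := h.run rfl
  have e47 : s₁.reg 47 = s.reg 13 := rfl
  have hrun : kempeAt.run s = (Cmd.seq (commonOf 42 42) (.ite (.lt (.reg 13) (.reg 0))
    (.seq (.assign 11 (.reg 13)) (.seq (.assign 10 (.reg 47)) (.seq (.assign 12 (.reg 42)) kempe)))
    (newColour 40))).run s₁ := by rw [kempeAt, run_seq]
  rcases common_cases (x := 42) (y := 42) h₁ hu.lt (by omega) rfl
    (.seq (.assign 11 (.reg 13)) (.seq (.assign 10 (.reg 47)) (.seq (.assign 12 (.reg 42)) kempe)))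
    (newColour 40) with ⟨t, ht, h1, -, h4, h3⟩ | ⟨t, ht, h1, -, h3⟩
  · right
    rw [hrun, h3, run_seq, run_seq, run_seq]
    rw [h₁.r42] at h1
    set t₁ := (Cmd.assign 12 (.reg 42)).run ((Cmd.assign 10 (.reg 47)).run
      ((Cmd.assign 11 (.reg 13)).run t)) with ht₁
    have e47' : t.reg 47 = s.reg 13 := by
      rw [← e47, h4]
      exact reg_run _ _ rfl
    have a₁ : At L k c e u v g w g' w' t₁ := by
      have := ht.run (p := .seq (.assign 11 (.reg 13)) (.seq (.assign 10 (.reg 47))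
        (.assign 12 (.reg 42)))) rfl
      exact this
    have f10 : t₁.reg 10 = s.reg 13 := by
      rw [← e47']; simp [ht₁, run, State.setReg, Expr.eval]
    have f11 : t₁.reg 11 = t.reg 13 := by simp [ht₁, run, State.setReg, Expr.eval]
    have f12 : t₁.reg 12 = v := by
      rw [← ht.r42]; simp [ht₁, run, State.setReg, Expr.eval]
    have hk := kempe_spec (k := k) a₁.holds (by rw [a₁.col]; exact hu.proper)
      (by rw [a₁.col]; exact hu.loopFree) (by rw [f10]; exact hγ)
      (by rw [f10, f11]; exact fun h => hv (h ▸ h1)) (by rw [a₁.col, f11, f12]; exact h1)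
    rw [a₁.col, f10, f11, f12] at hk
    refine ⟨_, _, h1, hk, ⟨a₁.holds.run rfl rfl rfl, ?_, rfl, ?_, ?_, ?_, ?_, ?_, ?_, ?_⟩⟩
    · exact (reg_run kempe t₁ rfl).trans a₁.colours
    · exact (reg_run kempe t₁ rfl).trans a₁.r40
    · exact (reg_run kempe t₁ rfl).trans a₁.r41
    · exact (reg_run kempe t₁ rfl).trans a₁.r42
    · exact (reg_run kempe t₁ rfl).trans a₁.r43
    · exact (reg_run kempe t₁ rfl).trans a₁.r44
    · exact (reg_run kempe t₁ rfl).trans a₁.r45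
    · exact (reg_run kempe t₁ rfl).trans a₁.r46
  · left
    rw [hrun, h3]
    refine newColour_spec ht.holds ht.colours ht.col ht.r40 (by omega) hu.proper hu.lt hu.col ?_
    intro hB
    obtain ⟨j, hj⟩ := hB.exists_missing hu.proper.le hu.right hu.col
    rw [h₁.r42] at h1
    exact h1 j hj hj

/-- A completed colouring after an exchange is a completed colouring before it. -/
theorem _root_.RAM.Finished.of_exchanged {γ β x : ℕ} {c' : ℕ → ℕ}
    (hx : L.Exchanged k c γ β x c') (h : Finished L k c' e r s) : Finished L k c e r s :=
  ⟨h.holds, h.reg, h.done.of_exchanged hx⟩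

/-- Let `γ` be missing at `u` and `w`. After the exchange from `v` it is missing at `v` and still at
one of `u` and `w`, because the path has only one other end. So colouring `e` directly or passing on
the colour of the leaf succeeds. -/
theorem pairEnd_spec (h : At L k c e u v g w g' w' s) (hu : L.Uncoloured k c e u v)
    (hg : L.Leaf k c u v g w) (huv : L.NoCommon k c u v) :
    Finished L k c e 40 (pairEnd.run s) ∨
      (At L k c e u v g w g' w' (pairEnd.run s) ∧ L.NoCommon k c u w) := by
  rw [pairEnd]
  rcases common_cases (x := 41) (y := 44) h hu.lt (by omega) rfl
    (.seq kempeAt (.seq (guarded 40 tryEnds) (guarded 40 tryLeaf))) .skip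
    with ⟨t, ht, h1, h2, -, h3⟩ | ⟨t, ht, h1, -, h3⟩
  · left
    rw [h3, run_seq, run_seq]
    rw [h.r41] at h1
    rw [h.r44] at h2
    rcases kempeAt_spec ht hu h1.1 (huv _ h1) with hk | ⟨β, c', hβ, hx, hk⟩
    · rwa [hk.guarded hu.left.1, hk.guarded hu.left.1]
    · have hu' := hu.exchanged hx
      have hg' := hg.exchanged hx (h2.2 g hg.inc) hβ
      rw [run_guarded (hk.uncoloured hu'.col)]
      have := guarded_spec (Q := fun s => At L k c' e u v g w g' w' s ∧ L.NoCommon k c' u v ∧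
          L.NoCommon k c' w v) hu.left.1
        (tryEnds_spec hk hu'.proper hu'.lt hu'.col hu'.ends) (fun H => H.1.uncoloured hu'.col)
        (p := tryLeaf) (fun H => by
          rcases tryLeaf_spec H.1 hu' hg' with h | h
          exacts [.inl h, .inr ⟨h.1, H.2, h.2⟩])
      rcases this with h | ⟨-, h4, h5⟩
      · exact h.of_exchanged hx
      · rcases hx.missing_or u w hg.left_ne hu.ne hg.ne_right h1 h2 with h | h
        · exact absurd hx.missing (h4 _ h)
        · exact absurd hx.missing (h5 _ h)
  · rw [h3, ← h.r41, ← h.r44]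
    exact .inr ⟨by rw [h.r41, h.r44]; exact ht, h1⟩

/-- As in `pairEnd_spec`, the exchange from `v` leaves a colour common to `v` and one of the two
leaves. -/
theorem pairLeaves_spec (h : At L k c e u v g w g' w' s) (hu : L.Uncoloured k c e u v)
    (hg : L.Leaf k c u v g w) (hg' : L.Leaf k c u v g' w') (hww : w ≠ w')
    (hwv : L.NoCommon k c w v) :
    Finished L k c e 40 (pairLeaves.run s) ∨
      (At L k c e u v g w g' w' (pairLeaves.run s) ∧ L.NoCommon k c w w') := by
  rw [pairLeaves]
  rcases common_cases (x := 44) (y := 46) h hu.lt (by omega) rfl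
    (.seq kempeAt (.seq (guarded 40 tryLeaf) (guarded 40 (.seq swapLeaves tryLeaf)))) .skip
    with ⟨t, ht, h1, h2, -, h3⟩ | ⟨t, ht, h1, -, h3⟩
  · left
    rw [h3, run_seq, run_seq]
    rw [h.r44] at h1
    rw [h.r46] at h2
    rcases kempeAt_spec ht hu h1.1 (hwv _ h1) with hk | ⟨β, c', hβ, hx, hk⟩
    · rwa [hk.guarded hu.left.1, hk.guarded hu.left.1]
    · have hu' := hu.exchanged hx
      have hl := hg.exchanged hx (h1.2 g hg.inc) hβ
      have hl' := hg'.exchanged hx (h2.2 g' hg'.inc) hβ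
      rw [run_guarded (hk.uncoloured hu'.col)]
      have := guarded_spec (Q := fun s => At L k c' e u v g' w' g w s ∧ L.NoCommon k c' w v ∧
          L.NoCommon k c' w' v) hu.left.1
        (tryLeaf_spec hk hu' hl) (fun H => H.1.uncoloured hu'.col)
        (p := .seq swapLeaves tryLeaf) (fun H => by
          rw [run_seq]
          rcases tryLeaf_spec (swapLeaves_spec H.1) hu' hl' with h | h
          exacts [.inl h, .inr ⟨h.1, H.2, h.2⟩])
      rcases this with h | ⟨-, h4, h5⟩
      · exact h.of_exchanged hx
      · rcases hx.missing_or w w' hww hg.ne_right hg'.ne_right h1 h2 with h | h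
        · exact absurd hx.missing (h4 _ h)
        · exact absurd hx.missing (h5 _ h)
  · rw [h3, ← h.r44, ← h.r46]
    exact .inr ⟨by rw [h.r44, h.r46]; exact ht, h1⟩

/-- The six attempts correspond to the six pairs among `u, v, w, w'`. When all fail, the four sets
of missing colours are pairwise disjoint, which `Bounds` forbids, so the new colour is justified. -/
theorem star_spec (h : At L k c e u v g w g' w' s) (hu : L.Uncoloured k c e u v)
    (hg : L.Leaf k c u v g w) (hg' : L.Leaf k c u v g' w') (hww : w ≠ w') :
    Finished L k c e 40 (star.run s) := by
  have he := hu.left.1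
  have h1 := tryEnds_spec h hu.proper hu.lt hu.col hu.ends
  rw [star, run_seq, run_seq, run_seq, run_seq, run_seq, run_seq]
  set s₁ := tryEnds.run s
  have h2 := guarded_spec (p := tryLeaf) (Q := fun s => At L k c e u v g w g' w' s ∧
      L.NoCommon k c u v ∧ L.NoCommon k c w v) he h1 (fun H => H.1.uncoloured hu.col) (fun H => by
    rcases tryLeaf_spec H.1 hu hg with h | h
    exacts [.inl h, .inr ⟨h.1, H.2, h.2⟩])
  set s₂ := (guarded 40 tryLeaf).run s₁
  have h3 := guarded_spec (p := .seq swapLeaves tryLeaf) (Q := fun s =>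
      At L k c e u v g' w' g w s ∧ (L.NoCommon k c u v ∧ L.NoCommon k c w v) ∧
      L.NoCommon k c w' v) he h2 (fun H => H.1.uncoloured hu.col) (fun H => by
    rcases tryLeaf_spec (swapLeaves_spec H.1) hu hg' with h | h
    exacts [.inl h, .inr ⟨h.1, H.2, h.2⟩])
  set s₃ := (guarded 40 (.seq swapLeaves tryLeaf)).run s₂
  have h4 := guarded_spec (p := pairEnd) (Q := fun s => At L k c e u v g' w' g w s ∧
      ((L.NoCommon k c u v ∧ L.NoCommon k c w v) ∧ L.NoCommon k c w' v) ∧ L.NoCommon k c u w')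
      he h3 (fun H => H.1.uncoloured hu.col) (fun H => by
    rcases pairEnd_spec H.1 hu hg' H.2.1.1 with h | h
    exacts [.inl h, .inr ⟨h.1, H.2, h.2⟩])
  set s₄ := (guarded 40 pairEnd).run s₃
  have h5 := guarded_spec (p := .seq swapLeaves pairEnd) (Q := fun s => At L k c e u v g w g' w' s ∧
      (((L.NoCommon k c u v ∧ L.NoCommon k c w v) ∧ L.NoCommon k c w' v) ∧ L.NoCommon k c u w') ∧
      L.NoCommon k c u w) he h4 (fun H => H.1.uncoloured hu.col) (fun H => by
    rcases pairEnd_spec (swapLeaves_spec H.1) hu hg H.2.1.1.1 with h | h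
    exacts [.inl h, .inr ⟨h.1, H.2, h.2⟩])
  set s₅ := (guarded 40 (.seq swapLeaves pairEnd)).run s₄
  have h6 := guarded_spec (p := pairLeaves) (Q := fun s => At L k c e u v g w g' w' s ∧
      ((((L.NoCommon k c u v ∧ L.NoCommon k c w v) ∧ L.NoCommon k c w' v) ∧ L.NoCommon k c u w') ∧
      L.NoCommon k c u w) ∧ L.NoCommon k c w w') he h5 (fun H => H.1.uncoloured hu.col) (fun H => by
    rcases pairLeaves_spec H.1 hu hg hg' hww H.2.1.1.1.2 with h | h
    exacts [.inl h, .inr ⟨h.1, H.2, h.2⟩])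
  set s₆ := (guarded 40 pairLeaves).run s₅
  have h7 := guarded_spec (p := newColour 40) (Q := fun _ => False) he h6
    (fun H => H.1.uncoloured hu.col) ?_
  · exact h7.resolve_right id
  · intro H
    left
    obtain ⟨H, ⟨⟨⟨⟨d1, d2⟩, d3⟩, d4⟩, d5⟩, d6⟩ := H
    refine newColour_spec H.holds H.colours H.col H.r40 (by omega) hu.proper hu.lt hu.col ?_
    intro hB
    exact hB.exists_common_of_star hu.proper.le hu.ne hg.ne_right hg'.ne_right hg.left_ne
      hg'.left_ne hww hu.left hu.right hu.col hg.right hg.inc hg'.right hg'.inc d1 d2 d3 d5 d4 d6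

end Cmd

end RAM

/-! ### Colouring one edge -/

namespace RAM

open EdgeList

namespace Cmd

/-- Pass the colour of the edge in register `43` to the one in register `40`, which thereby becomes a
leaf of the former. -/
def shiftLeaf : Cmd :=
  .seq (.store 2 (.reg 40) (.read 2 (.reg 43))) (.seq (.store 2 (.reg 43) (.reg 0))
    (.seq (swapRegs 40 43) (swapRegs 41 44)))

/-- Look for a second leaf whose colour is missing at the vertex in register `p`. -/
def secondLeaf (p : ℕ) (q : Cmd) : Cmd :=
  .seq (thirdOf p 42 41 44) (.ite (.lt (.reg 13) (.reg 0))
    (.seq (.assign 45 (.reg 13)) (.seq (otherEnd 45 42 46) q)) .skip)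

/-- Put into registers `43` and `44` a leaf whose colour is the one in register `13`. -/
def findLeaf : Cmd :=
  .seq (.assign 10 (.reg 13)) (.seq (findEdge 42)
    (.seq (.assign 43 (.reg 13)) (otherEnd 43 42 44)))

/-- Try to colour the edge in registers `3` and `40` by a fan at the vertex in register `42`. -/
def hub : Cmd :=
  .seq (commonOf 41 41) (.ite (.lt (.reg 13) (.reg 0))
    (.seq findLeaf (.seq tryLeaf (.seq (guarded 3 (secondLeaf 41 star))
      (guarded 3 (secondLeaf 44 (.seq shiftLeaf star))))))
    (newColour 40))

variable {L : EdgeList ℕ} {s : State} {k : ℕ} {c : ℕ → ℕ} {e u v g w g' w' r : ℕ} {p : Cmd}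

theorem _root_.RAM.Finished.change {r' : ℕ} (h : Finished L k c e r s) (hr : s.reg r' = e) :
    Finished L k c e r' s := ⟨h.holds, hr, h.done⟩

/-- A colour missing at `u` occurs at `v`, because the ends have no common missing colour. The edge
carrying it cannot end at `u`. -/
theorem findLeaf_spec (h : At L k c e u v g w g' w' s) (hu : L.Uncoloured k c e u v)
    (hm : L.Missing k c u (s.reg 13)) (huv : L.NoCommon k c u v) :
    ∃ g w, At L k c e u v g w g' w' (findLeaf.run s) ∧ L.Leaf k c u v g w := by
  rw [findLeaf, run_seq, run_seq, run_seq]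
  set s₁ := (Cmd.assign 10 (.reg 13)).run s with hs₁
  have h₁ : At L k c e u v g w g' w' s₁ := h.run rfl
  have e10 : s₁.reg 10 = s.reg 13 := rfl
  have hf := findEdge_spec (v := 42) h₁.holds (by omega) (by omega)
  have h₂ : At L k c e u v g w g' w' ((findEdge 42).run s₁) := h₁.run rfl
  set s₂ := (findEdge 42).run s₁ with hs₂
  rw [h₁.r42, h₁.col, e10] at hf
  have hf : L.Inc (s₂.reg 13) v ∧ c (s₂.reg 13) = s.reg 13 := hf.resolve_right fun H =>
    huv _ hm ⟨hm.1, H⟩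
  set s₃ := (Cmd.assign 43 (.reg 13)).run s₂ with hs₃
  have f43 : s₃.reg 43 = s₂.reg 13 := rfl
  have fx : ∀ x, x ≠ 43 → s₃.reg x = s₂.reg x := fun x hx => by
    simp [hs₃, run, State.setReg, hx]
  have hh₃ : Holds L s₃ := h₂.holds.run rfl rfl rfl
  have e42 : s₃.reg 42 = v := (fx 42 (by omega)).trans h₂.r42
  have hcm : c (s₂.reg 13) ≠ L.m := by rw [hf.2]; exact hu.proper.ne_m_of_missing hm
  have ho := otherEnd_spec (e := 43) (v := 42) (w := 44) hh₃ (by rw [f43, e42]; exact hf.1)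
    (by rw [f43]; exact hu.loopFree _ hf.1.1 hcm)
  rw [f43, e42] at ho
  set s₄ := (otherEnd 43 42 44).run s₃ with hs₄
  have gx : ∀ x, x ≠ 43 → x ≠ 44 → s₄.reg x = s₂.reg x := fun x hx hx' =>
    (reg_run _ _ (by simp [otherEnd, writes, hx'])).trans (fx x hx)
  refine ⟨s₂.reg 13, s₄.reg 44, ⟨hh₃.run rfl rfl rfl, (gx 2 (by omega) (by omega)).trans h₂.colours,
    (arr_run _ _ rfl).trans h₂.col, (gx 40 (by omega) (by omega)).trans h₂.r40,
    (gx 41 (by omega) (by omega)).trans h₂.r41, (gx 42 (by omega) (by omega)).trans h₂.r42,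
    reg_run _ _ rfl, rfl, (gx 45 (by omega) (by omega)).trans h₂.r45,
    (gx 46 (by omega) (by omega)).trans h₂.r46⟩, ?_, ho.2, hf.1, ho.1, hf.2.symm ▸ hm⟩
  rintro rfl
  exact hm.2 _ ho.1 hf.2

/-- The vertex `x` will be `u` for a leaf of `e`, and `w` for a leaf of `g` after the shift.
Avoiding both `u` and `w` makes the new end suitable in either case. -/
theorem secondLeaf_spec (h : At L k c e u v g w g' w' s) (hu : L.Uncoloured k c e u v) {q : Cmd}
    (hp : 20 < r) {x : ℕ} (hx : s.reg r = x) (hkeep : (thirdOf r 42 41 44).keeps = true)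
    (h3 : s.reg 3 = e) (hw3 : (thirdOf r 42 41 44).writes 3 = false)
    (hq : ∀ s' g' w', At L k c e u v g w g' w' s' → s'.reg 3 = e → L.Inc g' v → L.Inc g' w' →
      w' ≠ v → u ≠ w' → w ≠ w' → L.Missing k c x (c g') → Finished L k c e 3 (q.run s')) :
    Finished L k c e 3 ((secondLeaf r q).run s) ∨
      (At L k c e u v g w g' w' ((secondLeaf r q).run s) ∧ ((secondLeaf r q).run s).reg 3 = e ∧
        ∀ f, L.Inc f v → L.Missing k c x (c f) → L.Inc f u ∨ L.Inc f w) := by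
  have ht := thirdOf_spec (p := r) (v := 42) (u := 41) (w := 44) h.holds
    (by rw [h.colours]; exact hu.lt.le) (by omega) (by omega) (by omega) (by omega)
  have h₁ := h.run hkeep
  rw [secondLeaf, run_seq]
  rw [h.colours, h.col, h.r42, h.r41, h.r44, hx] at ht
  have h3' : ((thirdOf r 42 41 44).run s).reg 3 = e := (reg_run _ _ hw3).trans h3
  set s₁ := (thirdOf r 42 41 44).run s with hs₁
  rcases ht with ⟨t1, t2, t3, t4⟩ | ⟨t1, t2⟩
  · left
    have hrun : (Cmd.ite (.lt (.reg 13) (.reg 0))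
        (.seq (.assign 45 (.reg 13)) (.seq (otherEnd 45 42 46) q)) .skip).run s₁ =
        q.run ((otherEnd 45 42 46).run ((Cmd.assign 45 (.reg 13)).run s₁)) := by
      rw [← run_seq, ← run_seq]
      exact if_pos ((Test.eval_lt s₁ (.reg 13) (.reg 0)).2
        (show s₁.reg 13 < s₁.reg 0 by rw [h₁.holds.m]; exact t1.1))
    rw [hrun]
    set s₂ := (Cmd.assign 45 (.reg 13)).run s₁ with hs₂
    have f45 : s₂.reg 45 = s₁.reg 13 := rfl
    have fx : ∀ x, x ≠ 45 → s₂.reg x = s₁.reg x := fun x hx => by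
      simp [hs₂, run, State.setReg, hx]
    have hh₂ : Holds L s₂ := h₁.holds.run rfl rfl rfl
    have e42 : s₂.reg 42 = v := (fx 42 (by omega)).trans h₁.r42
    have ho := otherEnd_spec (e := 45) (v := 42) (w := 46) hh₂ (by rw [f45, e42]; exact t1)
      (by rw [f45]; exact hu.loopFree _ t1.1 (hu.proper.ne_m_of_missing t4))
    rw [f45, e42] at ho
    set s₃ := (otherEnd 45 42 46).run s₂ with hs₃
    have gx : ∀ x, x ≠ 45 → x ≠ 46 → s₃.reg x = s₁.reg x := fun x hx hx' =>
      (reg_run _ _ (by simp [otherEnd, writes, hx'])).trans (fx x hx)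
    refine hq s₃ (s₁.reg 13) (s₃.reg 46) ⟨hh₂.run rfl rfl rfl,
      (gx 2 (by omega) (by omega)).trans h₁.colours, (arr_run _ _ rfl).trans h₁.col,
      (gx 40 (by omega) (by omega)).trans h₁.r40, (gx 41 (by omega) (by omega)).trans h₁.r41,
      (gx 42 (by omega) (by omega)).trans h₁.r42, (gx 43 (by omega) (by omega)).trans h₁.r43,
      (gx 44 (by omega) (by omega)).trans h₁.r44, reg_run _ _ rfl, rfl⟩
      ((gx 3 (by omega) (by omega)).trans h3') t1 ho.1 ho.2 ?_ ?_ t4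
    · exact fun H => t2 (by rw [H]; exact ho.1)
    · exact fun H => t3 (by rw [H]; exact ho.1)
  · right
    have hrun : (Cmd.ite (.lt (.reg 13) (.reg 0))
        (.seq (.assign 45 (.reg 13)) (.seq (otherEnd 45 42 46) q)) .skip).run s₁ = s₁ :=
      if_neg (mt (Test.eval_lt s₁ (.reg 13) (.reg 0)).1
        (show ¬s₁.reg 13 < s₁.reg 0 by rw [h₁.holds.m, t1]; exact lt_irrefl _))
    rw [hrun]
    exact ⟨h₁, h3', t2⟩

theorem shiftLeaf_spec (h : At L k c e u v g w g' w' s) :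
    At L k (Function.update (Function.update c e (c g)) g L.m) g w v e u g' w'
      (shiftLeaf.run s) := by
  constructor
  case holds => exact h.holds.run rfl rfl rfl
  all_goals
    simp only [shiftLeaf, swapRegs, run, State.setReg, State.setArr, Expr.eval]
    simp [h.colours, h.col, h.r40, h.r41, h.r42, h.r43, h.r44, h.r45, h.r46, h.holds.m]

/-- A leaf becomes the uncoloured edge. -/
theorem _root_.EdgeList.Uncoloured.shift (hu : L.Uncoloured k c e u v) (hg : L.Leaf k c u v g w) :
    L.Uncoloured k (Function.update (Function.update c e (c g)) g L.m) g w v ∧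
      L.Leaf k (Function.update (Function.update c e (c g)) g L.m) w v e u ∧
      ∀ j, L.Missing k c w j →
        L.Missing k (Function.update (Function.update c e (c g)) g L.m) w j := by
  have hgm := hu.proper.ne_m_of_missing hg.missing
  have hge : g ≠ e := fun h => hg.missing.2 e hu.left (by rw [h])
  have hwe : ¬L.Inc e w := fun h => by
    rcases hu.ends w h with h | h
    · exact hg.left_ne h.symm
    · exact hg.ne_right h
  refine ⟨⟨hu.proper.shift hu.ne hu.left hu.right hg.right hg.missing, fun f hf hfm => ?_, hu.lt,
    by simp, hg.ne_right, hg.inc, hg.right⟩, ⟨hg.left_ne.symm, hu.ne, hu.right, hu.left, ?_⟩, ?_⟩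
  · rcases eq_or_ne f g with rfl | hfg
    · simp at hfm
    · rw [Function.update_of_ne hfg] at hfm
      rcases eq_or_ne f e with rfl | hfe
      · intro hab
        exact hu.ne ((by
          rcases hu.left.2 with h1 | h1 <;> rcases hu.right.2 with h2 | h2 <;> simp_all))
      · rw [Function.update_of_ne hfe] at hfm
        exact hu.loopFree f hf hfm
  · rw [Function.update_of_ne hge.symm, Function.update_self]
    exact hu.proper.missing_shift_self hgm hwe hg.inc
  · exact fun j hj => missing_shift (hu.proper.ne_m_of_missing hj) hwe hj

/-- Register `3` keeps the original edge, while the shift puts `g` into register `40`. If no second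
leaf exists for `e` or for `g`, the colouring is unchanged and the two failed searches become the
last two clauses. -/
theorem hub_spec (h : At L k c e u v g w g' w' s) (h3 : s.reg 3 = e)
    (hu : L.Uncoloured k c e u v) (huv : L.NoCommon k c u v) :
    Finished L k c e 3 (hub.run s) ∨ ∃ g w g' w', At L k c e u v g w g' w' (hub.run s) ∧
      (hub.run s).reg 3 = e ∧ L.Leaf k c u v g w ∧ L.NoCommon k c w v ∧
      (∀ f, L.Inc f v → L.Missing k c u (c f) → L.Inc f u ∨ L.Inc f w) ∧
      ∀ f, L.Inc f v → L.Missing k c w (c f) → L.Inc f u ∨ L.Inc f w := by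
  rw [hub]
  rcases common_cases (x := 41) (y := 41) h hu.lt (by omega) rfl
    (.seq findLeaf (.seq tryLeaf (.seq (guarded 3 (secondLeaf 41 star))
      (guarded 3 (secondLeaf 44 (.seq shiftLeaf star)))))) (newColour 40)
    with ⟨t, ht, h1, -, h2, hrun⟩ | ⟨t, ht, h1, h2, hrun⟩
  · rw [hrun, run_seq, run_seq, run_seq]
    rw [h.r41] at h1
    have t3 : t.reg 3 = e := by rw [h2, ← h3]; exact reg_run _ _ rfl
    obtain ⟨g, w, h₁, hg⟩ := findLeaf_spec ht hu h1 huv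
    have f3 : (findLeaf.run t).reg 3 = e := (reg_run _ _ rfl).trans t3
    set s₁ := findLeaf.run t with hs₁
    have h₂ := tryLeaf_spec h₁ hu hg
    have g3 : (tryLeaf.run s₁).reg 3 = e := (reg_run _ _ rfl).trans f3
    set s₂ := tryLeaf.run s₁ with hs₂
    have unc : ∀ {s g w g' w'}, At L k c e u v g w g' w' s → s.reg 3 = e →
        s.arr 2 (s.reg 3) = s.reg 0 := fun h h3 => by
      rw [h3, h.col, hu.col, h.holds.m]
    have h₃ := guarded_spec (r := 3) (p := secondLeaf 41 star) (Q := fun s =>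
        At L k c e u v g w g' w' s ∧ s.reg 3 = e ∧ L.NoCommon k c w v ∧
          ∀ f, L.Inc f v → L.Missing k c u (c f) → L.Inc f u ∨ L.Inc f w) hu.left.1
      (h₂.imp_left fun H => H.change g3) (fun H => unc H.1 g3) (fun H => by
        rcases secondLeaf_spec (r := 41) (q := star) H.1 hu (by omega) H.1.r41 rfl g3 rfl
          (fun s' g' w' a1 a2 a3 a4 a5 a6 a7 a8 => (star_spec a1 hu hg ⟨a6, a5, a3, a4, a8⟩
            a7).change ((reg_run _ _ rfl).trans a2)) with h | ⟨h, h', h''⟩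
        · exact .inl h
        · exact .inr ⟨h, h', H.2, h''⟩)
    set s₃ := (guarded 3 (secondLeaf 41 star)).run s₂ with hs₃
    -- After the shift `g` is uncoloured with ends `w` and `v`, and `e` has become a leaf at `u`.
    -- The edge `g'` keeps its colour and serves as the second leaf.
    have hshift : ∀ s' g' w', At L k c e u v g w g' w' s' → s'.reg 3 = e → L.Inc g' v →
        L.Inc g' w' → w' ≠ v → u ≠ w' → w ≠ w' → L.Missing k c w (c g') →
        Finished L k c e 3 ((Cmd.seq shiftLeaf star).run s') := by
      intro s' g' w' a1 a2 a3 a4 a5 a6 a7 a8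
      obtain ⟨hu', hl, hmiss⟩ := hu.shift hg
      have hgm := hu.proper.ne_m_of_missing hg.missing
      have hg'g : g' ≠ g := fun h => a8.2 g hg.inc (by rw [h])
      have hg'e : g' ≠ e := fun h => hu.proper.ne_m_of_missing a8 (h ▸ hu.col)
      have hl' : L.Leaf k (Function.update (Function.update c e (c g)) g L.m) w v g' w' := by
        refine ⟨a7, a5, a3, a4, ?_⟩
        rw [Function.update_of_ne hg'g, Function.update_of_ne hg'e]
        exact hmiss _ a8
      have := star_spec (shiftLeaf_spec a1) hu' hl hl' a6
      rw [run_seq]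
      refine ⟨this.holds, ?_, Done.of_shift hu.col hgm this.done⟩
      exact (reg_run _ _ rfl).trans ((reg_run _ _ rfl).trans a2)
    have h₄ := guarded_spec (r := 3) (p := secondLeaf 44 (.seq shiftLeaf star)) (Q := fun s =>
        At L k c e u v g w g' w' s ∧ s.reg 3 = e ∧ (L.NoCommon k c w v ∧
          ∀ f, L.Inc f v → L.Missing k c u (c f) → L.Inc f u ∨ L.Inc f w) ∧
          ∀ f, L.Inc f v → L.Missing k c w (c f) → L.Inc f u ∨ L.Inc f w) hu.left.1
      h₃ (fun H => unc H.1 H.2.1) (fun H => by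
        rcases secondLeaf_spec (r := 44) (q := .seq shiftLeaf star) H.1 hu (by omega) H.1.r44 rfl
          H.2.1 rfl hshift with h | ⟨h, h', h''⟩
        · exact .inl h
        · exact .inr ⟨h, h', H.2.2, h''⟩)
    rcases h₄ with h | ⟨b1, b2, ⟨b3, b4⟩, b5⟩
    · exact .inl h
    · exact .inr ⟨g, w, g', w', b1, b2, hg, b3, b4, b5⟩
  · left
    rw [hrun]
    rw [h.r41] at h1
    have t3 : t.reg 3 = e := by rw [h2, ← h3]; exact reg_run _ _ rfl
    refine (newColour_spec ht.holds ht.colours ht.col ht.r40 (by omega) hu.proper hu.lt hu.col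
      ?_).change ((reg_run _ _ rfl).trans t3)
    intro hB
    obtain ⟨j, hj⟩ := hB.exists_missing hu.proper.le hu.left hu.col
    exact h1 j hj hj

/-- Load the edge in register `3` and its ends. -/
def load : Cmd :=
  .seq (.assign 40 (.reg 3)) (.seq (.assign 41 (.read 0 (.reg 3))) (.assign 42 (.read 1 (.reg 3))))

/-- Save the leaf found and exchange the ends of the edge in register `3`. -/
def turn : Cmd :=
  .seq (.assign 33 (.reg 43)) (.seq (.assign 34 (.reg 44)) (swapRegs 41 42))

/-- Recolour a path with three edges. -/
def recolourPath : Cmd :=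
  .seq (.assign 47 (.reg 13)) (.seq (.assign 10 (.reg 47)) (.seq (findEdge 41)
    (.seq (.store 2 (.reg 13) (.read 2 (.reg 33))) (.seq (.store 2 (.reg 33) (.reg 47))
      (.seq (.store 2 (.reg 40) (.read 2 (.reg 43))) (.store 2 (.reg 43) (.reg 47)))))))

/-- Complete the colouring when both ends have exactly one leaf. -/
def finish : Cmd :=
  .seq (commonOf 34 44) (.ite (.lt (.reg 13) (.reg 0))
    (.ite (.eq (.reg 34) (.reg 44)) (newColour 40) recolourPath) (newColour 40))

/-- Colour the edge in register `3`, which is not a loop. -/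
def colourEdge : Cmd :=
  .seq load (.seq tryEnds (.seq (guarded 3 hub) (.seq (guarded 3 (.seq turn hub))
    (guarded 3 finish))))

theorem load_spec (h : Holds L s) (he : s.reg 3 = e) :
    At L (s.reg 2) (s.arr 2) e (L.a e) (L.b e) (s.reg 43) (s.reg 44) (s.reg 45) (s.reg 46)
      (load.run s) ∧ (load.run s).reg 3 = e := by
  constructor
  · constructor
    case holds => exact h.run rfl rfl rfl
    all_goals
      simp [load, run, State.setReg, Expr.eval, he, h.a, h.b]
  · exact (reg_run load s rfl).trans he

theorem turn_spec (h : At L k c e u v g w g' w' s) :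
    At L k c e v u g w g' w' (turn.run s) ∧ (turn.run s).reg 33 = g ∧ (turn.run s).reg 34 = w := by
  refine ⟨?_, ?_, ?_⟩
  · constructor
    case holds => exact h.holds.run rfl rfl rfl
    all_goals
      simp only [turn, swapRegs, run, State.setReg, Expr.eval]
      simp [h.colours, h.col, h.r40, h.r41, h.r42, h.r43, h.r44, h.r45, h.r46]
  · rw [← h.r43]; simp [turn, swapRegs, run, State.setReg, Expr.eval]
  · rw [← h.r44]; simp [turn, swapRegs, run, State.setReg, Expr.eval]

theorem recolourPath_spec {h x : ℕ} (ha : At L k c e v u h x g' w' s) (hu : L.Uncoloured k c e u v)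
    (h3 : s.reg 3 = e) (h33 : s.reg 33 = g) (hg : L.Leaf k c u v g w) (hh : L.Leaf k c v u h x)
    (hxw : x ≠ w) (hw : L.Missing k c w (s.reg 13)) (hx : L.Missing k c x (s.reg 13))
    (hwv : L.NoCommon k c w v)
    (cv : ∀ f, L.Inc f v → L.Missing k c w (c f) → L.Inc f u ∨ L.Inc f w) :
    Finished L k c e 3 (recolourPath.run s) := by
  set γ := s.reg 13 with hγ
  rw [recolourPath, run_seq, run_seq, run_seq]
  set s₁ := (Cmd.assign 10 (.reg 47)).run ((Cmd.assign 47 (.reg 13)).run s) with hs₁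
  have h₁ : At L k c e v u h x g' w' s₁ := (ha.run (p := .assign 47 (.reg 13)) rfl).run rfl
  have e10 : s₁.reg 10 = γ := by simp [hs₁, run, State.setReg, Expr.eval, hγ]
  have e47 : s₁.reg 47 = γ := by simp [hs₁, run, State.setReg, Expr.eval, hγ]
  have hf := findEdge_spec (v := 41) h₁.holds (by omega) (by omega)
  have h₂ : At L k c e v u h x g' w' ((findEdge 41).run s₁) := h₁.run rfl
  have f47 : ((findEdge 41).run s₁).reg 47 = γ := (reg_run _ _ rfl).trans e47
  have f33 : ((findEdge 41).run s₁).reg 33 = g := by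
    refine (reg_run _ _ rfl).trans ?_
    rw [← h33]
    simp [hs₁, run, State.setReg]
  have f3 : ((findEdge 41).run s₁).reg 3 = e := by
    refine (reg_run _ _ rfl).trans ?_
    rw [← h3]
    simp [hs₁, run, State.setReg]
  set s₂ := (findEdge 41).run s₁ with hs₂
  rw [h₁.r41, h₁.col, e10] at hf
  have hf : L.Inc (s₂.reg 13) v ∧ c (s₂.reg 13) = γ := hf.resolve_right fun H =>
    hwv _ hw ⟨hw.1, H⟩
  set f := s₂.reg 13 with hfdef
  -- The edge at `v` coloured `γ` cannot end at `w`, where `γ` is missing, so it is parallel to `e`.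
  have hfu : L.Inc f u := (cv f hf.1 (hf.2.symm ▸ hw)).resolve_right fun H => hw.2 f H hf.2
  have hfg : g ≠ f := fun H => hg.missing.2 f hfu (by rw [H])
  have hfh : h ≠ f := fun H => hh.missing.2 f hf.1 (by rw [H])
  have hgh : h ≠ g := fun H => hg.missing.2 h hh.right (by rw [H])
  have hd := hu.proper.recolour_path hu.ne hg.ne_right hh.ne_right hg.left_ne hh.left_ne.symm hxw
    hu.left hu.right hu.col hg.right hg.inc hh.right hh.inc hfu hf.1 hg.missing hh.missing hf.2 hw hx
  set s₃ := (Cmd.seq (.store 2 (.reg 13) (.read 2 (.reg 33))) (.seq (.store 2 (.reg 33) (.reg 47))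
      (.seq (.store 2 (.reg 40) (.read 2 (.reg 43))) (.store 2 (.reg 43) (.reg 47))))).run s₂
    with hs₃
  have hreg : s₃.reg = s₂.reg := rfl
  have harr : s₃.arr 2 = Function.update (Function.update (Function.update (Function.update c
      f (c g)) g γ) e (c h)) h γ := by
    rw [hs₃]
    simp only [run, State.setArr, Expr.eval, Function.update_self, h₂.col, f33, f47, h₂.r40, h₂.r43,
      ← hfdef, Function.update_of_ne hfh, Function.update_of_ne hgh]
  exact ⟨h₂.holds.run rfl rfl rfl, f3, by rw [harr, hreg, h₂.colours]; exact hd⟩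

/-- For `w = x` the triangle inequality fails; for `w ≠ x` with a common missing colour the path is
recoloured; without one the pair inequalities fail. In the first and the last case a new colour is
legitimate. -/
theorem finish_spec {h x : ℕ} (ha : At L k c e v u h x g' w' s) (hu : L.Uncoloured k c e u v)
    (h3 : s.reg 3 = e) (h33 : s.reg 33 = g) (h34 : s.reg 34 = w) (hg : L.Leaf k c u v g w)
    (hh : L.Leaf k c v u h x) (huv : L.NoCommon k c u v) (hwv : L.NoCommon k c w v)
    (hxu : L.NoCommon k c x u)
    (cvu : ∀ f, L.Inc f v → L.Missing k c u (c f) → L.Inc f u ∨ L.Inc f w)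
    (cvw : ∀ f, L.Inc f v → L.Missing k c w (c f) → L.Inc f u ∨ L.Inc f w)
    (cuv : ∀ f, L.Inc f u → L.Missing k c v (c f) → L.Inc f v ∨ L.Inc f x)
    (cux : ∀ f, L.Inc f u → L.Missing k c x (c f) → L.Inc f v ∨ L.Inc f x) :
    Finished L k c e 3 (finish.run s) := by
  rw [finish]
  rcases common_cases (x := 34) (y := 44) ha hu.lt (by omega) rfl
    (.ite (.eq (.reg 34) (.reg 44)) (newColour 40) recolourPath) (newColour 40)
    with ⟨t, ht, h1, h1', h2, hrun⟩ | ⟨t, ht, h1, h2, hrun⟩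
  all_goals
    have t3 : t.reg 3 = e := by rw [h2, ← h3]; exact reg_run _ _ rfl
    have t33 : t.reg 33 = g := by rw [h2, ← h33]; exact reg_run _ _ rfl
    have t34 : t.reg 34 = w := by rw [h2, ← h34]; exact reg_run _ _ rfl
    rw [hrun]
    rw [h34] at h1
  · rw [ha.r44] at h1'
    by_cases hwx : w = x
    · have hrun' : (Cmd.ite (.eq (.reg 34) (.reg 44)) (newColour 40) recolourPath).run t =
          (newColour 40).run t := if_pos ((Test.eval_eq t (.reg 34) (.reg 44)).2
            (show t.reg 34 = t.reg 44 by rw [t34, ht.r44, hwx]))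
      rw [hrun']
      refine (newColour_spec ht.holds ht.colours ht.col ht.r40 (by omega) hu.proper hu.lt hu.col
        ?_).change ((reg_run _ _ rfl).trans t3)
      intro hB
      subst hwx
      exact hB.false_of_triangle hu.proper.le hu.ne hg.left_ne hg.ne_right.symm hu.left hu.right
        hu.col hg.right hg.inc hh.right hh.inc huv
        (fun f hf hm => (cvu f hf hm).resolve_left fun H => hm.2 f H rfl)
        (fun f hf hm => (cuv f hf hm).resolve_left fun H => hm.2 f H rfl)
    · have hrun' : (Cmd.ite (.eq (.reg 34) (.reg 44)) (newColour 40) recolourPath).run t =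
          recolourPath.run t := if_neg (mt (Test.eval_eq t (.reg 34) (.reg 44)).1
            (show ¬t.reg 34 = t.reg 44 by rw [t34, ht.r44]; exact hwx))
      rw [hrun']
      exact recolourPath_spec ht hu t3 t33 hg hh (Ne.symm hwx) h1 h1' hwv cvw
  · rw [ha.r44] at h1
    refine (newColour_spec ht.holds ht.colours ht.col ht.r40 (by omega) hu.proper hu.lt hu.col
      ?_).change ((reg_run _ _ rfl).trans t3)
    intro hB
    obtain ⟨j, hj, hj'⟩ := hB.exists_common_of_path hu.proper.le hu.ne hg.ne_right hh.ne_right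
      hg.left_ne hh.left_ne.symm hu.left hu.right hu.col hg.right hg.inc hh.right hh.inc hwv hxu
      (fun f hf hm => (cvw f hf hm).resolve_right fun H => hm.2 f H rfl)
      (fun f hf hm => (cux f hf hm).resolve_right fun H => hm.2 f H rfl)
    exact h1 j hj hj'

/-- `hub` is run with centre `v` and then with centre `u`; what the two failures exclude is what
`finish_spec` requires. The first leaf survives in registers `33` and `34`. -/
theorem colourEdge_spec (h : Holds L s) (he : s.reg 3 = e) (hem : e < L.m) (hab : L.a e ≠ L.b e)
    (hp : L.Proper (s.reg 2) (s.arr 2)) (hl : L.LoopFree (s.arr 2)) (hlt : s.reg 2 < L.m)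
    (hc : s.arr 2 e = L.m) :
    Finished L (s.reg 2) (s.arr 2) e 3 (colourEdge.run s) := by
  have hu : L.Uncoloured (s.reg 2) (s.arr 2) e (L.a e) (L.b e) :=
    ⟨hp, hl, hlt, hc, hab, ⟨hem, .inl rfl⟩, ⟨hem, .inr rfl⟩⟩
  obtain ⟨h₁, r₁⟩ := load_spec h he
  generalize s.reg 2 = k at *
  generalize s.arr 2 = c at *
  rw [colourEdge, run_seq, run_seq, run_seq, run_seq]
  have h₂ := tryEnds_spec h₁ hu.proper hu.lt hu.col hu.ends
  have r₂ : (tryEnds.run (load.run s)).reg 3 = e := (reg_run _ _ rfl).trans r₁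
  set s₂ := tryEnds.run (load.run s)
  have unc : ∀ {s u v g w g' w'}, At L k c e u v g w g' w' s → s.reg 3 = e →
      s.arr 2 (s.reg 3) = s.reg 0 := fun h h3 => by
    rw [h3, h.col, hu.col, h.holds.m]
  have h₃ := guarded_spec (r := 3) (p := hub) (Q := fun s => ∃ g w g' w',
      At L k c e (L.a e) (L.b e) g w g' w' s ∧ s.reg 3 = e ∧ L.NoCommon k c (L.a e) (L.b e) ∧
      L.Leaf k c (L.a e) (L.b e) g w ∧ L.NoCommon k c w (L.b e) ∧
      (∀ f, L.Inc f (L.b e) → L.Missing k c (L.a e) (c f) → L.Inc f (L.a e) ∨ L.Inc f w) ∧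
      ∀ f, L.Inc f (L.b e) → L.Missing k c w (c f) → L.Inc f (L.a e) ∨ L.Inc f w) hem
    (h₂.imp_left fun H => H.change r₂) (fun H => unc H.1 r₂) (fun H => by
      rcases hub_spec H.1 r₂ hu H.2 with h | ⟨g, w, g', w', h, h', h''⟩
      · exact .inl h
      · exact .inr ⟨g, w, g', w', h, h', H.2, h''⟩)
  set s₃ := (guarded 3 hub).run s₂
  rcases h₃ with h | ⟨g, w, g', w', h₃, r₃, d1, hg, d2, c1, c2⟩
  · rwa [h.guarded hem, h.guarded hem]
  · rw [run_guarded (unc h₃ r₃), run_seq]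
    obtain ⟨h₄, e33, e34⟩ := turn_spec h₃
    have r₄ : (turn.run s₃).reg 3 = e := (reg_run _ _ rfl).trans r₃
    have h₅ := hub_spec h₄ r₄ hu.symm d1.symm
    have f33 : (hub.run (turn.run s₃)).reg 33 = g := (reg_run _ _ rfl).trans e33
    have f34 : (hub.run (turn.run s₃)).reg 34 = w := (reg_run _ _ rfl).trans e34
    set s₅ := hub.run (turn.run s₃)
    rcases h₅ with h | ⟨h, x, h', x', h₅, r₅, hh, d3, c3, c4⟩
    · rwa [h.guarded hem]
    · rw [run_guarded (unc h₅ r₅)]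
      exact finish_spec h₅ hu r₅ f33 f34 hg hh d1 d2 d3 c1 c2 c3 c4

end Cmd

end RAM

/-! ### Colouring all edges -/

namespace RAM

open EdgeList

/-- A proper partial colouring that uses no more colours than the local bounds demand. -/
structure Partial (L : EdgeList ℕ) (s : State) : Prop where
  holds : Holds L s
  proper : L.Proper (s.reg 2) (s.arr 2)
  le_ncard : s.reg 2 ≤ {f | f < L.m ∧ s.arr 2 f ≠ L.m}.ncard
  le_bound : ∀ K, L.Bounds K → s.reg 2 ≤ K

namespace Cmd

/-- Mark all edges as uncoloured. -/
def clearColours : Cmd := .loop 3 (.store 2 (.reg 3) (.reg 0))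

/-- Colour all edges other than loops. -/
def colourEdges : Cmd :=
  .loop 3 (.ite (.not (.eq (.read 0 (.reg 3)) (.read 1 (.reg 3)))) colourEdge .skip)

/-- Colour all edges that are still uncoloured. -/
def colourLoops : Cmd :=
  .loop 3 (.ite (.eq (.read 2 (.reg 3)) (.reg 0))
    (.seq load (.seq tryEnds (guarded 3 (newColour 3)))) .skip)

/-- The edge-colouring algorithm. -/
def colourAll : Cmd := .seq clearColours (.seq colourEdges colourLoops)

-- The outer loop runs over the edges, and every loop inside it has a loop-free body. This is where
-- the quadratic time comes from.
set_option maxRecDepth 10000 in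
theorem depth_colourAll : colourAll.depth = 2 := rfl

variable {L : EdgeList ℕ} {s s' : State} {e : ℕ}

theorem _root_.RAM.Partial.setReg (h : Partial L s) (n : ℕ) : Partial L (s.setReg 3 n) := by
  have h0 : (s.setReg 3 n).reg 0 = s.reg 0 := by simp [State.setReg]
  have h2 : (s.setReg 3 n).reg 2 = s.reg 2 := by simp [State.setReg]
  exact ⟨⟨h0.trans h.holds.m, h.holds.a, h.holds.b⟩, h2 ▸ h.proper, h2 ▸ h.le_ncard,
    h2 ▸ h.le_bound⟩

/-- There are at most as many colours as coloured edges, so while an edge is uncoloured a further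
colour can be added without reaching the marker `m`. -/
theorem _root_.RAM.Partial.lt (h : Partial L s) (he : e < L.m) (hc : s.arr 2 e = L.m) :
    s.reg 2 < L.m := by
  refine h.le_ncard.trans_lt ?_
  have hss : {f | f < L.m ∧ s.arr 2 f ≠ L.m} ⊂ Set.Iio L.m :=
    ⟨fun f hf => hf.1, fun hsub => (hsub (show e ∈ Set.Iio L.m from he)).2 hc⟩
  exact (Set.ncard_lt_ncard hss (Set.finite_Iio _)).trans_eq (ncard_Iio _)

theorem _root_.RAM.Partial.finished (h : Partial L s) (he : e < L.m) (hc : s.arr 2 e = L.m)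
    (hs' : Finished L (s.reg 2) (s.arr 2) e 3 s') : Partial L s' := by
  refine ⟨hs'.holds, hs'.done.proper, ?_, fun K hK => ?_⟩
  · have hset : {f | f < L.m ∧ s'.arr 2 f ≠ L.m} = insert e {f | f < L.m ∧ s.arr 2 f ≠ L.m} := by
      ext f
      simp only [Set.mem_ofPred_eq, Set.mem_insert_iff]
      constructor
      · rintro ⟨h1, h2⟩
        have := hs'.done.dom f h1
        tauto
      · rintro (rfl | ⟨h1, h2⟩)
        · exact ⟨he, fun H => ((hs'.done.dom f he).1 H).2 rfl⟩
        · exact ⟨h1, fun H => h2 ((hs'.done.dom f h1).1 H).1⟩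
    rw [hset, Set.ncard_insert_of_notMem (fun H => H.2 hc) (finite_of_lt fun f hf => hf.1)]
    have := h.le_ncard
    rcases hs'.done.bound with H | ⟨H, -⟩ <;> omega
  · have := h.le_bound K hK
    rcases hs'.done.bound with H | ⟨H, hB⟩
    · omega
    -- A colour was added because the bounds fail for the old number, so by monotonicity `K` is
    -- larger than it.
    · rcases Nat.lt_or_ge (s.reg 2) K with hlt | hge
      · omega
      · exact absurd (hK.mono hge) hB

theorem clearColours_spec (h : Holds L s) (h2 : s.reg 2 = 0) :
    Partial L (clearColours.run s) ∧ ∀ f < L.m, (clearColours.run s).arr 2 f = L.m := by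
  have key := loop_induct (r := 3) (p := .store 2 (.reg 3) (.reg 0)) rfl s
    (fun i s' => ∀ f < i, s'.arr 2 f = L.m) (by simp) (by
      intro i s' hi hr hx _ hI f hf
      have e0 : s'.reg 0 = L.m := (hx 0 rfl).trans h.m
      simp only [run, State.setReg, State.setArr, Expr.eval, Function.update_self, hr,
        Function.update_apply, e0]
      split_ifs with hfi
      · rfl
      · exact hI f (by omega))
  rw [h.m] at key
  have key : ∀ f < L.m, (clearColours.run s).arr 2 f = L.m := key
  have r2 : (clearColours.run s).reg 2 = 0 := (reg_run _ _ rfl).trans h2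
  refine ⟨⟨h.run rfl rfl rfl, ⟨by omega, fun f hf hm => absurd (key f hf) hm,
    fun f g x hf hg _ hm => absurd (key f hf.1) hm⟩, by omega, by omega⟩, key⟩

/-- The invariant says that exactly the non-loops met so far are coloured. This provides `LoopFree`,
on which alternating walks and leaves rely. -/
theorem colourEdges_spec (h : Partial L s) (hc : ∀ f < L.m, s.arr 2 f = L.m) :
    Partial L (colourEdges.run s) ∧
      ∀ f < L.m, L.a f ≠ L.b f → (colourEdges.run s).arr 2 f ≠ L.m := by
  have key := loop_induct (r := 3)
    (p := .ite (.not (.eq (.read 0 (.reg 3)) (.read 1 (.reg 3)))) colourEdge .skip) rfl s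
    (fun i s' => Partial L s' ∧
      ∀ f < L.m, s'.arr 2 f ≠ L.m ↔ f < i ∧ L.a f ≠ L.b f)
    ⟨h.setReg 0, fun f hf => ⟨fun H => absurd (hc f hf) H, fun H => absurd H.1 (Nat.not_lt_zero _)⟩⟩
    ?_
  · rw [h.holds.m] at key
    exact ⟨key.1, fun f hf hab => (key.2 f hf).2 ⟨hf, hab⟩⟩
  · rintro i s' hi hr - - ⟨hI, hI'⟩
    have him : i < L.m := by rw [← h.holds.m]; exact hi
    have htest : (Test.not (.eq (.read 0 (.reg 3)) (.read 1 (.reg 3)))).eval s' = true ↔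
        L.a i ≠ L.b i := by
      rw [Test.eval_not, Test.eval_eq]
      simp only [Expr.eval, hr, hI.holds.a, hI.holds.b, ne_eq]
    have hci : s'.arr 2 i = L.m := by
      by_contra H
      exact absurd ((hI' i him).1 H).1 (lt_irrefl i)
    by_cases hab : L.a i ≠ L.b i
    · have hrun : (Cmd.ite (.not (.eq (.read 0 (.reg 3)) (.read 1 (.reg 3)))) colourEdge
          .skip).run s' = colourEdge.run s' := if_pos (htest.2 hab)
      rw [hrun]
      have hfin := colourEdge_spec hI.holds hr him hab hI.proper
        (fun f hf hm => ((hI' f hf).1 hm).2) (hI.lt him hci) hci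
      refine ⟨(hI.finished him hci hfin).setReg _, fun f hf => ?_⟩
      have h1 := hfin.done.dom f hf
      have h2 := hI' f hf
      change (colourEdge.run s').arr 2 f ≠ L.m ↔ _
      rw [Ne, h1, ← not_iff_not, not_not]
      by_cases hfi : f = i
      · subst hfi
        simp [hab]
      · have : f < i + 1 ↔ f < i := by omega
        rw [this, ← h2]
        simp [hfi]
    · have hrun : (Cmd.ite (.not (.eq (.read 0 (.reg 3)) (.read 1 (.reg 3)))) colourEdge
          .skip).run s' = s' := if_neg (mt htest.1 hab)
      rw [hrun]
      refine ⟨hI.setReg _, fun f hf => (hI' f hf).trans ?_⟩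
      by_cases hfi : f = i
      · subst hfi
        simp [hab]
      · have : f < i + 1 ↔ f < i := by omega
        rw [this]

/-- Only loops are left. A loop has a single end, so a free colour is absent only if the degree
bound fails. -/
theorem colourLoops_spec (h : Partial L s)
    (hc : ∀ f < L.m, L.a f ≠ L.b f → s.arr 2 f ≠ L.m) :
    Partial L (colourLoops.run s) ∧ ∀ f < L.m, (colourLoops.run s).arr 2 f ≠ L.m := by
  have key := loop_induct (r := 3)
    (p := .ite (.eq (.read 2 (.reg 3)) (.reg 0))
      (.seq load (.seq tryEnds (guarded 3 (newColour 3)))) .skip) rfl s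
    (fun i s' => Partial L s' ∧
      ∀ f < L.m, f < i ∨ L.a f ≠ L.b f → s'.arr 2 f ≠ L.m)
    ⟨h.setReg 0, fun f hf H => hc f hf (H.resolve_left (Nat.not_lt_zero _))⟩ ?_
  · rw [h.holds.m] at key
    exact ⟨key.1, fun f hf => key.2 f hf (.inl hf)⟩
  · rintro i s' hi hr - - ⟨hI, hI'⟩
    have him : i < L.m := by rw [← h.holds.m]; exact hi
    have htest : (Test.eq (.read 2 (.reg 3)) (.reg 0)).eval s' = true ↔ s'.arr 2 i = L.m := by
      rw [Test.eval_eq]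
      simp only [Expr.eval, hr, hI.holds.m]
    by_cases hci : s'.arr 2 i = L.m
    · have hrun : (Cmd.ite (.eq (.read 2 (.reg 3)) (.reg 0))
          (.seq load (.seq tryEnds (guarded 3 (newColour 3)))) .skip).run s' =
          (guarded 3 (newColour 3)).run (tryEnds.run (load.run s')) := by
        rw [← run_seq, ← run_seq]
        exact if_pos (htest.2 hci)
      rw [hrun]
      obtain ⟨h₁, r₁⟩ := load_spec hI.holds hr
      have hlt := hI.lt him hci
      have r₂ : (tryEnds.run (load.run s')).reg 3 = i := (reg_run _ _ rfl).trans r₁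
      have hinc : L.Inc i (L.a i) := ⟨him, .inl rfl⟩
      have h₂ := tryEnds_spec h₁ hI.proper hlt hci fun x hx => hx.2.imp Eq.symm Eq.symm
      have hfin : Finished L (s'.reg 2) (s'.arr 2) i 3
          ((guarded 3 (newColour 3)).run (tryEnds.run (load.run s'))) := by
        rcases h₂ with h | ⟨h, hno⟩
        · rw [(h.change r₂).guarded him]
          exact h.change r₂
        · rw [run_guarded (by rw [r₂, h.col, hci, h.holds.m])]
          refine newColour_spec h.holds h.colours h.col r₂ (by omega) hI.proper hlt hci ?_
          intro hB
          have hab : L.a i = L.b i := by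
            by_contra H
            exact hI' i him (.inr H) hci
          obtain ⟨j, hj⟩ := hB.exists_missing hI.proper.le hinc hci
          rw [← hab] at hno
          exact hno j hj hj
      refine ⟨(hI.finished him hci hfin).setReg _, fun f hf hfi hm => ?_⟩
      have h1 := (hfin.done.dom f hf).1 hm
      exact hI' f hf (hfi.imp_left fun H => by have := h1.2; omega) h1.1
    · have hrun : (Cmd.ite (.eq (.read 2 (.reg 3)) (.reg 0))
          (.seq load (.seq tryEnds (guarded 3 (newColour 3)))) .skip).run s' = s' :=
        if_neg (mt htest.1 hci)
      rw [hrun]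
      refine ⟨hI.setReg _, fun f hf hfi => ?_⟩
      change s'.arr 2 f ≠ L.m
      by_cases H : f = i
      · rwa [H]
      · exact hI' f hf (hfi.imp_left fun H => by omega)

/-- The algorithm colours all edges with as many colours as the local bounds allow. -/
theorem colourAll_spec (h : Holds L s) (h2 : s.reg 2 = 0) {K : ℕ} (hK : L.Bounds K) :
    (∀ e < L.m, (colourAll.run s).arr 2 e < K) ∧
      ∀ e f x, e ≠ f → L.Inc e x → L.Inc f x →
        (colourAll.run s).arr 2 e ≠ (colourAll.run s).arr 2 f := by
  obtain ⟨p₁, c₁⟩ := clearColours_spec h h2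
  obtain ⟨p₂, c₂⟩ := colourEdges_spec p₁ c₁
  obtain ⟨p₃, c₃⟩ := colourLoops_spec p₂ c₂
  rw [colourAll, run_seq, run_seq]
  exact ⟨fun e he => (p₃.proper.range e he (c₃ e he)).trans_le (p₃.le_bound K hK),
    fun e f x hef he hf => p₃.proper.ne e f x he hf hef (c₃ e he.1)⟩

end Cmd

end RAM

/-! ### From graphs to edge lists -/

namespace Graph

variable {α β : Type*} {G : Graph α β}

theorem ceil_localBound_le_gammaLocal (hV : V(G).Finite) {e : β} {x y : α} (h : G.IsLink e x y) :
    ⌈G.localBound x y⌉₊ ≤ G.gammaLocal := by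
  refine le_csSup (Set.Finite.bddAbove ?_) ⟨e, x, y, h, rfl⟩
  refine ((hV.prod hV).image fun p : α × α => ⌈G.localBound p.1 p.2⌉₊).subset ?_
  rintro j ⟨e, x, y, h, rfl⟩
  exact ⟨(x, y), ⟨h.left_mem, h.right_mem⟩, rfl⟩

theorem localBound_le_gammaLocal (hV : V(G).Finite) {e : β} {x y : α} (h : G.IsLink e x y) :
    G.localBound x y ≤ G.gammaLocal :=
  (Nat.le_ceil _).trans (by exact_mod_cast ceil_localBound_le_gammaLocal hV h)

/-- Finitely many vertices bound the set, without which its supremum would be a meaningless default.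
-/
theorem le_triangleMult (hV : V(G).Finite) {x y w : α} (hx : w ≠ x) (hy : w ≠ y)
    (hxw : G.Adj x w) (hyw : G.Adj y w) :
    G.mult x y + G.mult x w + G.mult y w ≤ G.triangleMult x y := by
  refine le_csSup (Set.Finite.bddAbove ?_) ⟨w, hx, hy, hxw, hyw, rfl⟩
  refine (hV.image fun w => G.mult x y + G.mult x w + G.mult y w).subset ?_
  rintro j ⟨w, -, -, ⟨e, h⟩, -, rfl⟩
  exact ⟨w, h.right_mem, rfl⟩

/-- The edge list of a graph satisfies the local bounds. -/
theorem bounds_gammaLocal (hV : V(G).Finite) {m : ℕ} {f : ℕ → β}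
    (hf : Set.BijOn f (Set.Iio m) E(G)) {g : α → ℕ} (hg : Set.InjOn g V(G)) {a b : ℕ → α}
    (hab : ∀ i < m, G.IsLink (f i) (a i) (b i)) :
    (EdgeList.mk m (g ∘ a) (g ∘ b)).Bounds G.gammaLocal := by
  set L := EdgeList.mk m (g ∘ a) (g ∘ b) with hL
  have inc' : ∀ {i y}, L.Inc i y → ∃ x ∈ V(G), g x = y ∧ G.Inc (f i) x := by
    rintro i y ⟨hi, h | h⟩
    · exact ⟨a i, (hab i hi).left_mem, h, (hab i hi).inc_left⟩
    · exact ⟨b i, (hab i hi).right_mem, h, (hab i hi).inc_right⟩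
  have inc : ∀ {i x}, x ∈ V(G) → (L.Inc i (g x) ↔ i < m ∧ G.Inc (f i) x) := by
    intro i x hx
    constructor
    · intro h
      obtain ⟨y, hy, hyx, hi⟩ := inc' h
      exact ⟨h.1, hg hy hx hyx ▸ hi⟩
    · rintro ⟨hi, h⟩
      refine ⟨hi, ?_⟩
      rcases h.eq_or_eq_of_isLink (hab i hi) with rfl | rfl
      exacts [.inl rfl, .inr rfl]
  have link : ∀ {i x y}, x ∈ V(G) → y ∈ V(G) → x ≠ y → L.Inc i (g x) → L.Inc i (g y) →
      G.IsLink (f i) x y := by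
    intro i x y hx hy hxy h1 h2
    obtain ⟨z, hz⟩ := ((inc hx).1 h1).2
    obtain rfl := ((inc hy).1 h2).2.eq_of_isLink_of_ne_left hz hxy.symm
    exact hz
  have deg : ∀ {x}, x ∈ V(G) → L.deg (g x) = G.degreeOf x := by
    intro x hx
    have : G.incidenceSet x = f '' {i | L.Inc i (g x)} := by
      ext e
      constructor
      · intro he
        have he : G.Inc e x := he
        obtain ⟨i, hi, rfl⟩ := hf.2.2 he.edge_mem
        exact ⟨i, (inc hx).2 ⟨hi, he⟩, rfl⟩
      · rintro ⟨i, hi, rfl⟩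
        exact ((inc hx).1 hi).2
    unfold degreeOf EdgeList.deg
    rw [this, (hf.2.1.mono fun i hi => hi.1).ncard_image]
  have mul : ∀ {x y}, x ∈ V(G) → y ∈ V(G) → x ≠ y → L.mult (g x) (g y) = G.mult x y := by
    intro x y hx hy hxy
    have : {e | G.IsLink e x y} = f '' {i | L.Inc i (g x) ∧ L.Inc i (g y)} := by
      ext e
      constructor
      · intro he
        have he : G.IsLink e x y := he
        obtain ⟨i, hi, rfl⟩ := hf.2.2 he.edge_mem
        exact ⟨i, ⟨(inc hx).2 ⟨hi, he.inc_left⟩, (inc hy).2 ⟨hi, he.inc_right⟩⟩, rfl⟩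
      · rintro ⟨i, hi, rfl⟩
        exact link hx hy hxy hi.1 hi.2
    unfold mult EdgeList.mult
    rw [this, (hf.2.1.mono fun i hi => hi.1.1).ncard_image]
  have pair : ∀ e x y, x ≠ y → L.Inc e x → L.Inc e y →
      2 * L.deg x + L.deg y ≤ 2 * G.gammaLocal + L.mult x y := by
    intro e x y hxy h1 h2
    obtain ⟨x, hx, rfl, -⟩ := inc' h1
    obtain ⟨y, hy, rfl, -⟩ := inc' h2
    have hne : x ≠ y := fun h => hxy (h ▸ rfl)
    have hb := localBound_le_gammaLocal hV (link hx hy hne h1 h2)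
    rw [localBound, if_neg hne] at hb
    have hb := (le_max_left _ _).trans hb
    rw [deg hx, deg hy, mul hx hy hne]
    have : (2 * G.degreeOf x + G.degreeOf y : ℚ) ≤ 2 * G.gammaLocal + G.mult x y := by linarith
    exact_mod_cast this
  refine ⟨fun e y h => ?_, pair, fun e e₁ e₂ x y w hxy hxw hyw h1 h2 h3 h4 h5 h6 => ?_⟩
  · obtain ⟨x, hx, rfl, hi⟩ := inc' h
    obtain ⟨y, hl⟩ := hi
    by_cases hxy : x = y
    · subst hxy
      have hb := localBound_le_gammaLocal hV hl
      rw [localBound, if_pos rfl] at hb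
      rw [deg hx]
      exact_mod_cast hb
    -- For an edge with two ends the degree bound follows from the pair inequality, since `μ(xy) ≤
    -- d(y)`.
    · have hy := hl.right_mem
      have hgxy : g x ≠ g y := fun h => hxy (hg hx hy h)
      have hey : L.Inc e (g y) := (inc hy).2 ⟨h.1, hl.inc_right⟩
      have h1 := pair e (g x) (g y) hgxy h hey
      have h2 : L.mult (g x) (g y) ≤ L.deg (g y) :=
        Set.ncard_le_ncard (fun i hi => hi.2) (EdgeList.finite_inc _)
      omega
  · obtain ⟨x, hx, rfl, -⟩ := inc' h1
    obtain ⟨y, hy, rfl, -⟩ := inc' h2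
    obtain ⟨w, hw, rfl, -⟩ := inc' h4
    have nxy : x ≠ y := fun h => hxy (h ▸ rfl)
    have nxw : x ≠ w := fun h => hxw (h ▸ rfl)
    have nyw : y ≠ w := fun h => hyw (h ▸ rfl)
    have hb := localBound_le_gammaLocal hV (link hx hy nxy h1 h2)
    rw [localBound, if_neg nxy] at hb
    have hb := (le_max_right _ _).trans ((le_max_right _ _).trans hb)
    have ht := le_triangleMult hV nxw.symm nyw.symm ⟨_, link hx hw nxw h3 h4⟩
      ⟨_, link hy hw nyw h5 h6⟩
    rw [deg hx, deg hy, mul hx hw nxw, mul hy hw nyw]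
    -- The term `μ(xy)` in `t(xy)` cancels against the one subtracted in the local bound.
    have ht' : (G.mult x y + G.mult x w + G.mult y w : ℚ) ≤ G.triangleMult x y := by
      exact_mod_cast ht
    have : (G.degreeOf x + G.degreeOf y + G.mult x w + G.mult y w : ℚ) ≤ 2 * G.gammaLocal := by
      linarith
    exact_mod_cast this

/-- Finite vertex and edge sets can be numbered, so the algorithm runs on the resulting edge list;
only its effect matters here, not its time. -/
theorem exists_isEdgeColouring_gammaLocal (hV : V(G).Finite) (hE : E(G).Finite) :
    ∃ c : β → ℕ, G.IsEdgeColouring G.gammaLocal c := by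
  classical
  rcases E(G).eq_empty_or_nonempty with h0 | ⟨e₀, he₀⟩
  · exact ⟨fun _ => 0, fun e he => absurd he (by simp [h0]), fun e f x _ he =>
      absurd he.edge_mem (by simp [h0])⟩
  obtain ⟨x₀, -, -⟩ := G.exists_isLink_of_mem_edgeSet he₀
  have := hE.to_subtype
  have := hV.to_subtype
  obtain ⟨m, ⟨φ⟩⟩ := Finite.exists_equiv_fin E(G)
  obtain ⟨n, ⟨ψ⟩⟩ := Finite.exists_equiv_fin V(G)
  set f : ℕ → β := fun i => if h : i < m then (φ.symm ⟨i, h⟩ : β) else e₀ with hfdef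
  set g : α → ℕ := fun x => if h : x ∈ V(G) then (ψ ⟨x, h⟩ : ℕ) else 0 with hgdef
  have hfi : ∀ i (h : i < m), f i = φ.symm ⟨i, h⟩ := fun i h => dif_pos h
  have hf : Set.BijOn f (Set.Iio m) E(G) := by
    refine ⟨fun i hi => ?_, fun i hi j hj hij => ?_, fun e he => ?_⟩
    · rw [hfi i hi]; exact Subtype.coe_prop _
    · rw [hfi i hi, hfi j hj] at hij
      have := φ.symm.injective (Subtype.ext hij)
      exact Fin.ext_iff.1 this
    · refine ⟨φ ⟨e, he⟩, (φ ⟨e, he⟩).2, ?_⟩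
      rw [hfi _ (φ ⟨e, he⟩).2]
      simp
  have hg : Set.InjOn g V(G) := by
    intro x hx y hy hxy
    simp only [hgdef, dif_pos hx, dif_pos hy] at hxy
    simpa using ψ.injective (Fin.ext hxy)
  have hends : ∀ i, ∃ a b : α, i < m → G.IsLink (f i) a b := by
    intro i
    by_cases hi : i < m
    · obtain ⟨x, y, h⟩ := G.exists_isLink_of_mem_edgeSet (hf.1 (show i ∈ Set.Iio m from hi))
      exact ⟨x, y, fun _ => h⟩
    · exact ⟨x₀, x₀, fun h => absurd h hi⟩
  choose a b hab using hends
  have hB := bounds_gammaLocal hV hf hg hab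
  set s : RAM.State := ⟨fun x => if x = 0 then m else 0,
    fun j => if j = 0 then g ∘ a else if j = 1 then g ∘ b else fun _ => 0⟩
  obtain ⟨h1, h2⟩ := RAM.Cmd.colourAll_spec (s := s) ⟨rfl, rfl, rfl⟩ rfl hB
  have hinv : ∀ e ∈ E(G), ∃ i < m, f i = e := hf.2.2
  choose! ι hι hfι using hinv
  refine ⟨fun e => (RAM.Cmd.colourAll.run s).arr 2 (ι e), fun e he => h1 _ (hι e he), ?_⟩
  intro e e' x hne he he'
  refine h2 _ _ (g x) (fun h => hne ?_) ?_ ?_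
  · rw [← hfι e he.edge_mem, ← hfι e' he'.edge_mem, h]
  · refine ⟨hι e he.edge_mem, ?_⟩
    have := hfι e he.edge_mem
    rcases he.eq_or_eq_of_isLink (this ▸ hab (ι e) (hι e he.edge_mem)) with h | h
    · exact .inl (congrArg g h.symm)
    · exact .inr (congrArg g h.symm)
  · refine ⟨hι e' he'.edge_mem, ?_⟩
    have := hfι e' he'.edge_mem
    rcases he'.eq_or_eq_of_isLink (this ▸ hab (ι e') (hι e' he'.edge_mem)) with h | h
    · exact .inl (congrArg g h.symm)
    · exact .inr (congrArg g h.symm)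

end Graph

theorem theorem3 :
    (∀ {α : Type*} {β : Type*} (G : Graph α β), V(G).Finite → E(G).Finite →
      G.chromaticIndex ≤ (G.gammaLocal : ℕ∞)) ∧
    (∃ (P : RAM.Prog) (C D : ℕ), ∀ (n m : ℕ) (G : Graph ℕ ℕ) (a b : ℕ → ℕ),
      V(G) = Set.Iio n → E(G) = Set.Iio m → (∀ i < m, G.IsLink i (a i) (b i)) →
      ∃ (t : ℕ) (s : RAM.State),
        RAM.Exec ((n + m + 2) ^ D) P (RAM.edgeListInput n m a b) t s ∧
        t ≤ C * (m ^ 2 + 1) ∧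
        G.IsEdgeColouring G.gammaLocal (s.arr 2)) := by
  refine ⟨fun G hV hE => ?_, ?_⟩
  · obtain ⟨c, hc⟩ := Graph.exists_isEdgeColouring_gammaLocal hV hE
    exact iInf₂_le G.gammaLocal ⟨c, hc⟩
  obtain ⟨C, hC⟩ := RAM.Cmd.colourAll.cost_le
  -- The factor 2 comes from `(m + 1)² ≤ 2(m² + 1)`. The exponent 1 suffices because no number ever
  -- exceeds `n + m + 2`.
  refine ⟨RAM.Cmd.colourAll.compile, 2 * C, 1, fun n m G a b hV hE hab => ?_⟩
  set s := RAM.edgeListInput n m a b with hs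
  have ha : ∀ i < m, s.arr 0 i = a i := fun i hi => by simp [hs, RAM.edgeListInput, hi]
  have hb : ∀ i < m, s.arr 1 i = b i := fun i hi => by simp [hs, RAM.edgeListInput, hi]
  have hlt : ∀ i < m, a i < n ∧ b i < n := fun i hi => by
    have h1 := (hab i hi).left_mem
    have h2 := (hab i hi).right_mem
    rw [hV] at h1 h2
    exact ⟨h1, h2⟩
  have hbd : s.Bounded ((n + m + 2) ^ 1) := by
    rw [pow_one]
    constructor
    · intro x
      simp only [hs, RAM.edgeListInput]
      split_ifs <;> omega
    · intro j i
      simp only [hs, RAM.edgeListInput]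
      split_ifs with hi
      · have := hlt i hi; omega
      · have := hlt i hi; omega
      · omega
      · omega
  obtain ⟨t, hrun, ht, -⟩ := RAM.Cmd.exec (by rw [pow_one]; omega) RAM.Cmd.colourAll rfl s hbd
  have hs0 : s.reg 0 = m := rfl
  -- The ends are read from the arrays, not from `a` and `b`: these may differ from `m` on, and
  -- `Holds` compares whole arrays.
  have hB := Graph.bounds_gammaLocal (G := G) (f := id) (g := id) (m := m) (a := s.arr 0)
    (b := s.arr 1) (by rw [hV]; exact Set.finite_Iio n) (by rw [hE]; exact Set.bijOn_id _)
    (Set.injOn_id _) (fun i hi => by rw [ha i hi, hb i hi]; exact hab i hi)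
  obtain ⟨h1, h2⟩ := RAM.Cmd.colourAll_spec (s := s) ⟨rfl, rfl, rfl⟩ rfl hB
  refine ⟨t, _, hrun, ?_, ?_, fun e f x hne he hf => h2 e f x hne ?_ ?_⟩
  · have := hC m
    rw [RAM.Cmd.depth_colourAll] at this
    rw [hs0] at ht
    refine (ht.trans this).trans ?_
    have h : (m + 1) ^ 2 ≤ 2 * (m ^ 2 + 1) := by
      zify
      nlinarith [sq_nonneg ((m : ℤ) - 1)]
    calc C * (m + 1) ^ 2 ≤ C * (2 * (m ^ 2 + 1)) := Nat.mul_le_mul_left _ h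
      _ = 2 * C * (m ^ 2 + 1) := by ring
  · intro e he
    rw [hE] at he
    exact h1 e he
  all_goals
    have hm : ∀ {e}, G.Inc e x → (EdgeList.mk m (id ∘ s.arr 0) (id ∘ s.arr 1)).Inc e x := by
      intro e he
      have hem : e < m := by
        have := he.edge_mem
        rwa [hE] at this
      refine ⟨hem, ?_⟩
      rcases he.eq_or_eq_of_isLink (hab e hem) with h | h
      · exact .inl ((ha e hem).trans h.symm)
      · exact .inr ((hb e hem).trans h.symm)
    exact hm (by assumption)
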